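/- **Theory.** Terms are kept in $\beta$-normal form: $A,B,t,u ::= \mathsf{Set}\mid\mathsf{Bool}\mid\mathsf{true}\mid\mathsf{false}\mid(x:A)\to B\mid\lambda x\to t\mid n$, with neutral terms $n ::= x\mid\alpha\mid n\,t\mid \mathbf{if}\ n\,/x.A\ \mathbf{then}\ t\ \mathbf{else}\ u$, where $x$ is a variable and $\alpha$ a metavariable. A context $\Gamma$ is a list of $x:A$; a signature $\Sigma,\Xi$ is a list of $\alpha:A$ with $A$ closed and no name repeated. Substitution of terms for variables or metavariables is hereditary: it contracts at once the redexes $(\lambda x\to t)\,u$ and $\mathbf{if}\ \mathsf{true}/\mathsf{false}\dots$ that it creates. It is a partial operation, as $\mathsf{Set}:\mathsf{Set}$; below, $t\,u$, $B[x:=t]$ and $\sigma t$ denote the resulting normal forms, and a judgment involving them presupposes that they exist. Write $\Gamma\to A$ for the iterated function type and $\alpha\,\Gamma$ for $\alpha$ applied to all variables of $\Gamma$. *Typing* $\Sigma;\Gamma\vdash t:A$ and, for neutral terms, inference $\Sigma;\Gamma\vdash n\Rightarrow A$: $\mathsf{Set},\mathsf{Bool}:\mathsf{Set}$; $\mathsf{true},\mathsf{false}:\mathsf{Bool}$;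 $(x:A)\to B:\mathsf{Set}$ if $A:\mathsf{Set}$ and $\Gamma,x:A\vdash B:\mathsf{Set}$; $\lambda x\to t:(x:A)\to B$ if $\Gamma,x:A\vdash t:B$; $n:B$ if $n\Rightarrow A$ and $A\equiv B:\mathsf{Set}$. Variables and metavariables infer their declared types; $n\,t\Rightarrow B[x:=t]$ if $n\Rightarrow(x:A)\to B$ and $t:A$; $\mathbf{if}\ n\,/x.A\ \mathbf{then}\ t\ \mathbf{else}\ u\Rightarrow A[x:=n]$ if $n\Rightarrow\mathsf{Bool}$, $\Gamma,x:\mathsf{Bool}\vdash A:\mathsf{Set}$, $t:A[x:=\mathsf{true}]$ and $u:A[x:=\mathsf{false}]$. *Definitional equality* $\Sigma;\Gamma\vdash t\equiv u:A$ and $\Sigma;\Gamma\vdash n\equiv n'\Rightarrow A$ is generated by the congruence rules for $\mathsf{Set},\mathsf{Bool},\mathsf{true},\mathsf{false}$, function types (second components compared in $\Gamma,x:A_1$), variables and metavariables (with their declared types), application ($n\,t\equiv n'\,t'\Rightarrow B[x:=t]$ if $n\equiv n'\Rightarrow(x:A)\to B$ and $t\equiv t':A$) and $\mathbf{if}$ (typed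 by its left-hand side as above), together with the rules: $f\equiv g:(x:A)\to B$ if $\Gamma,x:A\vdash f\,x\equiv g\,x:B$; and $n\equiv n':B$ if $n\equiv n'\Rightarrow A$ and $A\equiv B:\mathsf{Set}$. A signature is well formed ($\vdash\Sigma$) if each type in it has type $\mathsf{Set}$ in the empty context over the preceding declarations; a context is well formed ($\Sigma\vdash\Gamma$) if each type in it has type $\mathsf{Set}$ in the preceding context. An omitted signature is empty. **Elaboration.** The judgments $[\![\Sigma;\Gamma\vdash t]\!]\leadsto\Xi\mid\mathcal C\vdash t'\Rightarrow A$ (inference) and $[\![\Sigma;\Gamma\vdash t\Leftarrow A]\!]\leadsto\Xi\mid\mathcal C\vdash t'$ (checking) produce an extended signature $\Xi$ and a set $\mathcal C$ of constraints $\Delta\vdash u:B=u':B'$. In the rules below the signature is threaded through the premises from left to right, the constraints of the premises are united, and $\alpha:=\mathrm{Fresh}(\Delta,B)$ extends the current signature by $\alpha:\Delta\to B$ with $\alpha$ a new name, later occurrences of $\alpha$ meaning $\alpha\,\Delta$. * *Checking* $t\Leftarrow A$: infer $t\leadsto u\Rightarrow B$, let $\alpha:=\mathrm{Fresh}(\Gamma,A)$,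 return $\alpha\,\Gamma$ and add the constraint $\Gamma\vdash u:B=\alpha\,\Gamma:A$. * *Inference*: $\mathsf{Set},\mathsf{Bool}$ (type $\mathsf{Set}$), $\mathsf{true},\mathsf{false}$ (type $\mathsf{Bool}$), $x:A\in\Gamma$ and $\alpha:A\in\Sigma$ (type $A$) are returned unchanged. * $(x:A)\to B$: check $A\Leftarrow\mathsf{Set}$ giving $A'$, and $B\Leftarrow\mathsf{Set}$ in $\Gamma,x:A'$ giving $B'$; return $(x:A')\to B'\Rightarrow\mathsf{Set}$. * $\lambda x\to t$: let $\beta:=\mathrm{Fresh}(\Gamma,\mathsf{Set})$ and $\gamma:=\mathrm{Fresh}((\Gamma,x:\beta),\mathsf{Set})$; check $t\Leftarrow\gamma$ in $\Gamma,x:\beta$ giving $u$; return $\lambda x\to u\Rightarrow(x:\beta)\to\gamma$. * $n\,u$: with $\beta,\gamma$ as before, check $n\Leftarrow(x:\beta)\to\gamma$ giving $t$, and $u\Leftarrow\beta$ giving $v$; return $t\,v\Rightarrow\gamma[x:=v]$. * $\mathbf{if}\ n\,/x.B\ \mathbf{then}\ u\ \mathbf{else}\ v$: check $B\Leftarrow\mathsf{Set}$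 in $\Gamma,x:\mathsf{Bool}$ giving $B'$, $n\Leftarrow\mathsf{Bool}$ giving $t$, $u\Leftarrow B'[x:=\mathsf{true}]$ giving $u'$, and $v\Leftarrow B'[x:=\mathsf{false}]$ giving $v'$; return $\mathbf{if}\ t\,/x.B'\ \mathbf{then}\ u'\ \mathbf{else}\ v'\Rightarrow B'[x:=t]$. **Lemma (Strong soundness of elaboration).** Let $\vdash\Sigma$ and $\Sigma\vdash\Gamma$, and let $t$ be a term whose free variables are in $\Gamma$ and whose metavariables are in $\mathrm{dom}(\Sigma)$. Let $\sigma$ be a closing untyped substitution (a partial map from metavariables to closed terms without metavariables) with $\mathrm{dom}(\sigma)\supseteq\mathrm{dom}(\Xi)$ which * is well typed on $\Sigma$, i.e. $\vdash\sigma:\Sigma$: for each $(\alpha:B)\in\Sigma$, $\sigma\alpha$ and $\sigma B$ are defined and $\vdash\sigma\alpha:\sigma B$; * solves $\mathcal C$, i.e. $\Vdash\sigma\mathcal C$: for each constraint $\Delta\vdash u:B=u':B'$ in $\mathcal C$, the instances under $\sigma$ are defined, $\sigma\Delta\vdash\sigma B\equiv\sigma B':\mathsf{Set}$ and $\sigma\Delta\vdash\sigma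 u\equiv\sigma u':\sigma B$. (No typing of $\sigma$ on $\Xi\setminus\Sigma$ is assumed.) Suppose that $\sigma\Gamma,\sigma t,\sigma t',\sigma A$ are defined and that the context $\sigma\Gamma$ is well formed. 1. If $[\![\Sigma;\Gamma\vdash t]\!]\leadsto\Xi\mid\mathcal C\vdash t'\Rightarrow A$ and $\sigma\Gamma\vdash\sigma A:\mathsf{Set}$ and, in case $t$ is an application $n\,u$ for which $\sigma n$ is a $\lambda$-abstraction, moreover $\sigma\Gamma\vdash\sigma t':\sigma A$, then $\sigma\Gamma\vdash\sigma t\equiv\sigma t':\sigma A$. 2. If $[\![\Sigma;\Gamma\vdash t\Leftarrow A]\!]\leadsto\Xi\mid\mathcal C\vdash t'$, then $\sigma\Gamma\vdash\sigma t\equiv\sigma t':\sigma A$. -/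

import Mathlib

/-! A dependent type theory with booleans, one universe `Set : Set` and metavariables, with terms
kept in beta-normal form (hereditary substitution), and the elaboration of type-checking problems
into unification constraints. Variables are de Bruijn indices; metavariables are named by `ℕ`. -/

namespace TCU

/-- The two syntactic classes: terms (which are also the types) and neutral terms. -/
inductive Cls
  | tm
  | ne

/-- Beta-normal expressions of the two classes. `pi A B` is `(x : A) → B`, and
`ite n A t u` is `if n / x. A then t else u`; `B`, the body of `lam`, and the `A` of `ite` are
under one binder. -/
inductive Exp : Cls → Type
  | univ : Exp .tm
  | bool : Exp .tm
  | tt : Exp .tm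
  | ff : Exp .tm
  | pi (A B : Exp .tm) : Exp .tm
  | lam (t : Exp .tm) : Exp .tm
  | neu (n : Exp .ne) : Exp .tm
  | var (i : ℕ) : Exp .ne
  | mvar (α : ℕ) : Exp .ne
  | app (n : Exp .ne) (t : Exp .tm) : Exp .ne
  | ite (n : Exp .ne) (A t u : Exp .tm) : Exp .ne

abbrev Tm := Exp .tm
abbrev Ne := Exp .ne

open Exp

/-- Extension of a renaming under a binder. -/
def liftRen (ρ : ℕ → ℕ) : ℕ → ℕ
  | 0 => 0
  | i + 1 => ρ i + 1

/-- Renaming of the variables (this never creates a redex). -/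
def Exp.rename {c : Cls} (ρ : ℕ → ℕ) : Exp c → Exp c
  | univ => univ
  | bool => bool
  | tt => tt
  | ff => ff
  | pi A B => pi (A.rename ρ) (B.rename (liftRen ρ))
  | lam t => lam (t.rename (liftRen ρ))
  | neu n => neu (n.rename ρ)
  | var i => var (ρ i)
  | mvar α => mvar α
  | app n t => app (n.rename ρ) (t.rename ρ)
  | ite n A t u => ite (n.rename ρ) (A.rename (liftRen ρ)) (t.rename ρ) (u.rename ρ)

/-- Weakening by one variable. -/
def Exp.shift {c : Cls} (t : Exp c) : Exp c := t.rename Nat.succ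

/-- All free variables are below `k` and all metavariables belong to `M`. -/
def Exp.Scoped {c : Cls} (M : Set ℕ) (k : ℕ) : Exp c → Prop
  | univ => True
  | bool => True
  | tt => True
  | ff => True
  | pi A B => A.Scoped M k ∧ B.Scoped M (k + 1)
  | lam t => t.Scoped M (k + 1)
  | neu n => n.Scoped M k
  | var i => i < k
  | mvar α => α ∈ M
  | app n t => n.Scoped M k ∧ t.Scoped M k
  | ite n A t u => n.Scoped M k ∧ A.Scoped M (k + 1) ∧ t.Scoped M k ∧ u.Scoped M k

/-! ### Hereditary substitution -/

/-- A simultaneous substitution for the heads: variables and metavariables. -/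
structure Sub where
  var : ℕ → Tm
  mvar : ℕ → Tm

/-- Extension of a substitution under a binder. -/
def Sub.lift (s : Sub) : Sub where
  var
    | 0 => neu (.var 0)
    | i + 1 => (s.var i).shift
  mvar α := (s.mvar α).shift

/-- The substitution `[x := u]` for the last variable of the context. -/
def Sub.one (u : Tm) : Sub where
  var
    | 0 => u
    | i + 1 => neu (.var i)
  mvar α := neu (.mvar α)

/-- Elimination of `Bool`: `IfElim w A u v r` says that `if w / x. A then u else v` normalizes
to `r`. -/
inductive IfElim : Tm → Tm → Tm → Tm → Tm → Prop
  | tt {A u v : Tm} : IfElim tt A u v u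
  | ff {A u v : Tm} : IfElim ff A u v v
  | neu {n : Ne} {A u v : Tm} : IfElim (neu n) A u v (neu (ite n A u v))

mutual

/-- Hereditary substitution: `HSub s t t'` says that applying `s` to `t` gives the normal
form `t'`. As the theory has `Set : Set`, this is only a partial function. -/
inductive HSub : {c : Cls} → Sub → Exp c → Tm → Prop
  | univ {s : Sub} : HSub s univ univ
  | bool {s : Sub} : HSub s bool bool
  | tt {s : Sub} : HSub s tt tt
  | ff {s : Sub} : HSub s ff ff
  | pi {s : Sub} {A B A' B' : Tm} :
      HSub s A A' → HSub s.lift B B' → HSub s (pi A B) (pi A' B')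
  | lam {s : Sub} {t t' : Tm} : HSub s.lift t t' → HSub s (lam t) (lam t')
  | neu {s : Sub} {n : Ne} {t : Tm} : HSub s n t → HSub s (neu n) t
  | var {s : Sub} {i : ℕ} : HSub s (var i) (s.var i)
  | mvar {s : Sub} {α : ℕ} : HSub s (mvar α) (s.mvar α)
  | app {s : Sub} {n : Ne} {u v u' r : Tm} :
      HSub s n v → HSub s u u' → AppElim v u' r → HSub s (app n u) r
  | ite {s : Sub} {n : Ne} {A u v w A' u' v' r : Tm} :
      HSub s n w → HSub s.lift A A' → HSub s u u' → HSub s v v' → IfElim w A' u' v' r →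
      HSub s (ite n A u v) r

/-- Elimination of functions: `AppElim t u r` says that `t u` normalizes to `r`. -/
inductive AppElim : Tm → Tm → Tm → Prop
  | lam {t u r : Tm} : HSub (Sub.one u) t r → AppElim (lam t) u r
  | neu {n : Ne} {u : Tm} : AppElim (neu n) u (neu (app n u))

end

/-! ### Contexts, signatures, conversion and typing -/

/-- Contexts; the most recent variable comes first, and each type lives in the context formed by
the rest of the list. -/
abbrev Ctx := List Tm

/-- Signatures; the most recent metavariable comes first. -/
abbrev Sig := List (ℕ × Tm)

/-- The metavariables declared by a signature. -/
def Sig.dom (S : Sig) : Set ℕ := {α | ∃ A, (α, A) ∈ S}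

/-- `Lookup Γ i A` is `x : A ∈ Γ`, for `x` the variable with index `i`. -/
inductive Lookup : Ctx → ℕ → Tm → Prop
  | zero {Γ : Ctx} {A : Tm} : Lookup (A :: Γ) 0 A.shift
  | succ {Γ : Ctx} {A B : Tm} {i : ℕ} : Lookup Γ i B → Lookup (A :: Γ) (i + 1) B.shift

/-- Definitional equality: on terms, `Conv S Γ t u A` is `S; Γ ⊢ t ≡ u : A`; on neutral terms,
`Conv S Γ n n' A` is `S; Γ ⊢ n ≡ n' ⇒ A`. -/
inductive Conv (S : Sig) : {c : Cls} → Ctx → Exp c → Exp c → Tm → Prop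
  | univ {Γ : Ctx} : Conv S Γ univ univ univ
  | bool {Γ : Ctx} : Conv S Γ bool bool univ
  | tt {Γ : Ctx} : Conv S Γ tt tt bool
  | ff {Γ : Ctx} : Conv S Γ ff ff bool
  | pi {Γ : Ctx} {A₁ A₂ B₁ B₂ : Tm} :
      Conv S Γ A₁ A₂ univ → Conv S (A₁ :: Γ) B₁ B₂ univ →
      Conv S Γ (pi A₁ B₁) (pi A₂ B₂) univ
  | eta {Γ : Ctx} {A B f g f' g' : Tm} :
      AppElim f.shift (neu (var 0)) f' → AppElim g.shift (neu (var 0)) g' →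
      Conv S (A :: Γ) f' g' B → Conv S Γ f g (pi A B)
  | neu {Γ : Ctx} {n n' : Ne} {A B : Tm} :
      Conv S Γ n n' A → Conv S Γ A B univ → Conv S Γ (neu n) (neu n') B
  | var {Γ : Ctx} {i : ℕ} {A : Tm} : Lookup Γ i A → Conv S Γ (var i) (var i) A
  | mvar {Γ : Ctx} {α : ℕ} {A : Tm} : (α, A) ∈ S → Conv S Γ (mvar α) (mvar α) A
  | app {Γ : Ctx} {n n' : Ne} {t t' A B C : Tm} :
      Conv S Γ n n' (pi A B) → Conv S Γ t t' A → HSub (Sub.one t) B C →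
      Conv S Γ (app n t) (app n' t') C
  | ite {Γ : Ctx} {n n' : Ne} {A A' t t' u u' At Af C : Tm} :
      Conv S Γ n n' bool → Conv S (bool :: Γ) A A' univ →
      HSub (Sub.one tt) A At → Conv S Γ t t' At →
      HSub (Sub.one ff) A Af → Conv S Γ u u' Af →
      HSub (Sub.one (neu n)) A C →
      Conv S Γ (ite n A t u) (ite n' A' t' u') C

/-- Typing: on terms, `Typed S Γ t A` is checking, `S; Γ ⊢ t : A`; on neutral terms,
`Typed S Γ n A` is inference, `S; Γ ⊢ n ⇒ A`. -/
inductive Typed (S : Sig) : {c : Cls} → Ctx → Exp c → Tm → Prop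
  | univ {Γ : Ctx} : Typed S Γ univ univ
  | bool {Γ : Ctx} : Typed S Γ bool univ
  | tt {Γ : Ctx} : Typed S Γ tt bool
  | ff {Γ : Ctx} : Typed S Γ ff bool
  | pi {Γ : Ctx} {A B : Tm} :
      Typed S Γ A univ → Typed S (A :: Γ) B univ → Typed S Γ (pi A B) univ
  | lam {Γ : Ctx} {t A B : Tm} : Typed S (A :: Γ) t B → Typed S Γ (lam t) (pi A B)
  | neu {Γ : Ctx} {n : Ne} {A B : Tm} :
      Typed S Γ n A → Conv S Γ A B univ → Typed S Γ (neu n) B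
  | var {Γ : Ctx} {i : ℕ} {A : Tm} : Lookup Γ i A → Typed S Γ (var i) A
  | mvar {Γ : Ctx} {α : ℕ} {A : Tm} : (α, A) ∈ S → Typed S Γ (mvar α) A
  | app {Γ : Ctx} {n : Ne} {t A B C : Tm} :
      Typed S Γ n (pi A B) → Typed S Γ t A → HSub (Sub.one t) B C → Typed S Γ (app n t) C
  | ite {Γ : Ctx} {n : Ne} {A t u At Af C : Tm} :
      Typed S Γ n bool → Typed S (bool :: Γ) A univ →
      HSub (Sub.one tt) A At → Typed S Γ t At →
      HSub (Sub.one ff) A Af → Typed S Γ u Af →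
      HSub (Sub.one (neu n)) A C → Typed S Γ (ite n A t u) C

/-- Well-formed signatures, without repeated names. -/
inductive SigOk : Sig → Prop
  | nil : SigOk []
  | cons {S : Sig} {α : ℕ} {A : Tm} :
      SigOk S → α ∉ S.dom → Typed S [] A univ → SigOk ((α, A) :: S)

/-- Well-formed contexts over a signature. -/
inductive CtxOk (S : Sig) : Ctx → Prop
  | nil : CtxOk S []
  | cons {Γ : Ctx} {A : Tm} : CtxOk S Γ → Typed S Γ A univ → CtxOk S (A :: Γ)

/-! ### Metavariable substitutions -/

/-- Untyped metavariable substitutions, as partial maps. -/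
abbrev MSub := ℕ → Option Tm

def MSub.dom (σ : MSub) : Set ℕ := {α | ∃ u, σ α = some u}

/-- All the instantiations are closed terms without metavariables. -/
def MSub.Closing (σ : MSub) : Prop := ∀ α u, σ α = some u → u.Scoped ∅ 0

/-- The action of a metavariable substitution on heads. -/
def MSub.toSub (σ : MSub) : Sub where
  var i := neu (.var i)
  mvar α := (σ α).getD (neu (.mvar α))

/-- `σ.Inst t t'` says that `σ t` is defined and equal to `t'`. -/
def MSub.Inst (σ : MSub) (t t' : Tm) : Prop := HSub σ.toSub t t'

/-- `σ.InstCtx Γ Γ'` says that `σ Γ` is defined and equal to `Γ'`. -/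
def MSub.InstCtx (σ : MSub) (Γ Γ' : Ctx) : Prop := List.Forall₂ σ.Inst Γ Γ'

/-- `⊢ σ : S`, over the empty signature. -/
def MSub.WellTyped (σ : MSub) (S : Sig) : Prop :=
  ∀ α A, (α, A) ∈ S → ∃ u A', σ α = some u ∧ σ.Inst A A' ∧ Typed [] [] u A'

/-! ### Constraints and elaboration -/

/-- The heterogeneous constraint `ctx ⊢ lhs : lhsTy = rhs : rhsTy`. -/
structure Constraint where
  ctx : Ctx
  lhs : Tm
  lhsTy : Tm
  rhs : Tm
  rhsTy : Tm

/-- `⊩ σ C`: over the empty signature, the instance under `σ` of each constraint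
`Γ ⊢ t : A = u : B` in `C` satisfies `Γ ⊢ A ≡ B : Set` and `Γ ⊢ t ≡ u : A`. -/
def MSub.Solves (σ : MSub) (C : Set Constraint) : Prop :=
  ∀ c ∈ C, ∃ Γ t A u B, σ.InstCtx c.ctx Γ ∧ σ.Inst c.lhs t ∧ σ.Inst c.lhsTy A ∧
    σ.Inst c.rhs u ∧ σ.Inst c.rhsTy B ∧ Conv [] Γ A B univ ∧ Conv [] Γ t u A

/-- The iterated function type `Γ → A`. -/
def piCtx : Ctx → Tm → Tm
  | [], A => A
  | B :: Γ, A => piCtx Γ (pi B A)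

/-- `α Γ`: the metavariable `α` applied to all the variables of `Γ`, oldest first. -/
def mvApp (α : ℕ) (Γ : Ctx) : Tm :=
  neu ((List.range Γ.length).foldr (fun i n => app n (neu (var i))) (mvar α))

/-- The signature `S, α : Γ → A`. -/
def Sig.add (S : Sig) (α : ℕ) (Γ : Ctx) (A : Tm) : Sig := (α, piCtx Γ A) :: S

mutual

/-- Elaboration in inference mode: `Infer S Γ t Ξ C t' A` is `⟦S; Γ ⊢ t⟧ ⇝ Ξ | C ⊢ t' ⇒ A`. -/
inductive Infer : Sig → Ctx → Tm → Sig → Set Constraint → Tm → Tm → Prop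
  | univ {S : Sig} {Γ : Ctx} : Infer S Γ univ S ∅ univ univ
  | bool {S : Sig} {Γ : Ctx} : Infer S Γ bool S ∅ bool univ
  | tt {S : Sig} {Γ : Ctx} : Infer S Γ tt S ∅ tt bool
  | ff {S : Sig} {Γ : Ctx} : Infer S Γ ff S ∅ ff bool
  | pi {S S₁ S₂ : Sig} {Γ : Ctx} {A B A' B' : Tm} {C₁ C₂ : Set Constraint} :
      Check S Γ A univ S₁ C₁ A' → Check S₁ (A' :: Γ) B univ S₂ C₂ B' →
      Infer S Γ (pi A B) S₂ (C₁ ∪ C₂) (pi A' B') univ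
  | lam {S S₁ S₂ Ξ : Sig} {Γ : Ctx} {β γ : ℕ} {t t' : Tm} {C : Set Constraint} :
      β ∉ S.dom → S₁ = S.add β Γ univ →
      γ ∉ S₁.dom → S₂ = S₁.add γ (mvApp β Γ :: Γ) univ →
      Check S₂ (mvApp β Γ :: Γ) t (mvApp γ (mvApp β Γ :: Γ)) Ξ C t' →
      Infer S Γ (lam t) Ξ C (lam t') (pi (mvApp β Γ) (mvApp γ (mvApp β Γ :: Γ)))
  | var {S : Sig} {Γ : Ctx} {i : ℕ} {A : Tm} :
      Lookup Γ i A → Infer S Γ (neu (var i)) S ∅ (neu (var i)) A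
  | mvar {S : Sig} {Γ : Ctx} {α : ℕ} {A : Tm} :
      (α, A) ∈ S → Infer S Γ (neu (mvar α)) S ∅ (neu (mvar α)) A
  | app {S S₁ S₂ S₃ Ξ : Sig} {Γ : Ctx} {β γ : ℕ} {n : Ne} {u t v r A : Tm}
      {C₁ C₂ : Set Constraint} :
      β ∉ S.dom → S₁ = S.add β Γ univ →
      γ ∉ S₁.dom → S₂ = S₁.add γ (mvApp β Γ :: Γ) univ →
      Check S₂ Γ (neu n) (pi (mvApp β Γ) (mvApp γ (mvApp β Γ :: Γ))) S₃ C₁ t →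
      Check S₃ Γ u (mvApp β Γ) Ξ C₂ v →
      AppElim t v r → HSub (Sub.one v) (mvApp γ (mvApp β Γ :: Γ)) A →
      Infer S Γ (neu (app n u)) Ξ (C₁ ∪ C₂) r A
  | ite {S S₁ S₂ S₃ Ξ : Sig} {Γ : Ctx} {n : Ne} {B u v B' t u' v' Bt Bf r A : Tm}
      {C₁ C₂ C₃ C₄ : Set Constraint} :
      Check S (bool :: Γ) B univ S₁ C₁ B' →
      Check S₁ Γ (neu n) bool S₂ C₂ t →
      HSub (Sub.one tt) B' Bt → Check S₂ Γ u Bt S₃ C₃ u' →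
      HSub (Sub.one ff) B' Bf → Check S₃ Γ v Bf Ξ C₄ v' →
      IfElim t B' u' v' r → HSub (Sub.one t) B' A →
      Infer S Γ (neu (ite n B u v)) Ξ (C₁ ∪ C₂ ∪ C₃ ∪ C₄) r A

/-- Elaboration in checking mode: `Check S Γ t A Ξ C t'` is `⟦S; Γ ⊢ t ⇐ A⟧ ⇝ Ξ | C ⊢ t'`.
The elaborated term is a fresh metavariable applied to `Γ`, which is equated to the result of
inference by a new constraint. -/
inductive Check : Sig → Ctx → Tm → Tm → Sig → Set Constraint → Tm → Prop
  | mk {S Ξ : Sig} {Γ : Ctx} {t A t' B : Tm} {C : Set Constraint} {α : ℕ} :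
      Infer S Γ t Ξ C t' B → α ∉ Ξ.dom →
      Check S Γ t A (Ξ.add α Γ A) (insert ⟨Γ, t', B, mvApp α Γ, A⟩ C) (mvApp α Γ)

end

end TCU

-- Definitional equality is typed and syntax-directed, without rules for symmetry or transitivity,
-- and hereditary substitution is partial because of `Set : Set`. The proof therefore relates it to
-- an untyped conversion that has the closure properties by construction. Raw terms may contain
-- redexes, and `Cv` means having a common reduct under beta, eta and the reductions of `ite`. By
-- the diamond property (`Par.diamond`) it is a congruence for which function types are injective
-- and distinct from `univ` and `bool`. Hereditary substitution yields a normal form convertible to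
-- the raw substitution (`HSub.cv`). Two type systems sit on top: the declarative `RTyped`, closed
-- under conversion, and the algorithmic `AlgTyped`, which is the typing of the theory with `Cv` in
-- place of definitional equality.
--
-- The crux is that conversion of typed terms preserves the definedness of hereditary substitution.
-- Between normal forms only eta-reduction is left, so convertible normal forms have a common
-- eta-reduct (`Cv.exists_etas`). A derivation of hereditary substitution can be carried down along
-- eta-reductions without typing (`HSub.eta`), and up along eta-expansions between typed terms,
-- since typing keeps abstractions away from the scrutinee of `ite` (`HSub.of_eta`). Together these
-- give `HSub.exists_of_cv`. It follows that algorithmic typing passes from a term to any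
-- convertible, declaratively typed one, and that such terms are definitionally equal
-- (`Alg.conv_size`); conversely, definitionally equal terms are algorithmically typed and
-- convertible (`Conv.algTyped`).
--
-- Soundness is then an induction on elaboration (`Infer.sound`) whose invariant is that the
-- instances of the source and of the elaborated term are algorithmically typed and convertible. No
-- typing of `σ` on fresh metavariables is needed: each check emits a constraint, and a solved
-- constraint types both of its sides (`InferSound.check`). Types substituted into during
-- elaboration have the form `α (Γ, x)`, for which instantiation commutes with substitution
-- (`HSub.one_mvApp_inst`). The delicate case is an application whose function becomes an
-- abstraction: contraction is shown to preserve declarative typing only. The missing algorithmic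
-- typing of the elaborated term comes from the constraint at inner nodes and from the extra
-- hypothesis at the root.

namespace TCU
open Exp

/-! ### Raw terms, with redexes -/

/-- Raw terms: the expressions of the theory, not necessarily in normal form. -/
inductive Raw : Type
  | univ : Raw
  | bool : Raw
  | tt : Raw
  | ff : Raw
  | pi (A B : Raw) : Raw
  | lam (t : Raw) : Raw
  | var (i : ℕ) : Raw
  | mvar (α : ℕ) : Raw
  | app (n t : Raw) : Raw
  | ite (n A t u : Raw) : Raw

namespace Raw

/-- Renaming of raw terms. -/
def rename (ρ : ℕ → ℕ) : Raw → Raw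
  | univ => univ
  | bool => bool
  | tt => tt
  | ff => ff
  | pi A B => pi (A.rename ρ) (B.rename (liftRen ρ))
  | lam t => lam (t.rename (liftRen ρ))
  | var i => var (ρ i)
  | mvar α => mvar α
  | app n t => app (n.rename ρ) (t.rename ρ)
  | ite n A t u => ite (n.rename ρ) (A.rename (liftRen ρ)) (t.rename ρ) (u.rename ρ)

/-- Extension of a raw substitution under a binder. -/
def up (s : ℕ → Raw) : ℕ → Raw
  | 0 => var 0
  | i + 1 => (s i).rename Nat.succ

/-- Simultaneous substitution for the variables of a raw term. -/
def subst (s : ℕ → Raw) : Raw → Raw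
  | univ => univ
  | bool => bool
  | tt => tt
  | ff => ff
  | pi A B => pi (A.subst s) (B.subst (up s))
  | lam t => lam (t.subst (up s))
  | var i => s i
  | mvar α => mvar α
  | app n t => app (n.subst s) (t.subst s)
  | ite n A t u => ite (n.subst s) (A.subst (up s)) (t.subst s) (u.subst s)

/-- The substitution `[x := u]` for the last variable. -/
def one (u : Raw) : ℕ → Raw
  | 0 => u
  | i + 1 => var i

/-- Number of constructors. -/
def size : Raw → ℕ
  | univ => 1
  | bool => 1
  | tt => 1
  | ff => 1
  | pi A B => A.size + B.size + 1
  | lam t => t.size + 1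
  | var _ => 1
  | mvar _ => 1
  | app n t => n.size + t.size + 1
  | ite n A t u => n.size + A.size + t.size + u.size + 1

/-- The variable `i` occurs freely. -/
def Occurs : Raw → ℕ → Prop
  | univ, _ => False
  | bool, _ => False
  | tt, _ => False
  | ff, _ => False
  | pi A B, i => A.Occurs i ∨ B.Occurs (i + 1)
  | lam t, i => t.Occurs (i + 1)
  | var j, i => i = j
  | mvar _, _ => False
  | app n t, i => n.Occurs i ∨ t.Occurs i
  | ite n A t u, i => n.Occurs i ∨ A.Occurs (i + 1) ∨ t.Occurs i ∨ u.Occurs i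

end Raw

theorem liftRen_comp (ρ ρ' : ℕ → ℕ) :
    liftRen ρ' ∘ liftRen ρ = liftRen (ρ' ∘ ρ) := by
  funext i; cases i <;> rfl

theorem liftRen_id : liftRen id = id := by
  funext i; cases i <;> rfl

theorem liftRen_injective {ρ : ℕ → ℕ} (h : ρ.Injective) : (liftRen ρ).Injective := by
  intro i j e
  cases i <;> cases j <;> simp_all [liftRen]
  exact h e

namespace Raw

theorem up_var (ρ : ℕ → ℕ) : up (fun i => var (ρ i)) = fun i => var (liftRen ρ i) := by
  funext i; cases i <;> rfl

theorem rename_eq_subst (t : Raw) : ∀ ρ, t.rename ρ = t.subst (fun i => var (ρ i)) := by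
  induction t <;> intro ρ <;> simp_all [rename, subst, up_var]

theorem rename_rename (t : Raw) : ∀ ρ ρ', (t.rename ρ).rename ρ' = t.rename (ρ' ∘ ρ) := by
  induction t <;> intro ρ ρ' <;> simp_all [rename, liftRen_comp]

theorem up_comp_liftRen (ρ : ℕ → ℕ) (s : ℕ → Raw) :
    (fun i => up s (liftRen ρ i)) = up (fun i => s (ρ i)) := by
  funext i; cases i <;> rfl

theorem subst_rename (t : Raw) :
    ∀ (ρ : ℕ → ℕ) s, (t.rename ρ).subst s = t.subst (fun i => s (ρ i)) := by
  induction t <;> intro ρ s <;> simp_all [rename, subst, up_comp_liftRen]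

theorem up_rename (ρ : ℕ → ℕ) (s : ℕ → Raw) :
    (fun i => (up s i).rename (liftRen ρ)) = up (fun i => (s i).rename ρ) := by
  funext i; cases i
  · rfl
  · simp only [up, rename_rename]; rfl

theorem rename_subst (t : Raw) :
    ∀ (ρ : ℕ → ℕ) s, (t.subst s).rename ρ = t.subst (fun i => (s i).rename ρ) := by
  induction t <;> intro ρ s <;> simp_all [rename, subst, up_rename]

theorem up_subst (s s' : ℕ → Raw) :
    (fun i => (up s i).subst (up s')) = up (fun i => (s i).subst s') := by
  funext i; cases i
  · rfl
  · simp only [up, rename_subst, subst_rename]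

theorem subst_subst (t : Raw) :
    ∀ s s', (t.subst s).subst s' = t.subst (fun i => (s i).subst s') := by
  induction t <;> intro s s' <;> simp_all [subst, up_subst]

theorem up_id : up var = var := by
  funext i; cases i <;> rfl

theorem subst_var (t : Raw) : t.subst var = t := by
  induction t <;> simp_all [subst, up_id]

theorem subst_succ_one (t u : Raw) : (t.rename Nat.succ).subst (one u) = t := by
  rw [subst_rename]; exact subst_var t

theorem subst_one_subst (t u : Raw) (s : ℕ → Raw) :
    (t.subst (one u)).subst s = (t.subst (up s)).subst (one (u.subst s)) := by
  rw [subst_subst, subst_subst]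
  congr 1; funext i; cases i
  · rfl
  · simp only [one, up, subst_succ_one]; rfl

theorem subst_one_rename (t u : Raw) (ρ : ℕ → ℕ) :
    (t.subst (one u)).rename ρ = (t.rename (liftRen ρ)).subst (one (u.rename ρ)) := by
  rw [rename_subst, subst_rename]
  congr 1; funext i; cases i <;> rfl

theorem rename_lift_succ_one (t : Raw) :
    (t.rename (liftRen Nat.succ)).subst (one (var 0)) = t := by
  rw [subst_rename]
  have : (fun i => one (var 0) (liftRen Nat.succ i)) = var := by funext i; cases i <;> rfl
  rw [this, subst_var]

theorem size_rename (t : Raw) : ∀ ρ, (t.rename ρ).size = t.size := by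
  induction t <;> intro ρ <;> simp_all [rename, size]

theorem rename_injective {ρ : ℕ → ℕ} (h : ρ.Injective) : (rename ρ).Injective := by
  have hl : ∀ i, Function.invFun ρ (ρ i) = i := Function.leftInverse_invFun h
  intro t u e
  have := congrArg (subst (fun i => var (Function.invFun ρ i))) e
  simpa only [subst_rename, hl, subst_var] using this

theorem occurs_rename (t : Raw) : ∀ ρ i, (t.rename ρ).Occurs i → ∃ j, i = ρ j ∧ t.Occurs j := by
  have key : ∀ (t : Raw) (ρ : ℕ → ℕ) (i : ℕ),
      (∀ ρ i, (t.rename ρ).Occurs i → ∃ j, i = ρ j ∧ t.Occurs j) →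
      (t.rename (liftRen ρ)).Occurs (i + 1) → ∃ j, i = ρ j ∧ t.Occurs (j + 1) := by
    intro t ρ i ih h
    obtain ⟨j, hj, ho⟩ := ih _ _ h
    cases j with
    | zero => simp [liftRen] at hj
    | succ j => exact ⟨j, by simpa [liftRen] using hj, ho⟩
  induction t with
  | univ | bool | tt | ff | mvar => intro ρ i h; exact h.elim
  | var j => intro ρ i h; exact ⟨j, h, rfl⟩
  | lam t ih => intro ρ i h; exact key t ρ i ih h
  | pi A B ihA ihB =>
    intro ρ i h
    rcases h with h | h
    · obtain ⟨j, e, o⟩ := ihA _ _ h; exact ⟨j, e, .inl o⟩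
    · obtain ⟨j, e, o⟩ := key B ρ i ihB h; exact ⟨j, e, .inr o⟩
  | app n t ihn iht =>
    intro ρ i h
    rcases h with h | h
    · obtain ⟨j, e, o⟩ := ihn _ _ h; exact ⟨j, e, .inl o⟩
    · obtain ⟨j, e, o⟩ := iht _ _ h; exact ⟨j, e, .inr o⟩
  | ite n A t u ihn ihA iht ihu =>
    intro ρ i h
    rcases h with h | h | h | h
    · obtain ⟨j, e, o⟩ := ihn _ _ h; exact ⟨j, e, .inl o⟩
    · obtain ⟨j, e, o⟩ := key A ρ i ihA h; exact ⟨j, e, .inr (.inl o)⟩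
    · obtain ⟨j, e, o⟩ := iht _ _ h; exact ⟨j, e, .inr (.inr (.inl o))⟩
    · obtain ⟨j, e, o⟩ := ihu _ _ h; exact ⟨j, e, .inr (.inr (.inr o))⟩

theorem Occurs.rename {t : Raw} {i : ℕ} (h : t.Occurs i) (ρ : ℕ → ℕ) :
    (t.rename ρ).Occurs (ρ i) := by
  induction t generalizing ρ i with
  | univ | bool | tt | ff | mvar => exact h.elim
  | var j => exact congrArg ρ h
  | lam t ih => exact ih h (liftRen ρ)
  | pi A B ihA ihB => exact h.imp (ihA · ρ) fun h => ihB (i := i + 1) h (liftRen ρ)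
  | app n t ihn iht => exact h.imp (ihn · ρ) (iht · ρ)
  | ite n A t u ihn ihA iht ihu =>
    exact h.imp (ihn · ρ) (Or.imp (fun h => ihA (i := i + 1) h (liftRen ρ)) (Or.imp (iht · ρ) (ihu · ρ)))

theorem subst_congr {t : Raw} {s s' : ℕ → Raw} (h : ∀ i, t.Occurs i → s i = s' i) :
    t.subst s = t.subst s' := by
  have hup : ∀ (t : Raw) (s s' : ℕ → Raw), (∀ i, t.Occurs (i + 1) → s i = s' i) →
      ∀ i, t.Occurs i → up s i = up s' i := by
    intro t s s' h i hi
    cases i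
    · rfl
    · simp only [up, h _ hi]
  induction t generalizing s s' with
  | univ | bool | tt | ff | mvar => rfl
  | var j => exact h j rfl
  | lam t ih => exact congrArg lam (ih (hup _ _ _ h))
  | pi A B ihA ihB =>
    exact congrArg₂ pi (ihA fun i hi => h i (.inl hi)) (ihB (hup _ _ _ fun i hi => h i (.inr hi)))
  | app n t ihn iht =>
    exact congrArg₂ app (ihn fun i hi => h i (.inl hi)) (iht fun i hi => h i (.inr hi))
  | ite n A t u ihn ihA iht ihu =>
    simp only [subst]
    rw [ihn fun i hi => h i (.inl hi), ihA (hup _ _ _ fun i hi => h i (.inr (.inl hi))),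
      iht fun i hi => h i (.inr (.inr (.inl hi))), ihu fun i hi => h i (.inr (.inr (.inr hi)))]

end Raw

/-! ### Parallel reduction -/

/-- Parallel reduction: beta, the reductions of `ite`, and eta. -/
inductive Par : Raw → Raw → Prop
  | univ : Par .univ .univ
  | bool : Par .bool .bool
  | tt : Par .tt .tt
  | ff : Par .ff .ff
  | pi {A A' B B' : Raw} : Par A A' → Par B B' → Par (.pi A B) (.pi A' B')
  | lam {t t' : Raw} : Par t t' → Par (.lam t) (.lam t')
  | var {i : ℕ} : Par (.var i) (.var i)
  | mvar {α : ℕ} : Par (.mvar α) (.mvar α)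
  | app {n n' t t' : Raw} : Par n n' → Par t t' → Par (.app n t) (.app n' t')
  | ite {n n' A A' t t' u u' : Raw} :
      Par n n' → Par A A' → Par t t' → Par u u' → Par (.ite n A t u) (.ite n' A' t' u')
  | beta {t t' u u' r : Raw} : Par t t' → Par u u' → r = t'.subst (.one u') →
      Par (.app (.lam t) u) r
  | iteTT {A t t' u : Raw} : Par t t' → Par (.ite .tt A t u) t'
  | iteFF {A t u u' : Raw} : Par u u' → Par (.ite .ff A t u) u'
  | eta {m n n' : Raw} : m = n.rename Nat.succ → Par n n' → Par (.lam (.app m (.var 0))) n'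

namespace Par

theorem refl (t : Raw) : Par t t := by
  induction t <;> constructor <;> assumption

theorem rename {t t' : Raw} (h : Par t t') : ∀ ρ, Par (t.rename ρ) (t'.rename ρ) := by
  induction h with
  | beta _ _ e ih₁ ih₂ =>
    intro ρ; subst e
    exact .beta (ih₁ _) (ih₂ _) (Raw.subst_one_rename _ _ _)
  | eta e _ ih =>
    intro ρ; subst e
    refine .eta ?_ (ih ρ)
    simp only [Raw.rename_rename]; rfl
  | iteTT _ ih => intro ρ; exact .iteTT (ih ρ)
  | iteFF _ ih => intro ρ; exact .iteFF (ih ρ)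
  | _ => intro ρ; constructor <;> apply_assumption

theorem subst {t t' : Raw} (h : Par t t') :
    ∀ {s s' : ℕ → Raw}, (∀ i, Par (s i) (s' i)) → Par (t.subst s) (t'.subst s') := by
  have hup : ∀ {s s' : ℕ → Raw}, (∀ i, Par (s i) (s' i)) → ∀ i, Par (Raw.up s i) (Raw.up s' i) := by
    intro s s' h i
    cases i
    · exact .var
    · exact (h _).rename _
  induction h with
  | univ | bool | tt | ff | mvar => intros; constructor
  | var => intro s s' hs; exact hs _
  | pi _ _ ih₁ ih₂ => intro s s' hs; exact .pi (ih₁ hs) (ih₂ (hup hs))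
  | lam _ ih => intro s s' hs; exact .lam (ih (hup hs))
  | app _ _ ih₁ ih₂ => intro s s' hs; exact .app (ih₁ hs) (ih₂ hs)
  | ite _ _ _ _ ih₁ ih₂ ih₃ ih₄ =>
    intro s s' hs; exact .ite (ih₁ hs) (ih₂ (hup hs)) (ih₃ hs) (ih₄ hs)
  | beta _ _ e ih₁ ih₂ =>
    intro s s' hs; subst e
    exact .beta (ih₁ (hup hs)) (ih₂ hs) (Raw.subst_one_subst _ _ _)
  | iteTT _ ih => intro s s' hs; exact .iteTT (ih hs)
  | iteFF _ ih => intro s s' hs; exact .iteFF (ih hs)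
  | eta e _ ih =>
    intro s s' hs; subst e
    refine .eta ?_ (ih hs)
    rw [Raw.subst_rename, Raw.rename_subst]; rfl

theorem subst_one {t t' u u' : Raw} (h : Par t t') (hu : Par u u') :
    Par (t.subst (.one u)) (t'.subst (.one u')) :=
  h.subst fun i => by cases i; exacts [hu, .var]

/-- Reducts of renamings are renamings of reducts. -/
theorem of_rename {t₀ r : Raw} (h : Par t₀ r) : ∀ {ρ : ℕ → ℕ} {t : Raw}, ρ.Injective →
    t₀ = t.rename ρ → ∃ t', r = t'.rename ρ ∧ Par t t' := by
  induction h with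
  | univ | bool | tt | ff | mvar =>
    intro ρ t hρ e
    cases t <;> simp [Raw.rename] at e
    exact ⟨_, by simp [Raw.rename, e], refl _⟩
  | var =>
    intro ρ t hρ e
    cases t <;> simp [Raw.rename] at e
    exact ⟨_, by simp [Raw.rename, e], refl _⟩
  | pi _ _ ih₁ ih₂ =>
    intro ρ t hρ e
    cases t <;> simp [Raw.rename] at e
    obtain ⟨_, rfl, h₁⟩ := ih₁ hρ e.1
    obtain ⟨_, rfl, h₂⟩ := ih₂ (liftRen_injective hρ) e.2
    exact ⟨_, rfl, .pi h₁ h₂⟩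
  | lam _ ih₁ =>
    intro ρ t hρ e
    cases t <;> simp [Raw.rename] at e
    obtain ⟨_, rfl, h₁⟩ := ih₁ (liftRen_injective hρ) e
    exact ⟨_, rfl, .lam h₁⟩
  | app _ _ ih₁ ih₂ =>
    intro ρ t hρ e
    cases t <;> simp [Raw.rename] at e
    obtain ⟨_, rfl, h₁⟩ := ih₁ hρ e.1
    obtain ⟨_, rfl, h₂⟩ := ih₂ hρ e.2
    exact ⟨_, rfl, .app h₁ h₂⟩
  | ite _ _ _ _ ih₁ ih₂ ih₃ ih₄ =>
    intro ρ t hρ e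
    cases t <;> simp [Raw.rename] at e
    obtain ⟨_, rfl, h₁⟩ := ih₁ hρ e.1
    obtain ⟨_, rfl, h₂⟩ := ih₂ (liftRen_injective hρ) e.2.1
    obtain ⟨_, rfl, h₃⟩ := ih₃ hρ e.2.2.1
    obtain ⟨_, rfl, h₄⟩ := ih₄ hρ e.2.2.2
    exact ⟨_, rfl, .ite h₁ h₂ h₃ h₄⟩
  | beta _ _ e' ih₁ ih₂ =>
    intro ρ t hρ e
    subst e'
    cases t <;> simp [Raw.rename] at e
    rename_i n u
    obtain ⟨e₁, e₂⟩ := e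
    cases n <;> simp [Raw.rename] at e₁
    obtain ⟨_, rfl, h₁⟩ := ih₁ (liftRen_injective hρ) e₁
    obtain ⟨_, rfl, h₂⟩ := ih₂ hρ e₂
    exact ⟨_, (Raw.subst_one_rename _ _ _).symm, .beta h₁ h₂ rfl⟩
  | iteTT _ ih =>
    intro ρ t hρ e
    cases t <;> simp [Raw.rename] at e
    rename_i n _ _ _
    obtain ⟨e₁, -, e₂, -⟩ := e
    cases n <;> simp [Raw.rename] at e₁
    obtain ⟨_, rfl, h₁⟩ := ih hρ e₂
    exact ⟨_, rfl, .iteTT h₁⟩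
  | iteFF _ ih =>
    intro ρ t hρ e
    cases t <;> simp [Raw.rename] at e
    rename_i n _ _ _
    obtain ⟨e₁, -, -, e₂⟩ := e
    cases n <;> simp [Raw.rename] at e₁
    obtain ⟨_, rfl, h₁⟩ := ih hρ e₂
    exact ⟨_, rfl, .iteFF h₁⟩
  | @eta m n n' e' _ ih =>
    intro ρ t hρ e
    subst e'
    cases t <;> simp [Raw.rename] at e
    rename_i b
    cases b <;> simp [Raw.rename] at e
    rename_i p q
    obtain ⟨e₁, e₂⟩ := e
    cases q <;> simp [Raw.rename] at e₂
    rename_i j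
    have hj : j = 0 := by
      cases j
      · rfl
      · simp [liftRen] at e₂
    subst hj
    -- The function part of the renamed body is also a weakening, so the new variable does not occur
    -- in it; since `liftRen ρ` fixes 0, it does not occur in `p` either.
    have hpn : ∀ i, p.Occurs i → i ≠ 0 := by
      rintro i hi rfl
      have : (p.rename (liftRen ρ)).Occurs 0 := by
        exact Raw.Occurs.rename hi (liftRen ρ)
      rw [← e₁] at this
      obtain ⟨j, h, -⟩ := Raw.occurs_rename _ _ _ this
      simp at h
    -- `Nat.pred` undoes the weakening; its value at 0 is harmless because 0 does not occur in `p`.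
    have hp : p = (p.rename Nat.pred).rename Nat.succ := by
      rw [Raw.rename_rename, Raw.rename_eq_subst]
      conv_lhs => rw [← Raw.subst_var p]
      refine Raw.subst_congr fun i hi => ?_
      have := hpn i hi
      cases i
      · contradiction
      · rfl
    have hn : n = (p.rename Nat.pred).rename ρ := by
      apply Raw.rename_injective Nat.succ_injective
      rw [e₁]
      conv_lhs => rw [hp]
      simp only [Raw.rename_rename]; rfl
    obtain ⟨n₁, rfl, h₁⟩ := ih hρ hn
    exact ⟨n₁, rfl, .eta hp h₁⟩

end Par

-- The diamond property

namespace Par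

theorem lam_inv {s r : Raw} (h : Par (.lam s) r) :
    (∃ s', r = .lam s' ∧ Par s s') ∨ ∃ m, s = .app (m.rename Nat.succ) (.var 0) ∧ Par m r := by
  cases h with
  | lam h => exact .inl ⟨_, rfl, h⟩
  | eta e h => exact .inr ⟨_, by rw [e], h⟩

theorem app_inv {n t r : Raw} (h : Par (.app n t) r) :
    (∃ n' t', r = .app n' t' ∧ Par n n' ∧ Par t t') ∨
    ∃ b b' t', n = .lam b ∧ r = b'.subst (.one t') ∧ Par b b' ∧ Par t t' := by
  cases h with
  | app h₁ h₂ => exact .inl ⟨_, _, rfl, h₁, h₂⟩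
  | beta h₁ h₂ e => exact .inr ⟨_, _, _, rfl, e, h₁, h₂⟩

/-- Reducts of the body of an eta-redex. -/
theorem app_succ_inv {m r : Raw} (h : Par (.app (m.rename Nat.succ) (.var 0)) r) :
    (∃ m', r = .app (m'.rename Nat.succ) (.var 0) ∧ Par m m') ∨
    ∃ d, m = .lam d ∧ Par d r := by
  rcases h.app_inv with ⟨n', t', rfl, h₁, h₂⟩ | ⟨b, b', t', e, rfl, h₁, h₂⟩
  · obtain ⟨m', rfl, hm⟩ := h₁.of_rename Nat.succ_injective rfl
    cases h₂
    exact .inl ⟨_, rfl, hm⟩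
  · cases h₂
    cases m <;> simp [Raw.rename] at e
    subst e
    obtain ⟨d', rfl, hd⟩ := h₁.of_rename (liftRen_injective Nat.succ_injective) rfl
    exact .inr ⟨_, rfl, by rwa [Raw.rename_lift_succ_one]⟩

/-- The overlaps of beta with eta are resolved by reductions of terms that are not subterms of `t`,
only smaller than it. This is why the induction is on the size rather than on the term. -/
theorem diamond_size : ∀ (k : ℕ) (t : Raw), t.size < k →
    ∀ {a b}, Par t a → Par t b → ∃ c, Par a c ∧ Par b c := by
  intro k
  induction k with
  | zero => intro t h; omega
  | succ k IH =>
  intro t hk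
  have lam_eta : ∀ {m a s}, t = .lam (.app (m.rename Nat.succ) (.var 0)) → Par m a →
      Par (.app (m.rename Nat.succ) (.var 0)) s → ∃ c, Par a c ∧ Par (.lam s) c := by
    rintro m a s rfl ha hs
    simp only [Raw.size, Raw.size_rename] at hk
    rcases hs.app_succ_inv with ⟨m', rfl, h⟩ | ⟨d, rfl, h⟩
    · obtain ⟨c, h₁, h₂⟩ := IH m (by omega) ha h
      exact ⟨c, h₁, .eta rfl h₂⟩
    · exact IH _ (by omega) ha (.lam h)
  have app_beta : ∀ {s s' u u' q v}, t = .app (.lam s) u → Par s s' → Par u u' →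
      Par (.lam s) q → Par u v → ∃ c, Par (s'.subst (.one u')) c ∧ Par (.app q v) c := by
    rintro s s' u u' q v rfl hs hu hq hv
    simp only [Raw.size] at hk
    rcases hq.lam_inv with ⟨s'', rfl, hs''⟩ | ⟨m, rfl, hm⟩
    · obtain ⟨c, h₁, h₂⟩ := IH s (by omega) hs hs''
      obtain ⟨d, h₃, h₄⟩ := IH u (by omega) hu hv
      exact ⟨_, h₁.subst_one h₃, .beta h₂ h₄ rfl⟩
    · simp only [Raw.size, Raw.size_rename] at hk
      rcases hs.app_succ_inv with ⟨m', rfl, h⟩ | ⟨d, rfl, h⟩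
      · obtain ⟨c, h₁, h₂⟩ := IH m (by omega) h hm
        obtain ⟨d, h₃, h₄⟩ := IH u (by omega) hu hv
        refine ⟨_, ?_, .app h₂ h₄⟩
        simp only [Raw.subst, Raw.subst_succ_one, Raw.one]
        exact .app h₁ h₃
      · simp only [Raw.size] at hk
        -- Here `t` is `(λ x. (λ d) x) u`. Both reducts are already reducts of the smaller term `(λ
        -- d) u`.
        exact IH (.app (.lam d) u) (by simp only [Raw.size]; omega) (.beta h hu rfl) (.app hm hv)
  have ite_tt : ∀ {A t₀ u₀ t' n A' t'' u''}, t = .ite .tt A t₀ u₀ → Par t₀ t' → Par .tt n →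
      Par t₀ t'' → ∃ c, Par t' c ∧ Par (.ite n A' t'' u'') c := by
    rintro A t₀ u₀ t' n A' t'' u'' rfl h hn h'
    simp only [Raw.size] at hk
    cases hn
    obtain ⟨c, h₁, h₂⟩ := IH _ (by omega) h h'
    exact ⟨c, h₁, .iteTT h₂⟩
  have ite_ff : ∀ {A t₀ u₀ u' n A' t'' u''}, t = .ite .ff A t₀ u₀ → Par u₀ u' → Par .ff n →
      Par u₀ u'' → ∃ c, Par u' c ∧ Par (.ite n A' t'' u'') c := by
    rintro A t₀ u₀ t' n A' t'' u'' rfl h hn h'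
    simp only [Raw.size] at hk
    cases hn
    obtain ⟨c, h₁, h₂⟩ := IH _ (by omega) h h'
    exact ⟨c, h₁, .iteFF h₂⟩
  intro a b ha hb
  cases ha with
  | univ => cases hb; exact ⟨_, .univ, .univ⟩
  | bool => cases hb; exact ⟨_, .bool, .bool⟩
  | tt => cases hb; exact ⟨_, .tt, .tt⟩
  | ff => cases hb; exact ⟨_, .ff, .ff⟩
  | var => cases hb; exact ⟨_, .var, .var⟩
  | mvar => cases hb; exact ⟨_, .mvar, .mvar⟩
  | pi h₁ h₂ =>
    cases hb with
    | pi h₁' h₂' =>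
    simp only [Raw.size] at hk
    obtain ⟨c, h₃, h₄⟩ := IH _ (by omega) h₁ h₁'
    obtain ⟨d, h₅, h₆⟩ := IH _ (by omega) h₂ h₂'
    exact ⟨_, .pi h₃ h₅, .pi h₄ h₆⟩
  | lam h =>
    cases hb with
    | lam h' =>
      simp only [Raw.size] at hk
      obtain ⟨c, h₃, h₄⟩ := IH _ (by omega) h h'
      exact ⟨_, .lam h₃, .lam h₄⟩
    | eta e h' =>
      subst e
      obtain ⟨c, h₁, h₂⟩ := lam_eta rfl h' h
      exact ⟨c, h₂, h₁⟩
  | eta e h =>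
    subst e
    rcases hb.lam_inv with ⟨s', rfl, h'⟩ | ⟨m, e, h'⟩
    · exact lam_eta rfl h h'
    · simp only [Raw.app.injEq, and_true] at e
      cases Raw.rename_injective Nat.succ_injective e
      simp only [Raw.size, Raw.size_rename] at hk
      exact IH _ (by omega) h h'
  | app h₁ h₂ =>
    cases hb with
    | app h₁' h₂' =>
      simp only [Raw.size] at hk
      obtain ⟨c, h₃, h₄⟩ := IH _ (by omega) h₁ h₁'
      obtain ⟨d, h₅, h₆⟩ := IH _ (by omega) h₂ h₂'
      exact ⟨_, .app h₃ h₅, .app h₄ h₆⟩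
    | beta h₁' h₂' e =>
      subst e
      obtain ⟨c, h₃, h₄⟩ := app_beta rfl h₁' h₂' h₁ h₂
      exact ⟨c, h₄, h₃⟩
  | beta h₁ h₂ e =>
    subst e
    cases hb with
    | app h₁' h₂' => exact app_beta rfl h₁ h₂ h₁' h₂'
    | beta h₁' h₂' e =>
      subst e
      simp only [Raw.size] at hk
      obtain ⟨c, h₃, h₄⟩ := IH _ (by omega) h₁ h₁'
      obtain ⟨d, h₅, h₆⟩ := IH _ (by omega) h₂ h₂'
      exact ⟨_, h₃.subst_one h₅, h₄.subst_one h₆⟩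
  | ite h₁ h₂ h₃ h₄ =>
    cases hb with
    | ite h₁' h₂' h₃' h₄' =>
      simp only [Raw.size] at hk
      obtain ⟨_, k₁, k₁'⟩ := IH _ (by omega) h₁ h₁'
      obtain ⟨_, k₂, k₂'⟩ := IH _ (by omega) h₂ h₂'
      obtain ⟨_, k₃, k₃'⟩ := IH _ (by omega) h₃ h₃'
      obtain ⟨_, k₄, k₄'⟩ := IH _ (by omega) h₄ h₄'
      exact ⟨_, .ite k₁ k₂ k₃ k₄, .ite k₁' k₂' k₃' k₄'⟩
    | iteTT h =>
      obtain ⟨c, k₁, k₂⟩ := ite_tt rfl h h₁ h₃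
      exact ⟨c, k₂, k₁⟩
    | iteFF h =>
      obtain ⟨c, k₁, k₂⟩ := ite_ff rfl h h₁ h₄
      exact ⟨c, k₂, k₁⟩
  | iteTT h =>
    cases hb with
    | ite h₁' h₂' h₃' h₄' => exact ite_tt rfl h h₁' h₃'
    | iteTT h' => simp only [Raw.size] at hk; exact IH _ (by omega) h h'
  | iteFF h =>
    cases hb with
    | ite h₁' h₂' h₃' h₄' => exact ite_ff rfl h h₁' h₄'
    | iteFF h' => simp only [Raw.size] at hk; exact IH _ (by omega) h h'

theorem diamond {t a b : Raw} (ha : Par t a) (hb : Par t b) : ∃ c, Par a c ∧ Par b c :=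
  diamond_size _ t (Nat.lt_succ_self _) ha hb

end Par

/-! ### Conversion of raw terms -/

/-- Iterated parallel reduction. -/
abbrev Pars : Raw → Raw → Prop := Relation.ReflTransGen Par

/-- Conversion of raw terms: having a common reduct. -/
def Cv : Raw → Raw → Prop := Relation.Join Pars

/-- Transitivity of having a common reduct is confluence, which follows from the diamond property.
-/
theorem cv_equivalence : Equivalence Cv :=
  Relation.equivalence_join_reflTransGen fun _ _ _ h₁ h₂ =>
    let ⟨d, h₃, h₄⟩ := h₁.diamond h₂
    ⟨d, .single h₃, .single h₄⟩

namespace Pars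

theorem map {f : Raw → Raw} (hf : ∀ {a b}, Par a b → Par (f a) (f b)) {t u : Raw} (h : Pars t u) :
    Pars (f t) (f u) := by
  induction h with
  | refl => exact .refl
  | tail _ h ih => exact ih.tail (hf h)

theorem pi_inv {A B r : Raw} (h : Pars (.pi A B) r) :
    ∃ A' B', r = .pi A' B' ∧ Pars A A' ∧ Pars B B' := by
  induction h with
  | refl => exact ⟨_, _, rfl, .refl, .refl⟩
  | tail _ h ih =>
    obtain ⟨A', B', rfl, h₁, h₂⟩ := ih
    cases h with
    | pi h₃ h₄ => exact ⟨_, _, rfl, h₁.tail h₃, h₂.tail h₄⟩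

theorem univ_inv {r : Raw} (h : Pars .univ r) : r = .univ := by
  induction h with
  | refl => rfl
  | tail _ h ih => subst ih; cases h; rfl

theorem bool_inv {r : Raw} (h : Pars .bool r) : r = .bool := by
  induction h with
  | refl => rfl
  | tail _ h ih => subst ih; cases h; rfl

end Pars

namespace Cv

theorem refl (t : Raw) : Cv t t := cv_equivalence.refl t
theorem symm {t u : Raw} (h : Cv t u) : Cv u t := cv_equivalence.symm h
theorem trans {t u v : Raw} (h : Cv t u) (h' : Cv u v) : Cv t v := cv_equivalence.trans h h'

theorem of_par {t u : Raw} (h : Par t u) : Cv t u := ⟨u, .single h, .refl⟩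

theorem map {f : Raw → Raw} (hf : ∀ {a b}, Par a b → Par (f a) (f b)) {t u : Raw} (h : Cv t u) :
    Cv (f t) (f u) :=
  let ⟨_, h₁, h₂⟩ := h
  ⟨_, Pars.map hf h₁, Pars.map hf h₂⟩

theorem pi {A A' B B' : Raw} (hA : Cv A A') (hB : Cv B B') : Cv (.pi A B) (.pi A' B') :=
  (hA.map (f := (.pi · B)) fun h => .pi h (.refl _)).trans
    (hB.map (f := .pi A') fun h => .pi (.refl _) h)

theorem lam {t t' : Raw} (h : Cv t t') : Cv (.lam t) (.lam t') := h.map fun h => .lam h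

theorem app {n n' t t' : Raw} (hn : Cv n n') (ht : Cv t t') : Cv (.app n t) (.app n' t') :=
  (hn.map (f := (.app · t)) fun h => .app h (.refl _)).trans
    (ht.map (f := .app n') fun h => .app (.refl _) h)

theorem ite {n n' A A' t t' u u' : Raw} (hn : Cv n n') (hA : Cv A A') (ht : Cv t t')
    (hu : Cv u u') : Cv (.ite n A t u) (.ite n' A' t' u') :=
  (((hn.map (f := (.ite · A t u)) fun h => .ite h (.refl _) (.refl _) (.refl _)).trans
    (hA.map (f := (.ite n' · t u)) fun h => .ite (.refl _) h (.refl _) (.refl _))).trans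
    (ht.map (f := (.ite n' A' · u)) fun h => .ite (.refl _) (.refl _) h (.refl _))).trans
    (hu.map (f := .ite n' A' t') fun h => .ite (.refl _) (.refl _) (.refl _) h)

theorem beta (t u : Raw) : Cv (.app (.lam t) u) (t.subst (.one u)) :=
  of_par (.beta (.refl _) (.refl _) rfl)

theorem eta (t : Raw) : Cv (.lam (.app (t.rename Nat.succ) (.var 0))) t :=
  of_par (.eta rfl (.refl _))

theorem subst {t u : Raw} (h : Cv t u) (s : ℕ → Raw) : Cv (t.subst s) (u.subst s) :=
  h.map fun h => h.subst fun _ => .refl _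

theorem rename {t u : Raw} (h : Cv t u) (ρ : ℕ → ℕ) : Cv (t.rename ρ) (u.rename ρ) :=
  h.map fun h => h.rename _

theorem up {s s' : ℕ → Raw} (h : ∀ i, Cv (s i) (s' i)) (i : ℕ) : Cv (Raw.up s i) (Raw.up s' i) := by
  cases i
  · exact refl _
  · exact (h _).rename _

theorem subst_right (t : Raw) : ∀ {s s' : ℕ → Raw}, (∀ i, Cv (s i) (s' i)) →
    Cv (t.subst s) (t.subst s') := by
  induction t with
  | univ | bool | tt | ff | mvar => intros; exact refl _
  | var i => intro s s' h; exact h i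
  | pi A B ihA ihB => intro s s' h; exact (ihA h).pi (ihB (up h))
  | lam t ih => intro s s' h; exact (ih (up h)).lam
  | app n t ihn iht => intro s s' h; exact (ihn h).app (iht h)
  | ite n A t u ihn ihA iht ihu => intro s s' h; exact (ihn h).ite (ihA (up h)) (iht h) (ihu h)

theorem subst_one {t t' u u' : Raw} (h : Cv t t') (hu : Cv u u') :
    Cv (t.subst (.one u)) (t'.subst (.one u')) :=
  (h.subst _).trans (subst_right _ fun i => by cases i; exacts [hu, refl _])

theorem of_rename {ρ : ℕ → ℕ} (hρ : ρ.Injective) {t u : Raw} (h : Cv (t.rename ρ) (u.rename ρ)) :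
    Cv t u := by
  have hl : ∀ i, Function.invFun ρ (ρ i) = i := Function.leftInverse_invFun hρ
  have := h.subst (fun i => .var (Function.invFun ρ i))
  simpa only [Raw.subst_rename, hl, Raw.subst_var] using this

/-- No reduction applies at the root of a function type, so a common reduct is again a function
type, reached componentwise. Subject reduction and uniqueness of types below rest on this. -/
theorem pi_inv {A A' B B' : Raw} (h : Cv (.pi A B) (.pi A' B')) : Cv A A' ∧ Cv B B' := by
  obtain ⟨r, h₁, h₂⟩ := h
  obtain ⟨X, Y, rfl, h₃, h₄⟩ := h₁.pi_inv
  obtain ⟨_, _, e, h₅, h₆⟩ := h₂.pi_inv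
  cases e
  exact ⟨⟨_, h₃, h₅⟩, ⟨_, h₄, h₆⟩⟩

theorem not_univ_pi {A B : Raw} (h : Cv .univ (.pi A B)) : False := by
  obtain ⟨r, h₁, h₂⟩ := h
  cases h₁.univ_inv
  obtain ⟨X, Y, e, -⟩ := h₂.pi_inv
  cases e

theorem not_bool_pi {A B : Raw} (h : Cv .bool (.pi A B)) : False := by
  obtain ⟨r, h₁, h₂⟩ := h
  cases h₁.bool_inv
  obtain ⟨X, Y, e, -⟩ := h₂.pi_inv
  cases e

end Cv

/-! ### Renaming of normal forms -/

namespace Exp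

theorem rename_rename {c : Cls} (t : Exp c) :
    ∀ ρ ρ', (t.rename ρ).rename ρ' = t.rename (ρ' ∘ ρ) := by
  induction t <;> intro ρ ρ' <;> simp_all [rename, liftRen_comp]

theorem rename_id {c : Cls} (t : Exp c) : t.rename id = t := by
  induction t <;> simp_all [rename, liftRen_id]

theorem shift_rename {c : Cls} (t : Exp c) (ρ : ℕ → ℕ) :
    t.shift.rename (liftRen ρ) = (t.rename ρ).shift := by
  simp only [shift, rename_rename]; rfl

/-- A normal form of either class as a term. -/
def toTm : {c : Cls} → Exp c → Tm
  | .tm, t => t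
  | .ne, n => neu n

/-- The underlying raw term. -/
def raw : {c : Cls} → Exp c → Raw
  | _, univ => .univ
  | _, bool => .bool
  | _, tt => .tt
  | _, ff => .ff
  | _, pi A B => .pi A.raw B.raw
  | _, lam t => .lam t.raw
  | _, neu n => n.raw
  | _, var i => .var i
  | _, mvar α => .mvar α
  | _, app n t => .app n.raw t.raw
  | _, ite n A t u => .ite n.raw A.raw t.raw u.raw

theorem raw_rename {c : Cls} (t : Exp c) : ∀ ρ, (t.rename ρ).raw = t.raw.rename ρ := by
  induction t <;> intro ρ <;> simp_all [rename, raw, Raw.rename]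

theorem raw_shift {c : Cls} (t : Exp c) : t.shift.raw = t.raw.rename Nat.succ := raw_rename _ _

end Exp

/-! ### Hereditary substitution -/

/-- Induction on hereditary substitutions, with the elimination of functions inlined. The case of
abstractions also provides the function part of a body that is an application. -/
theorem HSub.induct {M : ∀ {c : Cls} {s : Sub} {t : Exp c} {r : Tm}, HSub s t r → Prop}
    (univ : ∀ {s}, M (.univ (s := s))) (bool : ∀ {s}, M (.bool (s := s)))
    (tt : ∀ {s}, M (.tt (s := s))) (ff : ∀ {s}, M (.ff (s := s)))
    (pi : ∀ {s : Sub} {A B A' B' : Tm} (h₁ : HSub s A A') (h₂ : HSub s.lift B B'), M h₁ → M h₂ →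
      M (.pi h₁ h₂))
    (lam : ∀ {s : Sub} {t t' : Tm} (h : HSub s.lift t t'), M h →
      (∀ n u, t = .neu (.app n u) → ∃ (v u' : Tm) (h₁ : HSub s.lift n v), M h₁ ∧
        HSub s.lift u u' ∧ AppElim v u' t') → M (.lam h))
    (neu : ∀ {s : Sub} {n : Ne} {t : Tm} (h : HSub s n t), M h → M (.neu h))
    (var : ∀ {s i}, M (.var (s := s) (i := i))) (mvar : ∀ {s α}, M (.mvar (s := s) (α := α)))
    (app_neu : ∀ {s : Sub} {n m : Ne} {u u' : Tm} (h₁ : HSub s n (.neu m)) (h₂ : HSub s u u'), M h₁ → M h₂ →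
      M (.app h₁ h₂ .neu))
    (app_lam : ∀ {s : Sub} {n : Ne} {b u u' r : Tm} (h₁ : HSub s n (.lam b)) (h₂ : HSub s u u')
      (h₃ : HSub (Sub.one u') b r), M h₁ → M h₂ → M h₃ → M (.app h₁ h₂ (.lam h₃)))
    (ite : ∀ {s : Sub} {n : Ne} {A u v w A' u' v' r : Tm} (h₁ : HSub s n w) (h₂ : HSub s.lift A A')
      (h₃ : HSub s u u') (h₄ : HSub s v v') (h₅ : IfElim w A' u' v' r),
      M h₁ → M h₂ → M h₃ → M h₄ → M (.ite h₁ h₂ h₃ h₄ h₅))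
    {c : Cls} {s : Sub} {t : Exp c} {r : Tm} (h : HSub s t r) : M h := by
  -- For an application the first motive also records the premises of its derivation. Phrasing this
  -- with `toTm` lets the record pass through the rule `neu` and so reach the body of an
  -- abstraction.
  refine (HSub.rec
    (motive_1 := fun {c} s t r h => M h ∧ ∀ n u, t.toTm = .neu (.app n u) →
      ∃ (v u' : Tm) (h₁ : HSub s n v), M h₁ ∧ HSub s u u' ∧ AppElim v u' r)
    (motive_2 := fun t u r _ => ∀ b, t = .lam b → ∃ h : HSub (Sub.one u) b r, M h)
    ?_ ?_ ?_ ?_ ?_ ?_ ?_ ?_ ?_ ?_ ?_ ?_ ?_ h).1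
  · intro s; exact ⟨univ, by simp [Exp.toTm]⟩
  · intro s; exact ⟨bool, by simp [Exp.toTm]⟩
  · intro s; exact ⟨tt, by simp [Exp.toTm]⟩
  · intro s; exact ⟨ff, by simp [Exp.toTm]⟩
  · intro s A B A' B' h₁ h₂ i₁ i₂; exact ⟨pi h₁ h₂ i₁.1 i₂.1, by simp [Exp.toTm]⟩
  · intro s t t' h i; exact ⟨lam h i.1 i.2, by simp [Exp.toTm]⟩
  · intro s n t h i; exact ⟨neu h i.1, i.2⟩
  · intro s i; exact ⟨var, by simp [Exp.toTm]⟩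
  · intro s i; exact ⟨mvar, by simp [Exp.toTm]⟩
  · intro s n u v u' r h₁ h₂ h₃ i₁ i₂ i₃
    refine ⟨?_, ?_⟩
    · cases h₃ with
      | lam h => exact app_lam h₁ h₂ h i₁.1 i₂.1 (i₃ _ rfl).2
      | neu => exact app_neu h₁ h₂ i₁.1 i₂.1
    · intro n' u'' e
      simp only [Exp.toTm, Exp.neu.injEq, Exp.app.injEq] at e
      obtain ⟨rfl, rfl⟩ := e
      exact ⟨v, u', h₁, i₁.1, h₂, h₃⟩
  · intro s n A u v w A' u' v' r h₁ h₂ h₃ h₄ h₅ i₁ i₂ i₃ i₄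
    exact ⟨ite h₁ h₂ h₃ h₄ h₅ i₁.1 i₂.1 i₃.1 i₄.1, by simp [Exp.toTm]⟩
  · rintro t u r h i b ⟨⟩; exact ⟨h, i.1⟩
  · rintro n u b ⟨⟩

theorem IfElim.rename {w A u v r : Tm} (h : IfElim w A u v r) (ρ : ℕ → ℕ) :
    IfElim (w.rename ρ) (A.rename (liftRen ρ)) (u.rename ρ) (v.rename ρ) (r.rename ρ) := by
  cases h <;> constructor

theorem Sub.lift_rename {s s' : Sub} {ρ ρ' : ℕ → ℕ}
    (hv : ∀ i, (s.var i).rename ρ' = s'.var (ρ i)) (i : ℕ) :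
    (s.lift.var i).rename (liftRen ρ') = s'.lift.var (liftRen ρ i) := by
  cases i
  · rfl
  · simp only [Sub.lift, liftRen, Exp.shift_rename, hv]

theorem Sub.lift_rename_mvar {s s' : Sub} {ρ' : ℕ → ℕ}
    (hm : ∀ α, (s.mvar α).rename ρ' = s'.mvar α) (α : ℕ) :
    (s.lift.mvar α).rename (liftRen ρ') = s'.lift.mvar α := by
  simp only [Sub.lift, Exp.shift_rename, hm]

theorem Sub.one_rename (u : Tm) (ρ : ℕ → ℕ) (i : ℕ) :
    ((Sub.one u).var i).rename ρ = (Sub.one (u.rename ρ)).var (liftRen ρ i) := by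
  cases i <;> rfl

theorem HSub.rename {c : Cls} {s : Sub} {t : Exp c} {r : Tm} (h : HSub s t r) :
    ∀ {s' : Sub} {ρ ρ' : ℕ → ℕ}, (∀ i, (s.var i).rename ρ' = s'.var (ρ i)) →
      (∀ α, (s.mvar α).rename ρ' = s'.mvar α) → HSub s' (t.rename ρ) (r.rename ρ') := by
  induction h using HSub.induct with
  | univ => intros; exact .univ
  | bool => intros; exact .bool
  | tt => intros; exact .tt
  | ff => intros; exact .ff
  | pi _ _ ih₁ ih₂ =>
    intro s' ρ ρ' hv hm
    exact .pi (ih₁ hv hm) (ih₂ (Sub.lift_rename hv) (Sub.lift_rename_mvar hm))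
  | lam _ ih _ =>
    intro s' ρ ρ' hv hm
    exact .lam (ih (Sub.lift_rename hv) (Sub.lift_rename_mvar hm))
  | neu _ ih => intro s' ρ ρ' hv hm; exact .neu (ih hv hm)
  | var => intro s' ρ ρ' hv hm; rw [hv]; exact .var
  | mvar => intro s' ρ ρ' hv hm; rw [hm]; exact .mvar
  | app_neu _ _ ih₁ ih₂ => intro s' ρ ρ' hv hm; exact .app (ih₁ hv hm) (ih₂ hv hm) .neu
  | app_lam _ _ _ ih₁ ih₂ ih₃ =>
    intro s' ρ ρ' hv hm
    exact .app (ih₁ hv hm) (ih₂ hv hm) (.lam (ih₃ (Sub.one_rename _ _) fun _ => rfl))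
  | ite _ _ _ _ h ih₁ ih₂ ih₃ ih₄ =>
    intro s' ρ ρ' hv hm
    exact .ite (ih₁ hv hm) (ih₂ (Sub.lift_rename hv) (Sub.lift_rename_mvar hm)) (ih₃ hv hm)
      (ih₄ hv hm) (h.rename _)

theorem HSub.rename_one {t u r : Tm} (h : HSub (.one u) t r) (ρ : ℕ → ℕ) :
    HSub (.one (u.rename ρ)) (t.rename (liftRen ρ)) (r.rename ρ) :=
  h.rename (Sub.one_rename _ _) fun _ => rfl

theorem AppElim.rename {t u r : Tm} (h : AppElim t u r) (ρ : ℕ → ℕ) :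
    AppElim (t.rename ρ) (u.rename ρ) (r.rename ρ) := by
  cases h with
  | lam h => exact .lam (h.rename_one ρ)
  | neu => exact .neu

theorem IfElim.of_rename {w A u v r' : Tm} {ρ : ℕ → ℕ}
    (h : IfElim (w.rename ρ) (A.rename (liftRen ρ)) (u.rename ρ) (v.rename ρ) r') :
    ∃ r, r' = r.rename ρ ∧ IfElim w A u v r := by
  cases w <;> cases h
  · exact ⟨_, rfl, .tt⟩
  · exact ⟨_, rfl, .ff⟩
  · exact ⟨.neu (.ite _ A u v), rfl, .neu⟩

/-- Renaming creates no redex and hides none, so a derivation for a renamed term is the renaming of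
a derivation. This is what allows weakenings to be undone while keeping definedness. -/
theorem HSub.of_rename {c : Cls} {s' : Sub} {t' : Exp c} {r' : Tm} (h : HSub s' t' r') :
    ∀ {s : Sub} {ρ ρ' : ℕ → ℕ} {t : Exp c}, t' = t.rename ρ →
      (∀ i, (s.var i).rename ρ' = s'.var (ρ i)) → (∀ α, (s.mvar α).rename ρ' = s'.mvar α) →
      ∃ r, r' = r.rename ρ' ∧ HSub s t r := by
  induction h using HSub.induct with
  | univ =>
    intro s ρ ρ' t e hv hm
    cases t <;> simp [Exp.rename] at e
    exact ⟨_, rfl, .univ⟩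
  | bool =>
    intro s ρ ρ' t e hv hm
    cases t <;> simp [Exp.rename] at e
    exact ⟨_, rfl, .bool⟩
  | tt =>
    intro s ρ ρ' t e hv hm
    cases t <;> simp [Exp.rename] at e
    exact ⟨_, rfl, .tt⟩
  | ff =>
    intro s ρ ρ' t e hv hm
    cases t <;> simp [Exp.rename] at e
    exact ⟨_, rfl, .ff⟩
  | pi _ _ ih₁ ih₂ =>
    intro s ρ ρ' t e hv hm
    cases t <;> simp [Exp.rename] at e
    obtain ⟨_, rfl, h₁⟩ := ih₁ e.1 hv hm
    obtain ⟨_, rfl, h₂⟩ := ih₂ e.2 (Sub.lift_rename hv) (Sub.lift_rename_mvar hm)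
    exact ⟨_, rfl, .pi h₁ h₂⟩
  | lam _ ih _ =>
    intro s ρ ρ' t e hv hm
    cases t <;> simp [Exp.rename] at e
    obtain ⟨_, rfl, h⟩ := ih e (Sub.lift_rename hv) (Sub.lift_rename_mvar hm)
    exact ⟨_, rfl, .lam h⟩
  | neu _ ih =>
    intro s ρ ρ' t e hv hm
    cases t <;> simp [Exp.rename] at e
    obtain ⟨_, rfl, h⟩ := ih e hv hm
    exact ⟨_, rfl, .neu h⟩
  | var =>
    intro s ρ ρ' t e hv hm
    cases t <;> simp [Exp.rename] at e
    exact ⟨_, by rw [e, hv], .var⟩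
  | mvar =>
    intro s ρ ρ' t e hv hm
    cases t <;> simp [Exp.rename] at e
    exact ⟨_, by rw [e, hm], .mvar⟩
  | app_neu _ _ ih₁ ih₂ =>
    intro s ρ ρ' t e hv hm
    cases t <;> simp [Exp.rename] at e
    obtain ⟨v, e₁, h₁⟩ := ih₁ e.1 hv hm
    obtain ⟨_, rfl, h₂⟩ := ih₂ e.2 hv hm
    cases v <;> simp [Exp.rename] at e₁
    subst e₁
    exact ⟨_, rfl, .app h₁ h₂ .neu⟩
  | app_lam _ _ _ ih₁ ih₂ ih₃ =>
    intro s ρ ρ' t e hv hm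
    cases t <;> simp [Exp.rename] at e
    obtain ⟨v, e₁, h₁⟩ := ih₁ e.1 hv hm
    obtain ⟨_, rfl, h₂⟩ := ih₂ e.2 hv hm
    cases v <;> simp [Exp.rename] at e₁
    obtain ⟨_, rfl, h₃⟩ := ih₃ e₁ (Sub.one_rename _ _) fun _ => rfl
    exact ⟨_, rfl, .app h₁ h₂ (.lam h₃)⟩
  | ite _ _ _ _ h ih₁ ih₂ ih₃ ih₄ =>
    intro s ρ ρ' t e hv hm
    cases t <;> simp [Exp.rename] at e
    obtain ⟨_, rfl, h₁⟩ := ih₁ e.1 hv hm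
    obtain ⟨_, rfl, h₂⟩ := ih₂ e.2.1 (Sub.lift_rename hv) (Sub.lift_rename_mvar hm)
    obtain ⟨_, rfl, h₃⟩ := ih₃ e.2.2.1 hv hm
    obtain ⟨_, rfl, h₄⟩ := ih₄ e.2.2.2 hv hm
    obtain ⟨_, rfl, h₅⟩ := h.of_rename
    exact ⟨_, rfl, .ite h₁ h₂ h₃ h₄ h₅⟩

theorem HSub.of_rename_one {t u r' : Tm} {ρ : ℕ → ℕ}
    (h : HSub (.one (u.rename ρ)) (t.rename (liftRen ρ)) r') :
    ∃ r, r' = r.rename ρ ∧ HSub (.one u) t r :=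
  h.of_rename rfl (Sub.one_rename _ _) fun _ => rfl

theorem HSub.of_shift {c : Cls} {s : Sub} {t : Exp c} {r' : Tm} (h : HSub s.lift t.shift r') :
    ∃ r, r' = r.shift ∧ HSub s t r :=
  h.of_rename rfl (fun _ => rfl) fun _ => rfl

theorem HSub.shift {c : Cls} {s : Sub} {t : Exp c} {r : Tm} (h : HSub s t r) :
    HSub s.lift t.shift r.shift :=
  h.rename (fun _ => rfl) fun _ => rfl

-- Determinism, and substitutions inverse to renamings

theorem IfElim.det {w A u v r r' : Tm} (h : IfElim w A u v r) (h' : IfElim w A u v r') :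
    r = r' := by
  cases h <;> cases h' <;> rfl

theorem HSub.det {c : Cls} {s : Sub} {t : Exp c} {r : Tm} (h : HSub s t r) :
    ∀ {r'}, HSub s t r' → r = r' := by
  induction h using HSub.induct with
  | univ => intro r' h'; cases h'; rfl
  | bool => intro r' h'; cases h'; rfl
  | tt => intro r' h'; cases h'; rfl
  | ff => intro r' h'; cases h'; rfl
  | var => intro r' h'; cases h'; rfl
  | mvar => intro r' h'; cases h'; rfl
  | pi _ _ ih₁ ih₂ =>
    intro r' h'
    cases h' with
    | pi h₁ h₂ => rw [ih₁ h₁, ih₂ h₂]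
  | lam _ ih _ =>
    intro r' h'
    cases h' with
    | lam h₁ => rw [ih h₁]
  | neu _ ih =>
    intro r' h'
    cases h' with
    | neu h₁ => rw [ih h₁]
  | app_neu _ _ ih₁ ih₂ =>
    intro r' h'
    cases h' with
    | app h₁ h₂ h₃ => cases ih₁ h₁; cases ih₂ h₂; cases h₃; rfl
  | app_lam _ _ _ ih₁ ih₂ ih₃ =>
    intro r' h'
    cases h' with
    | app h₁ h₂ h₃ =>
      cases ih₁ h₁; cases ih₂ h₂
      cases h₃ with
      | lam h₃ => exact ih₃ h₃
  | ite _ _ _ _ h ih₁ ih₂ ih₃ ih₄ =>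
    intro r' h'
    cases h' with
    | ite h₁ h₂ h₃ h₄ h₅ =>
      cases ih₁ h₁; cases ih₂ h₂; cases ih₃ h₃; cases ih₄ h₄
      exact h.det h₅

theorem AppElim.det {t u r r' : Tm} (h : AppElim t u r) (h' : AppElim t u r') : r = r' := by
  cases h with
  | lam h =>
    cases h' with
    | lam h' => exact h.det h'
  | neu => cases h'; rfl

/-- Substitutions that leave the metavariables alone. -/
def Sub.Plain (s : Sub) : Prop := ∀ α, s.mvar α = Exp.neu (Exp.mvar α)

theorem Sub.Plain.lift {s : Sub} (h : s.Plain) : s.lift.Plain := fun α => by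
  simp only [Sub.lift, h α]; rfl

theorem Sub.plain_one (u : Tm) : (Sub.one u).Plain := fun _ => rfl

/-- Every head that is met is sent to a variable or a metavariable, so no redex arises and the
partial operation is defined. -/
theorem HSub.of_inverse {c : Cls} (t : Exp c) : ∀ {s : Sub} {ρ : ℕ → ℕ}, s.Plain →
    (∀ i, s.var (ρ i) = Exp.neu (Exp.var i)) → HSub s (t.rename ρ) t.toTm := by
  have hl : ∀ {s : Sub} {ρ : ℕ → ℕ}, (∀ i, s.var (ρ i) = Exp.neu (Exp.var i)) →
      ∀ i, s.lift.var (liftRen ρ i) = Exp.neu (Exp.var i) := by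
    intro s ρ h i
    cases i
    · rfl
    · simp only [Sub.lift, liftRen, h]; rfl
  induction t with
  | univ => intros; exact .univ
  | bool => intros; exact .bool
  | tt => intros; exact .tt
  | ff => intros; exact .ff
  | pi A B ihA ihB => intro s ρ hs h; exact .pi (ihA hs h) (ihB hs.lift (hl h))
  | lam t ih => intro s ρ hs h; exact .lam (ih hs.lift (hl h))
  | neu n ih => intro s ρ hs h; exact .neu (ih hs h)
  | var i =>
    intro s ρ hs h
    have : HSub s (Exp.var (ρ i)) (s.var (ρ i)) := .var
    rwa [h] at this
  | mvar α =>
    intro s ρ hs h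
    have : HSub s (.mvar α) (s.mvar α) := .mvar
    rwa [hs] at this
  | app n t ihn iht => intro s ρ hs h; exact .app (ihn hs h) (iht hs h) .neu
  | ite n A t u ihn ihA iht ihu =>
    intro s ρ hs h
    exact .ite (ihn hs h) (ihA hs.lift (hl h)) (iht hs h) (ihu hs h) .neu

theorem HSub.shift_one {c : Cls} (t : Exp c) (u : Tm) : HSub (.one u) t.shift t.toTm :=
  .of_inverse t (Sub.plain_one u) fun _ => rfl

theorem HSub.lift_shift_one (t : Tm) :
    HSub (.one (Exp.neu (Exp.var 0))) (t.rename (liftRen Nat.succ)) t :=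
  .of_inverse t (Sub.plain_one _) fun i => by cases i <;> rfl

/-- Application of the weakening of a function to the new variable. -/
theorem appElim_lam_var {b r : Tm} :
    AppElim (Exp.lam b).shift (Exp.neu (Exp.var 0)) r ↔ r = b :=
  ⟨fun h => h.det (.lam (.lift_shift_one b)), by rintro rfl; exact .lam (.lift_shift_one _)⟩

theorem appElim_neu {n : Ne} {u r : Tm} : AppElim (Exp.neu n) u r ↔ r = Exp.neu (Exp.app n u) :=
  ⟨fun h => h.det .neu, fun h => h ▸ .neu⟩

/-- Eta-expansion before instantiation is application. -/
theorem AppElim.hsub_one {f v g r : Tm} (hg : AppElim f.shift (Exp.neu (Exp.var 0)) g)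
    (hr : AppElim f v r) : HSub (.one v) g r := by
  cases f <;> cases hr
  · rename_i b h
    rwa [appElim_lam_var.1 hg]
  · rename_i n
    rw [appElim_neu.1 hg]
    exact .neu (.app (.shift_one n v) (.neu .var) .neu)

-- Comparison with raw substitution

/-- The underlying raw substitution. -/
def Sub.raw (s : Sub) (i : ℕ) : Raw := (s.var i).raw

theorem Sub.raw_lift (s : Sub) : s.lift.raw = Raw.up s.raw := by
  funext i; cases i
  · rfl
  · exact raw_shift _

theorem Sub.raw_one (u : Tm) : (Sub.one u).raw = Raw.one u.raw := by
  funext i; cases i <;> rfl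

theorem IfElim.cv {w A u v r : Tm} (h : IfElim w A u v r) :
    Cv (.ite w.raw A.raw u.raw v.raw) r.raw := by
  cases h
  · exact .of_par (.iteTT (.refl _))
  · exact .of_par (.iteFF (.refl _))
  · exact .refl _

/-- Hereditary substitution only adds contractions of beta- and `ite`-redexes to the raw
substitution. Raw substitution does not touch metavariables, whence `Plain`. -/
theorem HSub.cv {c : Cls} {s : Sub} {t : Exp c} {r : Tm} (h : HSub s t r) :
    s.Plain → Cv (t.raw.subst s.raw) r.raw := by
  induction h using HSub.induct with
  | univ | bool | tt | ff | var => intro _; exact .refl _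
  | mvar => intro hs; rw [hs]; exact .refl _
  | pi _ _ ih₁ ih₂ =>
    intro hs
    have := ih₂ hs.lift
    rw [Sub.raw_lift] at this
    exact (ih₁ hs).pi this
  | lam _ ih _ =>
    intro hs
    have := ih hs.lift
    rw [Sub.raw_lift] at this
    exact this.lam
  | neu _ ih => exact ih
  | app_neu _ _ ih₁ ih₂ => intro hs; exact (ih₁ hs).app (ih₂ hs)
  | app_lam _ _ _ ih₁ ih₂ ih₃ =>
    intro hs
    have := ih₃ (Sub.plain_one _)
    rw [Sub.raw_one] at this
    exact ((ih₁ hs).app (ih₂ hs)).trans ((Cv.beta _ _).trans this)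
  | ite _ _ _ _ h ih₁ ih₂ ih₃ ih₄ =>
    intro hs
    have := ih₂ hs.lift
    rw [Sub.raw_lift] at this
    exact ((ih₁ hs).ite this (ih₃ hs) (ih₄ hs)).trans h.cv

theorem HSub.cv_one {c : Cls} {t : Exp c} {u r : Tm} (h : HSub (.one u) t r) :
    Cv (t.raw.subst (.one u.raw)) r.raw := by
  have := h.cv (Sub.plain_one u)
  rwa [Sub.raw_one] at this

theorem AppElim.cv {t u r : Tm} (h : AppElim t u r) : Cv (.app t.raw u.raw) r.raw := by
  cases h with
  | lam h => exact (Cv.beta _ _).trans h.cv_one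
  | neu => exact .refl _

/-! ### Eta-reduction of normal forms -/

/-- Parallel eta-reduction of normal forms. -/
inductive Eta : {c : Cls} → Exp c → Exp c → Prop
  | univ : Eta univ univ
  | bool : Eta bool bool
  | tt : Eta tt tt
  | ff : Eta ff ff
  | pi {A A' B B' : Tm} : Eta A A' → Eta B B' → Eta (pi A B) (pi A' B')
  | lam {t t' : Tm} : Eta t t' → Eta (lam t) (lam t')
  | neu {n n' : Ne} : Eta n n' → Eta (neu n) (neu n')
  | var {i : ℕ} : Eta (var i) (var i)
  | mvar {α : ℕ} : Eta (mvar α) (mvar α)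
  | app {n n' : Ne} {t t' : Tm} : Eta n n' → Eta t t' → Eta (app n t) (app n' t')
  | ite {n n' : Ne} {A A' t t' u u' : Tm} :
      Eta n n' → Eta A A' → Eta t t' → Eta u u' → Eta (ite n A t u) (ite n' A' t' u')
  | eta {m n n' : Ne} : m = n.shift → Eta n n' →
      Eta (lam (neu (app m (neu (var 0))))) (neu n')

namespace Eta

theorem refl {c : Cls} (t : Exp c) : Eta t t := by
  induction t <;> constructor <;> assumption

theorem par {c : Cls} {t t' : Exp c} (h : Eta t t') : Par t.raw t'.raw := by
  induction h with
  | eta e _ ih => subst e; exact .eta (raw_shift _) ih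
  | neu _ ih => exact ih
  | _ => constructor <;> assumption

theorem rename {c : Cls} {t t' : Exp c} (h : Eta t t') :
    ∀ ρ, Eta (t.rename ρ) (t'.rename ρ) := by
  induction h with
  | eta e _ ih =>
    intro ρ; subst e
    exact .eta (Exp.shift_rename _ _) (ih ρ)
  | _ => intro ρ; constructor <;> apply_assumption

end Eta

namespace Exp

/-- The only constructor that `raw` forgets is `neu`, and its presence is determined by the class
and by the raw head. -/
theorem raw_injective {c : Cls} {t u : Exp c} (h : t.raw = u.raw) : t = u := by
  have hne : ∀ (n : Ne), n.raw ≠ .univ ∧ n.raw ≠ .bool ∧ n.raw ≠ .tt ∧ n.raw ≠ .ff ∧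
      (∀ A B, n.raw ≠ .pi A B) ∧ ∀ t, n.raw ≠ .lam t := by
    intro n; cases n <;> simp [raw]
  induction t with
  | univ | bool | tt | ff =>
    cases u <;> simp [raw] at h <;> first | rfl | (have := hne ‹_›; simp_all)
  | pi A B ihA ihB =>
    cases u <;> simp [raw] at h
    · rw [ihA h.1, ihB h.2]
    · exact ((hne _).2.2.2.2.1 _ _ h.symm).elim
  | lam t ih =>
    cases u <;> simp [raw] at h
    · rw [ih h]
    · exact ((hne _).2.2.2.2.2 _ h.symm).elim
  | neu n ih =>
    cases u <;> simp [raw] at h <;> first | (have := hne n; simp_all; done) | rw [ih h]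
  | var i => cases u <;> simp [raw] at h; rw [h]
  | mvar i => cases u <;> simp [raw] at h; rw [h]
  | app n t ihn iht => cases u <;> simp [raw] at h; rw [ihn h.1, iht h.2]
  | ite n A t u ihn ihA iht ihu =>
    cases u <;> simp [raw] at h; rw [ihn h.1, ihA h.2.1, iht h.2.2.1, ihu h.2.2.2]

theorem raw_eq_rename {c : Cls} {t : Exp c} : ∀ {ρ : ℕ → ℕ} {r : Raw}, t.raw = r.rename ρ →
    ∃ t₀ : Exp c, t = t₀.rename ρ ∧ r = t₀.raw := by
  induction t with
  | univ => intro ρ r h; cases r <;> simp [raw, Raw.rename] at h; exact ⟨.univ, rfl, rfl⟩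
  | bool => intro ρ r h; cases r <;> simp [raw, Raw.rename] at h; exact ⟨.bool, rfl, rfl⟩
  | tt => intro ρ r h; cases r <;> simp [raw, Raw.rename] at h; exact ⟨.tt, rfl, rfl⟩
  | ff => intro ρ r h; cases r <;> simp [raw, Raw.rename] at h; exact ⟨.ff, rfl, rfl⟩
  | pi A B ihA ihB =>
    intro ρ r h; cases r <;> simp [raw, Raw.rename] at h
    obtain ⟨A', rfl, rfl⟩ := ihA h.1
    obtain ⟨B', rfl, rfl⟩ := ihB h.2
    exact ⟨.pi A' B', rfl, rfl⟩
  | lam t ih =>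
    intro ρ r h; cases r <;> simp [raw, Raw.rename] at h
    obtain ⟨t', rfl, rfl⟩ := ih h
    exact ⟨.lam t', rfl, rfl⟩
  | neu n ih =>
    intro ρ r h
    obtain ⟨n', rfl, rfl⟩ := ih h
    exact ⟨.neu n', rfl, rfl⟩
  | var i =>
    intro ρ r h; cases r <;> simp [raw, Raw.rename] at h
    rename_i j
    exact ⟨.var j, by rw [h]; rfl, rfl⟩
  | mvar i =>
    intro ρ r h; cases r <;> simp [raw, Raw.rename] at h
    rename_i j
    exact ⟨.mvar j, by rw [h]; rfl, rfl⟩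
  | app n t ihn iht =>
    intro ρ r h; cases r <;> simp [raw, Raw.rename] at h
    obtain ⟨n', rfl, rfl⟩ := ihn h.1
    obtain ⟨t', rfl, rfl⟩ := iht h.2
    exact ⟨.app n' t', rfl, rfl⟩
  | ite n A t u ihn ihA iht ihu =>
    intro ρ r h; cases r <;> simp [raw, Raw.rename] at h
    obtain ⟨n', rfl, rfl⟩ := ihn h.1
    obtain ⟨A', rfl, rfl⟩ := ihA h.2.1
    obtain ⟨t', rfl, rfl⟩ := iht h.2.2.1
    obtain ⟨u', rfl, rfl⟩ := ihu h.2.2.2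
    exact ⟨.ite n' A' t' u', rfl, rfl⟩

end Exp

theorem Eta.neu_inv {n : Ne} {t : Tm} (h : Eta (Exp.neu n) t) : ∃ n', t = .neu n' ∧ Eta n n' := by
  cases h with
  | neu h => exact ⟨_, rfl, h⟩

/-- Reduction of normal forms is eta-reduction. -/
theorem Par.exists_eta {r r' : Raw} (h : Par r r') :
    ∀ {t : Tm}, r = t.raw → ∃ t' : Tm, r' = t'.raw ∧ Eta t t' := by
  have hneu : ∀ {n : Ne} {r : Raw}, (∃ t' : Tm, r = t'.raw ∧ Eta (Exp.neu n) t') →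
      ∃ n' : Ne, r = n'.raw ∧ Eta n n' := by
    rintro n _ ⟨t', rfl, h⟩
    obtain ⟨n', rfl, hn⟩ := h.neu_inv
    exact ⟨n', rfl, hn⟩
  induction h with
  | univ | bool | tt | ff | var | mvar => intro t e; exact ⟨t, e, .refl t⟩
  | pi _ _ ih₁ ih₂ =>
    intro t e
    cases t with
    | pi A B =>
      simp only [raw, Raw.pi.injEq] at e
      obtain ⟨A', rfl, h₁⟩ := ih₁ e.1
      obtain ⟨B', rfl, h₂⟩ := ih₂ e.2
      exact ⟨.pi A' B', rfl, .pi h₁ h₂⟩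
    | neu n => cases n <;> simp [raw] at e
    | _ => simp [raw] at e
  | lam _ ih =>
    intro t e
    cases t with
    | lam t =>
      simp only [raw, Raw.lam.injEq] at e
      obtain ⟨t', rfl, h⟩ := ih e
      exact ⟨.lam t', rfl, .lam h⟩
    | neu n => cases n <;> simp [raw] at e
    | _ => simp [raw] at e
  | app _ _ ih₁ ih₂ =>
    intro t e
    cases t with
    | neu n =>
      cases n <;> simp only [raw, Raw.app.injEq, reduceCtorEq] at e
      rename_i n t
      obtain ⟨n', rfl, h₁⟩ := hneu (ih₁ (t := .neu n) e.1)
      obtain ⟨t', rfl, h₂⟩ := ih₂ e.2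
      exact ⟨.neu (.app n' t'), rfl, .neu (.app h₁ h₂)⟩
    | _ => simp [raw] at e
  | ite _ _ _ _ ih₁ ih₂ ih₃ ih₄ =>
    intro t e
    cases t with
    | neu n =>
      cases n <;> simp only [raw, Raw.ite.injEq, reduceCtorEq] at e
      rename_i n A t u
      obtain ⟨n', rfl, h₁⟩ := hneu (ih₁ (t := .neu n) e.1)
      obtain ⟨A', rfl, h₂⟩ := ih₂ e.2.1
      obtain ⟨t', rfl, h₃⟩ := ih₃ e.2.2.1
      obtain ⟨u', rfl, h₄⟩ := ih₄ e.2.2.2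
      exact ⟨.neu (.ite n' A' t' u'), rfl, .neu (.ite h₁ h₂ h₃ h₄)⟩
    | _ => simp [raw] at e
  | beta _ _ _ ih₁ ih₂ =>
    intro t e
    cases t with
    | neu n =>
      cases n with
      | app n u => cases n <;> simp [raw] at e
      | _ => simp [raw] at e
    | _ => simp [raw] at e
  | iteTT _ ih =>
    intro t e
    cases t with
    | neu n =>
      cases n with
      | ite n A u v => cases n <;> simp [raw] at e
      | _ => simp [raw] at e
    | _ => simp [raw] at e
  | iteFF _ ih =>
    intro t e
    cases t with
    | neu n =>
      cases n with
      | ite n A u v => cases n <;> simp [raw] at e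
      | _ => simp [raw] at e
    | _ => simp [raw] at e
  | eta em _ ih =>
    intro t e
    subst em
    cases t with
    | lam b =>
      cases b with
      | neu n =>
        cases n with
        | app p q =>
          simp only [raw, Raw.lam.injEq, Raw.app.injEq] at e
          obtain ⟨p, rfl, rfl⟩ := raw_eq_rename e.1.symm
          obtain ⟨n', rfl, h⟩ := hneu (ih (t := .neu p) rfl)
          cases raw_injective (u := .neu (.var 0)) e.2.symm
          exact ⟨.neu n', rfl, .eta rfl h⟩
        | _ => simp [raw] at e
      | _ => simp [raw] at e
    | neu n => cases n <;> simp [raw] at e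
    | _ => simp [raw] at e

/-- Iterated eta-reduction. -/
abbrev Etas {c : Cls} : Exp c → Exp c → Prop := Relation.ReflTransGen Eta

theorem Etas.cv {c : Cls} {t t' : Exp c} (h : Etas t t') : Cv t.raw t'.raw := by
  induction h with
  | refl => exact .refl _
  | tail _ h ih => exact ih.trans (.of_par h.par)

theorem Pars.exists_etas {t : Tm} {r : Raw} (h : Pars t.raw r) :
    ∃ t' : Tm, r = t'.raw ∧ Etas t t' := by
  induction h with
  | refl => exact ⟨t, rfl, .refl⟩
  | tail _ h ih =>
    obtain ⟨t', rfl, h₁⟩ := ih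
    obtain ⟨t'', rfl, h₂⟩ := h.exists_eta rfl
    exact ⟨t'', rfl, h₁.tail h₂⟩

/-- Convertible normal forms have a common eta-reduct. -/
theorem Cv.exists_etas {t u : Tm} (h : Cv t.raw u.raw) : ∃ w, Etas t w ∧ Etas u w := by
  obtain ⟨r, h₁, h₂⟩ := h
  obtain ⟨w, rfl, k₁⟩ := h₁.exists_etas
  obtain ⟨w', e, k₂⟩ := h₂.exists_etas
  cases raw_injective e
  exact ⟨w, k₁, k₂⟩

theorem Etas.neu_inv {n : Ne} {t : Tm} (h : Etas (Exp.neu n) t) :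
    ∃ n', t = .neu n' ∧ Etas n n' := by
  induction h with
  | refl => exact ⟨n, rfl, .refl⟩
  | tail _ h ih =>
    obtain ⟨n', rfl, h₁⟩ := ih
    obtain ⟨n'', rfl, h₂⟩ := h.neu_inv
    exact ⟨n'', rfl, h₁.tail h₂⟩

theorem Cv.exists_etas_ne {n m : Ne} (h : Cv n.raw m.raw) : ∃ p, Etas n p ∧ Etas m p := by
  obtain ⟨w, h₁, h₂⟩ := Cv.exists_etas (t := .neu n) (u := .neu m) h
  obtain ⟨p, rfl, k₁⟩ := h₁.neu_inv
  obtain ⟨q, e, k₂⟩ := h₂.neu_inv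
  cases e
  exact ⟨p, k₁, k₂⟩

-- Inversion of conversion between normal forms

/-- The head constructor of a term, not distinguishing abstractions from neutral terms. -/
def Exp.kind : Tm → ℕ
  | .univ => 0
  | .bool => 1
  | .tt => 2
  | .ff => 3
  | .pi _ _ => 4
  | .lam _ => 5
  | .neu _ => 5

theorem Etas.kind {t u : Tm} (h : Etas t u) : t.kind = u.kind := by
  induction h with
  | refl => rfl
  | tail _ h ih => rw [ih]; cases h <;> rfl

theorem Cv.kind {t u : Tm} (h : Cv t.raw u.raw) : t.kind = u.kind := by
  obtain ⟨w, h₁, h₂⟩ := h.exists_etas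
  rw [h₁.kind, h₂.kind]

theorem Cv.eq_univ {t : Tm} (h : Cv t.raw .univ) : t = .univ := by
  have := Cv.kind (u := .univ) h
  cases t <;> simp [Exp.kind] at this
  rfl

theorem Cv.eq_bool {t : Tm} (h : Cv t.raw .bool) : t = .bool := by
  have := Cv.kind (u := .bool) h
  cases t <;> simp [Exp.kind] at this
  rfl

theorem Cv.eq_tt {t : Tm} (h : Cv t.raw .tt) : t = .tt := by
  have := Cv.kind (u := .tt) h
  cases t <;> simp [Exp.kind] at this
  rfl

theorem Cv.eq_ff {t : Tm} (h : Cv t.raw .ff) : t = .ff := by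
  have := Cv.kind (u := .ff) h
  cases t <;> simp [Exp.kind] at this
  rfl

/-- The components `A` and `B` need not be normal, so the common reduct is used directly: it is a
function type, and it is an eta-reduct of `t`, which has the same `kind`. -/
theorem Cv.eq_pi {t : Tm} {A B : Raw} (h : Cv t.raw (.pi A B)) :
    ∃ A' B', t = .pi A' B' ∧ Cv A'.raw A ∧ Cv B'.raw B := by
  obtain ⟨r, h₁, h₂⟩ := h
  obtain ⟨X, Y, rfl, hX, hY⟩ := h₂.pi_inv
  obtain ⟨w, e, hw⟩ := h₁.exists_etas
  have hk : t.kind = 4 := by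
    rw [hw.kind]
    cases w with
    | neu n => cases n <;> simp [raw] at e
    | _ => first | rfl | simp [raw] at e
  cases t <;> simp [Exp.kind] at hk
  rename_i A' B'
  have := Cv.pi_inv (A := A'.raw) (B := B'.raw) (A' := A) (B' := B) ⟨_, h₁, h₂⟩
  exact ⟨_, _, rfl, this⟩

/-- Normal forms convertible to abstractions or neutral terms can be applied. -/
theorem AppElim.exists_of_kind {t : Tm} (h : t.kind = 5) :
    ∃ r, AppElim t.shift (Exp.neu (.var 0)) r := by
  cases t <;> simp [Exp.kind] at h
  · exact ⟨_, appElim_lam_var.2 rfl⟩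
  · exact ⟨_, .neu⟩

/-- Eta contracts abstractions only, so among neutral terms it preserves the outermost constructor
in both directions. Conversion of neutral terms is thus structural, here and in `Cv.ne_app` and
`Cv.ne_ite`. -/
theorem Cv.ne_var {i : ℕ} {m : Ne} (h : Cv (.var i) m.raw) : m = .var i := by
  obtain ⟨p, h₁, h₂⟩ := Cv.exists_etas_ne (n := .var i) h
  have hp : p = .var i := by
    clear h₂ h
    induction h₁ with
    | refl => rfl
    | tail _ h ih => subst ih; cases h; rfl
  subst hp
  clear h h₁
  induction h₂ using Relation.ReflTransGen.head_induction_on with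
  | refl => rfl
  | head h _ ih => subst ih; cases h; rfl

theorem Etas.app_inv {n : Ne} {t : Tm} {m : Ne} (h : Etas (app n t) m) :
    ∃ n' t', m = .app n' t' ∧ Etas n n' ∧ Etas t t' := by
  induction h with
  | refl => exact ⟨_, _, rfl, .refl, .refl⟩
  | tail _ h ih =>
    obtain ⟨_, _, rfl, h₁, h₂⟩ := ih
    cases h with
    | app h₃ h₄ => exact ⟨_, _, rfl, h₁.tail h₃, h₂.tail h₄⟩

theorem Etas.ite_inv {n : Ne} {A t u : Tm} {m : Ne} (h : Etas (ite n A t u) m) :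
    ∃ n' A' t' u', m = .ite n' A' t' u' ∧ Etas n n' ∧ Etas A A' ∧ Etas t t' ∧ Etas u u' := by
  induction h with
  | refl => exact ⟨_, _, _, _, rfl, .refl, .refl, .refl, .refl⟩
  | tail _ h ih =>
    obtain ⟨_, _, _, _, rfl, h₁, h₂, h₃, h₄⟩ := ih
    cases h with
    | ite k₁ k₂ k₃ k₄ =>
      exact ⟨_, _, _, _, rfl, h₁.tail k₁, h₂.tail k₂, h₃.tail k₃, h₄.tail k₄⟩

theorem Cv.ne_app {n : Ne} {t : Tm} {m : Ne} (h : Cv (Exp.app n t).raw m.raw) :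
    ∃ n' t', m = .app n' t' ∧ Cv n.raw n'.raw ∧ Cv t.raw t'.raw := by
  obtain ⟨p, h₁, h₂⟩ := h.exists_etas_ne
  obtain ⟨n₁, t₁, rfl, hn, ht⟩ := h₁.app_inv
  have : ∃ n' t', m = .app n' t' := by
    clear h h₁
    generalize e : Exp.app n₁ t₁ = p at h₂
    induction h₂ using Relation.ReflTransGen.head_induction_on with
    | refl => exact ⟨_, _, e.symm⟩
    | head h _ ih => obtain ⟨_, _, rfl⟩ := ih; cases h; exact ⟨_, _, rfl⟩
  obtain ⟨n', t', rfl⟩ := this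
  obtain ⟨_, _, e, hn', ht'⟩ := h₂.app_inv
  cases e
  exact ⟨_, _, rfl, hn.cv.trans hn'.cv.symm, ht.cv.trans ht'.cv.symm⟩

theorem Cv.ne_ite {n : Ne} {A t u : Tm} {m : Ne} (h : Cv (Exp.ite n A t u).raw m.raw) :
    ∃ n' A' t' u', m = .ite n' A' t' u' ∧ Cv n.raw n'.raw ∧ Cv A.raw A'.raw ∧ Cv t.raw t'.raw ∧
      Cv u.raw u'.raw := by
  obtain ⟨p, h₁, h₂⟩ := h.exists_etas_ne
  obtain ⟨n₁, A₁, t₁, u₁, rfl, hn, hA, ht, hu⟩ := h₁.ite_inv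
  have : ∃ n' A' t' u', m = .ite n' A' t' u' := by
    clear h h₁
    generalize e : Exp.ite n₁ A₁ t₁ u₁ = p at h₂
    induction h₂ using Relation.ReflTransGen.head_induction_on with
    | refl => exact ⟨_, _, _, _, e.symm⟩
    | head h _ ih => obtain ⟨_, _, _, _, rfl⟩ := ih; cases h; exact ⟨_, _, _, _, rfl⟩
  obtain ⟨n', A', t', u', rfl⟩ := this
  obtain ⟨_, _, _, _, e, hn', hA', ht', hu'⟩ := h₂.ite_inv
  cases e
  exact ⟨_, _, _, _, rfl, hn.cv.trans hn'.cv.symm, hA.cv.trans hA'.cv.symm,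
    ht.cv.trans ht'.cv.symm, hu.cv.trans hu'.cv.symm⟩

-- Hereditary substitution under eta-reduction

/-- Pointwise eta-reduction of substitutions. -/
structure Sub.Eta (s s' : Sub) : Prop where
  var : ∀ i, TCU.Eta (s.var i) (s'.var i)
  mvar : ∀ α, TCU.Eta (s.mvar α) (s'.mvar α)

theorem Sub.Eta.lift {s s' : Sub} (h : s.Eta s') : s.lift.Eta s'.lift where
  var i := by
    cases i
    · exact .refl _
    · exact (h.var _).rename _
  mvar α := (h.mvar α).rename _

theorem Sub.Eta.one {u u' : Tm} (h : TCU.Eta u u') : (Sub.one u).Eta (Sub.one u') where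
  var i := by
    cases i
    · exact h
    · exact .refl _
  mvar _ := .refl _

/-- Passing to raw terms makes `Par.of_rename` available; `Par.exists_eta` leads back to normal
forms. -/
theorem Eta.of_shift {t u : Tm} (h : Eta t.shift u.shift) : Eta t u := by
  have := h.par
  rw [raw_shift, raw_shift] at this
  obtain ⟨r, e, h⟩ := this.of_rename Nat.succ_injective rfl
  cases Raw.rename_injective Nat.succ_injective e
  obtain ⟨u', e, h⟩ := h.exists_eta rfl
  cases raw_injective e
  exact h

/-- Hereditary substitution stays defined when its arguments are eta-reduced. -/
theorem HSub.eta {c : Cls} {s : Sub} {t : Exp c} {r : Tm} (h : HSub s t r) :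
    ∀ {s' : Sub} {t' : Exp c}, s.Eta s' → Eta t t' → ∃ r', HSub s' t' r' ∧ Eta r r' := by
  induction h using HSub.induct with
  | univ => intro s' t' hs ht; cases ht; exact ⟨_, .univ, .refl _⟩
  | bool => intro s' t' hs ht; cases ht; exact ⟨_, .bool, .refl _⟩
  | tt => intro s' t' hs ht; cases ht; exact ⟨_, .tt, .refl _⟩
  | ff => intro s' t' hs ht; cases ht; exact ⟨_, .ff, .refl _⟩
  | var => intro s' t' hs ht; cases ht; exact ⟨_, .var, hs.var _⟩
  | mvar => intro s' t' hs ht; cases ht; exact ⟨_, .mvar, hs.mvar _⟩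
  | pi _ _ ih₁ ih₂ =>
    intro s' t' hs ht
    cases ht with
    | pi k₁ k₂ =>
    obtain ⟨_, h₁, e₁⟩ := ih₁ hs k₁
    obtain ⟨_, h₂, e₂⟩ := ih₂ hs.lift k₂
    exact ⟨_, .pi h₁ h₂, .pi e₁ e₂⟩
  | lam h ih ih' =>
    intro s' t' hs ht
    cases ht with
    | lam k =>
      obtain ⟨_, h₁, e₁⟩ := ih hs.lift k
      exact ⟨_, .lam h₁, .lam e₁⟩
    | eta em k =>
      subst em
      -- The eta-redex disappears, so the new derivation starts from the one for its function part,
      -- which lies inside the derivation for the body. Here the extra clause of `HSub.induct` is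
      -- needed.
      obtain ⟨v₀, u', h₁, ih₁, h₂, h₃⟩ := ih' _ _ rfl
      obtain ⟨w, k₁, e⟩ := ih₁ hs.lift (k.rename Nat.succ)
      obtain ⟨v, rfl, h₁⟩ := h₁.of_shift
      obtain ⟨w, rfl, k₂⟩ := k₁.of_shift
      refine ⟨w, .neu k₂, ?_⟩
      cases h₂.det (.neu .var)
      have e := e.of_shift
      -- If the function part becomes an abstraction, applying its weakening to the new variable
      -- restores its body and the result is unchanged. If it becomes neutral, the result is itself
      -- an eta-redex.
      cases v with
      | lam b => cases appElim_lam_var.1 h₃; exact e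
      | neu m =>
        cases appElim_neu.1 h₃
        obtain ⟨m', rfl, em⟩ := e.neu_inv
        exact .eta rfl em
      | _ => cases h₃
  | neu _ ih =>
    intro s' t' hs ht
    cases ht with
    | neu k =>
    obtain ⟨_, h₁, e₁⟩ := ih hs k
    exact ⟨_, .neu h₁, e₁⟩
  | app_neu _ _ ih₁ ih₂ =>
    intro s' t' hs ht
    cases ht with
    | app k₁ k₂ =>
    obtain ⟨_, h₁, e₁⟩ := ih₁ hs k₁
    obtain ⟨_, h₂, e₂⟩ := ih₂ hs k₂
    obtain ⟨m, rfl, em⟩ := e₁.neu_inv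
    exact ⟨_, .app h₁ h₂ .neu, .neu (.app em e₂)⟩
  | app_lam _ _ _ ih₁ ih₂ ih₃ =>
    intro s' t' hs ht
    cases ht with
    | app k₁ k₂ =>
    obtain ⟨v, h₁, e₁⟩ := ih₁ hs k₁
    obtain ⟨_, h₂, e₂⟩ := ih₂ hs k₂
    cases e₁ with
    | lam e₁ =>
      obtain ⟨_, h₃, e₃⟩ := ih₃ (.one e₂) e₁
      exact ⟨_, .app h₁ h₂ (.lam h₃), e₃⟩
    | @eta m n n' em e₁ =>
      subst em
      -- The function turns from an abstraction into the neutral `n'`, so the beta-step is lost. The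
      -- induction hypothesis for the reduced body `n' x` shows that the application of `n'` is
      -- still an eta-reduct of the old result.
      obtain ⟨_, h₃, e₃⟩ := ih₃ (t' := .neu (.app n'.shift (.neu (.var 0)))) (.one e₂)
        (.neu (.app (e₁.rename _) (.refl _)))
      cases h₃.det (.neu (.app (.shift_one _ _) (.neu .var) .neu))
      exact ⟨_, .app h₁ h₂ .neu, e₃⟩
  | ite _ _ _ _ h ih₁ ih₂ ih₃ ih₄ =>
    intro s' t' hs ht
    cases ht with
    | ite k₁ k₂ k₃ k₄ =>
    obtain ⟨w, h₁, e₁⟩ := ih₁ hs k₁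
    obtain ⟨_, h₂, e₂⟩ := ih₂ hs.lift k₂
    obtain ⟨_, h₃, e₃⟩ := ih₃ hs k₃
    obtain ⟨_, h₄, e₄⟩ := ih₄ hs k₄
    cases h with
    | tt => cases e₁; exact ⟨_, .ite h₁ h₂ h₃ h₄ .tt, e₃⟩
    | ff => cases e₁; exact ⟨_, .ite h₁ h₂ h₃ h₄ .ff, e₄⟩
    | neu =>
      obtain ⟨m, rfl, em⟩ := e₁.neu_inv
      exact ⟨_, .ite h₁ h₂ h₃ h₄ .neu, .neu (.ite em e₂ e₃ e₄)⟩


/-! ### Declarative typing of raw terms -/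

/-- Extension of a raw context, a map from variables to types over the whole context. -/
def Raw.cons (A : Raw) (Γ : ℕ → Raw) : ℕ → Raw
  | 0 => A.rename Nat.succ
  | i + 1 => (Γ i).rename Nat.succ

/-- Typing of raw terms up to conversion. The types are not required to be well formed. -/
inductive RTyped : (ℕ → Raw) → Raw → Raw → Prop
  | univ {Γ : ℕ → Raw} : RTyped Γ .univ .univ
  | bool {Γ : ℕ → Raw} : RTyped Γ .bool .univ
  | tt {Γ : ℕ → Raw} : RTyped Γ .tt .bool
  | ff {Γ : ℕ → Raw} : RTyped Γ .ff .bool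
  | pi {Γ : ℕ → Raw} {A B : Raw} :
      RTyped Γ A .univ → RTyped (.cons A Γ) B .univ → RTyped Γ (.pi A B) .univ
  | lam {Γ : ℕ → Raw} {t A B : Raw} : RTyped (.cons A Γ) t B → RTyped Γ (.lam t) (.pi A B)
  | var {Γ : ℕ → Raw} {i : ℕ} : RTyped Γ (.var i) (Γ i)
  | app {Γ : ℕ → Raw} {n t A B : Raw} :
      RTyped Γ n (.pi A B) → RTyped Γ t A → RTyped Γ (.app n t) (B.subst (.one t))
  | ite {Γ : ℕ → Raw} {n A t u : Raw} :
      RTyped Γ n .bool → RTyped (.cons .bool Γ) A .univ → RTyped Γ t (A.subst (.one .tt)) →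
      RTyped Γ u (A.subst (.one .ff)) → RTyped Γ (.ite n A t u) (A.subst (.one n))
  | conv {Γ : ℕ → Raw} {t A B : Raw} : RTyped Γ t A → Cv A B → RTyped Γ t B

namespace RTyped

theorem rename {Γ : ℕ → Raw} {t T : Raw} (h : RTyped Γ t T) : ∀ {Δ : ℕ → Raw} {ρ : ℕ → ℕ},
    (∀ i, Δ (ρ i) = (Γ i).rename ρ) → RTyped Δ (t.rename ρ) (T.rename ρ) := by
  have hl : ∀ {Γ Δ : ℕ → Raw} {ρ : ℕ → ℕ} (A : Raw), (∀ i, Δ (ρ i) = (Γ i).rename ρ) →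
      ∀ i, Raw.cons (A.rename ρ) Δ (liftRen ρ i) = (Raw.cons A Γ i).rename (liftRen ρ) := by
    intro Γ Δ ρ A h i
    cases i
    · simp only [Raw.cons, liftRen, Raw.rename_rename]; rfl
    · simp only [Raw.cons, liftRen, h, Raw.rename_rename]; rfl
  induction h with
  | univ => intros; exact .univ
  | bool => intros; exact .bool
  | tt => intros; exact .tt
  | ff => intros; exact .ff
  | pi _ _ ih₁ ih₂ => intro Δ ρ h; exact .pi (ih₁ h) (ih₂ (hl _ h))
  | lam _ ih => intro Δ ρ h; exact .lam (ih (hl _ h))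
  | var => intro Δ ρ h; rw [← h]; exact .var
  | app _ _ ih₁ ih₂ =>
    intro Δ ρ h
    rw [Raw.subst_one_rename]
    exact .app (ih₁ h) (ih₂ h)
  | ite _ _ _ _ ih₁ ih₂ ih₃ ih₄ =>
    intro Δ ρ h
    have h₃ := ih₃ h
    have h₄ := ih₄ h
    rw [Raw.subst_one_rename] at h₃ h₄ ⊢
    exact .ite (ih₁ h) (ih₂ (hl .bool h)) h₃ h₄
  | conv _ hc ih => intro Δ ρ h; exact .conv (ih h) (hc.rename ρ)

theorem weaken {Γ : ℕ → Raw} {t T : Raw} (h : RTyped Γ t T) (A : Raw) :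
    RTyped (.cons A Γ) (t.rename Nat.succ) (T.rename Nat.succ) :=
  h.rename fun _ => rfl

/-- Substitution; only the variables that occur need to be replaced by typed terms. -/
theorem subst {Γ : ℕ → Raw} {t T : Raw} (h : RTyped Γ t T) : ∀ {Δ s : ℕ → Raw},
    (∀ i, t.Occurs i → RTyped Δ (s i) ((Γ i).subst s)) → RTyped Δ (t.subst s) (T.subst s) := by
  have hup : ∀ {Γ Δ s : ℕ → Raw} (A t : Raw),
      (∀ i, t.Occurs (i + 1) → RTyped Δ (s i) ((Γ i).subst s)) →
      ∀ i, t.Occurs i → RTyped (.cons (A.subst s) Δ) (Raw.up s i)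
        ((Raw.cons A Γ i).subst (Raw.up s)) := by
    intro Γ Δ s A t h i hi
    cases i with
    | zero =>
      have : (A.rename Nat.succ).subst (Raw.up s) = (A.subst s).rename Nat.succ := by
        rw [Raw.subst_rename, Raw.rename_subst]; rfl
      simp only [Raw.cons, this]
      exact .var (i := 0)
    | succ i =>
      have : ((Γ i).rename Nat.succ).subst (Raw.up s) = ((Γ i).subst s).rename Nat.succ := by
        rw [Raw.subst_rename, Raw.rename_subst]; rfl
      simp only [Raw.cons, this]
      exact (h i hi).weaken _
  induction h with
  | univ => intros; exact .univ
  | bool => intros; exact .bool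
  | tt => intros; exact .tt
  | ff => intros; exact .ff
  | pi _ _ ih₁ ih₂ =>
    intro Δ s h
    exact .pi (ih₁ fun i hi => h i (.inl hi)) (ih₂ (hup _ _ fun i hi => h i (.inr hi)))
  | lam _ ih => intro Δ s h; exact .lam (ih (hup _ _ h))
  | var => intro Δ s h; exact h _ rfl
  | app _ _ ih₁ ih₂ =>
    intro Δ s h
    rw [Raw.subst_one_subst]
    exact .app (ih₁ fun i hi => h i (.inl hi)) (ih₂ fun i hi => h i (.inr hi))
  | ite _ _ _ _ ih₁ ih₂ ih₃ ih₄ =>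
    intro Δ s h
    have h₃ := ih₃ fun i hi => h i (.inr (.inr (.inl hi)))
    have h₄ := ih₄ fun i hi => h i (.inr (.inr (.inr hi)))
    rw [Raw.subst_one_subst] at h₃ h₄ ⊢
    exact .ite (ih₁ fun i hi => h i (.inl hi)) (ih₂ (hup .bool _ fun i hi => h i (.inr (.inl hi))))
      h₃ h₄
  | conv _ hc ih => intro Δ s h; exact .conv (ih h) (hc.subst s)

theorem ctx_cv {Γ Δ : ℕ → Raw} {t T : Raw} (h : RTyped Γ t T) (hc : ∀ i, Cv (Γ i) (Δ i)) :
    RTyped Δ t T := by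
  have := h.subst (Δ := Δ) (s := .var) fun i _ => by
    rw [Raw.subst_var]; exact .conv .var (hc i).symm
  rwa [Raw.subst_var, Raw.subst_var] at this

theorem one {Γ : ℕ → Raw} {u A : Raw} (h : RTyped Γ u A) (i : ℕ) :
    RTyped Γ (Raw.one u i) ((Raw.cons A Γ i).subst (.one u)) := by
  cases i
  · simp only [Raw.cons, Raw.subst_succ_one]; exact h
  · simp only [Raw.cons, Raw.subst_succ_one]; exact .var

theorem pi_inv {Γ : ℕ → Raw} {A B T : Raw} (h : RTyped Γ (.pi A B) T) :
    RTyped Γ A .univ ∧ RTyped (.cons A Γ) B .univ ∧ Cv .univ T := by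
  generalize e : Raw.pi A B = t at h
  induction h <;> cases e
  · exact ⟨‹_›, ‹_›, .refl _⟩
  · rename_i hc _ ih
    have ih := ih rfl
    exact ⟨ih.1, ih.2.1, ih.2.2.trans hc⟩

theorem lam_inv {Γ : ℕ → Raw} {t T : Raw} (h : RTyped Γ (.lam t) T) :
    ∃ A B, RTyped (.cons A Γ) t B ∧ Cv (.pi A B) T := by
  generalize e : Raw.lam t = t' at h
  induction h <;> cases e
  · exact ⟨_, _, ‹_›, .refl _⟩
  · rename_i hc _ ih
    obtain ⟨A, B, h, hc'⟩ := ih rfl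
    exact ⟨A, B, h, hc'.trans hc⟩

theorem app_inv {Γ : ℕ → Raw} {n t T : Raw} (h : RTyped Γ (.app n t) T) :
    ∃ A B, RTyped Γ n (.pi A B) ∧ RTyped Γ t A ∧ Cv (B.subst (.one t)) T := by
  generalize e : Raw.app n t = t' at h
  induction h <;> cases e
  · exact ⟨_, _, ‹_›, ‹_›, .refl _⟩
  · rename_i hc _ ih
    obtain ⟨A, B, h, h', hc'⟩ := ih rfl
    exact ⟨A, B, h, h', hc'.trans hc⟩

theorem ite_inv {Γ : ℕ → Raw} {n A t u T : Raw} (h : RTyped Γ (.ite n A t u) T) :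
    RTyped Γ n .bool ∧ RTyped (.cons .bool Γ) A .univ ∧ RTyped Γ t (A.subst (.one .tt)) ∧
      RTyped Γ u (A.subst (.one .ff)) ∧ Cv (A.subst (.one n)) T := by
  generalize e : Raw.ite n A t u = t' at h
  induction h <;> cases e
  · exact ⟨‹_›, ‹_›, ‹_›, ‹_›, .refl _⟩
  · rename_i hc _ ih
    obtain ⟨h₁, h₂, h₃, h₄, hc'⟩ := ih rfl
    exact ⟨h₁, h₂, h₃, h₄, hc'.trans hc⟩

theorem var_inv {Γ : ℕ → Raw} {i : ℕ} {T : Raw} (h : RTyped Γ (.var i) T) : Cv (Γ i) T := by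
  generalize e : Raw.var i = t' at h
  induction h <;> cases e
  · exact .refl _
  · rename_i hc _ ih
    exact (ih rfl).trans hc

theorem mvar_inv {Γ : ℕ → Raw} {α : ℕ} {T : Raw} (h : RTyped Γ (.mvar α) T) : False := by
  generalize e : Raw.mvar α = t' at h
  induction h <;> cases e
  rename_i ih
  exact ih rfl

theorem univ_inv {Γ : ℕ → Raw} {T : Raw} (h : RTyped Γ .univ T) : Cv .univ T := by
  generalize e : Raw.univ = t' at h
  induction h <;> cases e
  · exact .refl _
  · rename_i hc _ ih
    exact (ih rfl).trans hc

theorem bool_inv {Γ : ℕ → Raw} {T : Raw} (h : RTyped Γ .bool T) : Cv .univ T := by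
  generalize e : Raw.bool = t' at h
  induction h <;> cases e
  · exact .refl _
  · rename_i hc _ ih
    exact (ih rfl).trans hc

theorem tt_inv {Γ : ℕ → Raw} {T : Raw} (h : RTyped Γ .tt T) : Cv .bool T := by
  generalize e : Raw.tt = t' at h
  induction h <;> cases e
  · exact .refl _
  · rename_i hc _ ih
    exact (ih rfl).trans hc

theorem ff_inv {Γ : ℕ → Raw} {T : Raw} (h : RTyped Γ .ff T) : Cv .bool T := by
  generalize e : Raw.ff = t' at h
  induction h <;> cases e
  · exact .refl _
  · rename_i hc _ ih
    exact (ih rfl).trans hc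

/-- Abstractions carry no domain, so inversion produces some other function type. By injectivity its
components are convertible to the given ones, and the context can be changed accordingly. -/
theorem lam_pi_inv {Γ : ℕ → Raw} {t A B : Raw} (h : RTyped Γ (.lam t) (.pi A B)) :
    RTyped (.cons A Γ) t B := by
  obtain ⟨A', B', h, hc⟩ := h.lam_inv
  obtain ⟨hA, hB⟩ := hc.pi_inv
  refine .conv (h.ctx_cv fun i => ?_) hB
  cases i
  · exact hA.rename _
  · exact .refl _

/-- Normal forms of function type are abstractions or neutral. -/
theorem kind_of_pi {Γ : ℕ → Raw} {t : Tm} {A B : Raw} (h : RTyped Γ t.raw (.pi A B)) :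
    t.kind = 5 := by
  cases t with
  | univ => exact (h.univ_inv.not_univ_pi).elim
  | bool => exact (h.bool_inv.not_univ_pi).elim
  | tt => exact (h.tt_inv.not_bool_pi).elim
  | ff => exact (h.ff_inv.not_bool_pi).elim
  | pi => exact (h.pi_inv.2.2.not_univ_pi).elim
  | lam => rfl
  | neu => rfl

/-- The head variable fixes the type, which is then propagated by injectivity of function types; an
`ite` carries its own motive. Abstractions have no such determined type. -/
theorem unique {n : Ne} : ∀ {Γ : ℕ → Raw} {T T' : Raw}, RTyped Γ n.raw T → RTyped Γ n.raw T' →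
    Cv T T' := by
  suffices ∀ {c : Cls} (n : Exp c), c = .ne → ∀ {Γ : ℕ → Raw} {T T' : Raw}, RTyped Γ n.raw T →
      RTyped Γ n.raw T' → Cv T T' from @this _ n rfl
  intro c n
  induction n with
  | var i => intro _ Γ T T' h h'; exact h.var_inv.symm.trans h'.var_inv
  | mvar α => intro _ Γ T T' h; exact h.mvar_inv.elim
  | app n t ih _ =>
    intro _ Γ T T' h h'
    obtain ⟨A, B, h₁, -, h₂⟩ := h.app_inv
    obtain ⟨A', B', h₁', -, h₂'⟩ := h'.app_inv
    exact h₂.symm.trans (((ih rfl h₁ h₁').pi_inv.2.subst _).trans h₂')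
  | ite n A t u =>
    intro _ Γ T T' h h'
    exact h.ite_inv.2.2.2.2.symm.trans h'.ite_inv.2.2.2.2
  | _ => intro h; cases h

end RTyped

-- Subject reduction, and definedness under conversion

/-- Hereditary substitution preserves typing. -/
theorem HSub.rtyped {c : Cls} {s : Sub} {t : Exp c} {r : Tm} (h : HSub s t r) :
    ∀ {Γ Δ : ℕ → Raw} {T : Raw}, s.Plain →
      (∀ i, RTyped Δ (s.raw i) ((Γ i).subst s.raw)) → RTyped Γ t.raw T →
      RTyped Δ r.raw (T.subst s.raw) := by
  -- Under a function type the new context holds the hereditary instance `A'` of the domain, which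
  -- is only convertible to the raw instance.
  have hup : ∀ {s : Sub} {Γ Δ : ℕ → Raw} {A A' : Raw}, Cv (A.subst s.raw) A' →
      (∀ i, RTyped Δ (s.raw i) ((Γ i).subst s.raw)) →
      ∀ i, RTyped (.cons A' Δ) (s.lift.raw i) ((Raw.cons A Γ i).subst s.lift.raw) := by
    intro s Γ Δ A A' hA h i
    rw [Sub.raw_lift]
    cases i with
    | zero =>
      have : (A.rename Nat.succ).subst (Raw.up s.raw) = (A.subst s.raw).rename Nat.succ := by
        rw [Raw.subst_rename, Raw.rename_subst]; rfl
      simp only [Raw.cons, this]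
      exact .conv (.var (i := 0)) (hA.symm.rename _)
    | succ i =>
      have : ((Γ i).rename Nat.succ).subst (Raw.up s.raw) =
          ((Γ i).subst s.raw).rename Nat.succ := by
        rw [Raw.subst_rename, Raw.rename_subst]; rfl
      simp only [Raw.cons, this]
      exact (h i).weaken _
  induction h using HSub.induct with
  | univ => intro Γ Δ T hp hs ht; exact .conv .univ (ht.univ_inv.subst _)
  | bool => intro Γ Δ T hp hs ht; exact .conv .bool (ht.bool_inv.subst _)
  | tt => intro Γ Δ T hp hs ht; exact .conv .tt (ht.tt_inv.subst _)
  | ff => intro Γ Δ T hp hs ht; exact .conv .ff (ht.ff_inv.subst _)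
  | pi h₁ h₂ ih₁ ih₂ =>
    intro Γ Δ T hp hs ht
    obtain ⟨hA, hB, hT⟩ := ht.pi_inv
    exact .conv (.pi (ih₁ hp hs hA) (ih₂ hp.lift (hup (h₁.cv hp) hs) hB)) (hT.subst _)
  | lam h ih _ =>
    intro Γ Δ T hp hs ht
    obtain ⟨A, B, hB, hT⟩ := ht.lam_inv
    have := ih hp.lift (hup (.refl _) hs) hB
    rw [Sub.raw_lift] at this
    exact .conv (.lam this) (hT.subst _)
  | neu _ ih => exact ih
  | @var s i =>
    intro Γ Δ T hp hs ht
    exact .conv (hs i) (ht.var_inv.subst _)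
  | mvar => intro Γ Δ T hp hs ht; exact ht.mvar_inv.elim
  | app_neu h₁ h₂ ih₁ ih₂ =>
    intro Γ Δ T hp hs ht
    obtain ⟨A, B, hn, hu, hT⟩ := ht.app_inv
    refine .conv (.app (ih₁ hp hs hn) (ih₂ hp hs hu)) (.trans ?_ (hT.subst _))
    rw [Raw.subst_one_subst]
    exact .subst_one (.refl _) (h₂.cv hp).symm
  | app_lam h₁ h₂ _ ih₁ ih₂ ih₃ =>
    intro Γ Δ T hp hs ht
    obtain ⟨A, B, hn, hu, hT⟩ := ht.app_inv
    have h := ih₃ (Sub.plain_one _) (by rw [Sub.raw_one]; exact (ih₂ hp hs hu).one)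
      (ih₁ hp hs hn).lam_pi_inv
    refine .conv h (.trans ?_ (hT.subst _))
    rw [Sub.raw_one, Raw.subst_one_subst]
    exact .subst_one (.refl _) (h₂.cv hp).symm
  | @ite s _ _ _ _ _ _ _ _ _ h₁ h₂ _ _ h ih₁ ih₂ ih₃ ih₄ =>
    intro Γ Δ T hp hs ht
    obtain ⟨hn, hA, hu, hv, hT⟩ := ht.ite_inv
    have kA := h₂.cv hp.lift
    rw [Sub.raw_lift] at kA
    have ku := ih₃ hp hs hu
    have kv := ih₄ hp hs hv
    rw [Raw.subst_one_subst] at ku kv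
    have ku := ku.conv (kA.subst_one (.refl _))
    have kv := kv.conv (kA.subst_one (.refl _))
    have hT := hT.subst s.raw
    rw [Raw.subst_one_subst] at hT
    have hT := (kA.subst_one (h₁.cv hp)).symm.trans hT
    cases h with
    | tt => exact ku.conv hT
    | ff => exact kv.conv hT
    | neu => exact .conv (.ite (ih₁ hp hs hn) (ih₂ hp.lift (hup (.refl _) hs) hA) ku kv) hT

theorem HSub.rtyped_one {c : Cls} {t : Exp c} {u r : Tm} (h : HSub (.one u) t r) {Γ : ℕ → Raw}
    {A T : Raw} (hu : RTyped Γ u.raw A) (ht : RTyped (.cons A Γ) t.raw T) :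
    RTyped Γ r.raw (T.subst (.one u.raw)) := by
  have := h.rtyped (Sub.plain_one u) (by rw [Sub.raw_one]; exact hu.one) ht
  rwa [Sub.raw_one] at this

theorem AppElim.rtyped {t u r : Tm} (h : AppElim t u r) {Γ : ℕ → Raw} {A B : Raw}
    (ht : RTyped Γ t.raw (.pi A B)) (hu : RTyped Γ u.raw A) :
    RTyped Γ r.raw (B.subst (.one u.raw)) := by
  cases h with
  | lam h => exact h.rtyped_one hu ht.lam_pi_inv
  | neu => exact .app ht hu

/-- Typing of the application of a function to a new variable. -/
theorem AppElim.rtyped_var {t r : Tm} (h : AppElim t.shift (Exp.neu (.var 0)) r) {Γ : ℕ → Raw}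
    {A B : Raw} (ht : RTyped Γ t.raw (.pi A B)) : RTyped (.cons A Γ) r.raw B := by
  have := h.rtyped (by rw [raw_shift]; exact ht.weaken A) (.var (i := 0))
  exact this.conv (by rw [show (Exp.neu (.var 0)).raw = .var 0 from rfl,
    Raw.rename_lift_succ_one]; exact .refl _)

/-- Eta-reduction of normal forms preserves typing. -/
theorem Eta.rtyped {c : Cls} {t t' : Exp c} (h : Eta t t') :
    ∀ {Γ : ℕ → Raw} {T : Raw}, RTyped Γ t.raw T → RTyped Γ t'.raw T := by
  induction h with
  | univ | bool | tt | ff | var | mvar => intro Γ T h; exact h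
  | neu _ ih => exact ih
  | pi h₁ _ ih₁ ih₂ =>
    intro Γ T h
    obtain ⟨hA, hB, hT⟩ := h.pi_inv
    refine .conv (.pi (ih₁ hA) ((ih₂ hB).ctx_cv fun i => ?_)) hT
    cases i
    · exact (Cv.of_par h₁.par).rename _
    · exact .refl _
  | lam _ ih =>
    intro Γ T h
    obtain ⟨A, B, hB, hT⟩ := h.lam_inv
    exact .conv (.lam (ih hB)) hT
  | app _ h₂ ih₁ ih₂ =>
    intro Γ T h
    obtain ⟨A, B, hn, ht, hT⟩ := h.app_inv
    exact .conv (.app (ih₁ hn) (ih₂ ht))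
      (.trans (.subst_one (.refl _) (Cv.of_par h₂.par).symm) hT)
  | ite h₁ h₂ _ _ ih₁ ih₂ ih₃ ih₄ =>
    intro Γ T h
    obtain ⟨hn, hA, ht, hu, hT⟩ := h.ite_inv
    have cA := Cv.of_par h₂.par
    exact .conv (.ite (ih₁ hn) (ih₂ hA) ((ih₃ ht).conv (cA.subst_one (.refl _)))
      ((ih₄ hu).conv (cA.subst_one (.refl _))))
      (.trans (.subst_one cA.symm (Cv.of_par h₁.par).symm) hT)
  | @eta m n n' e _ ih =>
    intro Γ T h
    subst e
    obtain ⟨A, B, hB, hT⟩ := h.lam_inv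
    obtain ⟨X, Y, hn, h0, hY⟩ := hB.app_inv
    have hX := h0.var_inv
    -- Strengthening: the new variable does not occur in the weakened function part, so an arbitrary
    -- term, here `univ`, can be put for it without being typed.
    let s : ℕ → Raw := Raw.one .univ
    rw [raw_shift] at hn
    have h₀ : RTyped Γ n.raw ((Raw.pi X Y).subst s) := by
      have := hn.subst (Δ := Γ) (s := s) fun i hi => by
        obtain ⟨j, rfl, -⟩ := Raw.occurs_rename _ _ _ hi
        simp only [Raw.cons, s, Raw.subst_succ_one]
        exact .var
      simpa only [s, Raw.subst_succ_one] using this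
    -- Strengthening has replaced the new variable inside `X` and `Y`. Uniqueness of types shows
    -- that this did not matter up to conversion.
    have hu := RTyped.unique (n := n.shift) (by rw [raw_shift]; exact h₀.weaken A)
      (by rw [raw_shift]; exact hn)
    obtain ⟨cX, cY⟩ := hu.pi_inv
    have cX : Cv (X.subst s) A := .of_rename Nat.succ_injective (cX.trans hX.symm)
    have cY := cY.subst (.one (.var 0))
    rw [Raw.rename_lift_succ_one] at cY
    exact .conv (ih h₀) (.trans (.pi cX (cY.trans hY)) hT)

theorem Etas.rtyped {c : Cls} {t t' : Exp c} (h : Etas t t') {Γ : ℕ → Raw} {T : Raw}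
    (ht : RTyped Γ t.raw T) : RTyped Γ t'.raw T := by
  induction h with
  | refl => exact ht
  | tail _ h ih => exact h.rtyped ih

/-- Hereditary substitution stays defined when its arguments are eta-expanded to typed terms. -/
theorem HSub.of_eta {c : Cls} {s' : Sub} {t' : Exp c} {r' : Tm} (h : HSub s' t' r') :
    ∀ {s : Sub} {t : Exp c} {Γ Δ : ℕ → Raw} {T : Raw}, s.Eta s' → Eta t t' → s.Plain →
      (∀ i, RTyped Δ (s.raw i) ((Γ i).subst s.raw)) → RTyped Γ t.raw T →
      ∃ r, HSub s t r ∧ Eta r r' := by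
  have hup : ∀ {s : Sub} {Γ Δ : ℕ → Raw} {A : Raw},
      (∀ i, RTyped Δ (s.raw i) ((Γ i).subst s.raw)) →
      ∀ i, RTyped (.cons (A.subst s.raw) Δ) (s.lift.raw i)
        ((Raw.cons A Γ i).subst s.lift.raw) := by
    intro s Γ Δ A h i
    rw [Sub.raw_lift]
    cases i with
    | zero =>
      simp only [Raw.cons]
      rw [Raw.subst_rename]
      have : A.subst (fun i => Raw.up s.raw (Nat.succ i)) = (A.subst s.raw).rename Nat.succ := by
        rw [Raw.rename_subst]; rfl
      rw [this]
      exact .var (i := 0)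
    | succ i =>
      have : ((Γ i).rename Nat.succ).subst (Raw.up s.raw) =
          ((Γ i).subst s.raw).rename Nat.succ := by
        rw [Raw.subst_rename, Raw.rename_subst]; rfl
      simp only [Raw.cons, this]
      exact (h i).weaken _
  induction h using HSub.induct with
  | univ => intro s t Γ Δ T hs ht hp hd h; cases ht; exact ⟨_, .univ, .refl _⟩
  | bool => intro s t Γ Δ T hs ht hp hd h; cases ht; exact ⟨_, .bool, .refl _⟩
  | tt => intro s t Γ Δ T hs ht hp hd h; cases ht; exact ⟨_, .tt, .refl _⟩
  | ff => intro s t Γ Δ T hs ht hp hd h; cases ht; exact ⟨_, .ff, .refl _⟩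
  | var => intro s t Γ Δ T hs ht hp hd h; cases ht; exact ⟨_, .var, hs.var _⟩
  | mvar => intro s t Γ Δ T hs ht hp hd h; cases ht; exact ⟨_, .mvar, hs.mvar _⟩
  | pi _ _ ih₁ ih₂ =>
    intro s t Γ Δ T hs ht hp hd h
    cases ht with
    | pi k₁ k₂ =>
    obtain ⟨hA, hB, -⟩ := h.pi_inv
    obtain ⟨_, h₁, e₁⟩ := ih₁ hs k₁ hp hd hA
    obtain ⟨_, h₂, e₂⟩ := ih₂ hs.lift k₂ hp.lift (hup hd) hB
    exact ⟨_, .pi h₁ h₂, .pi e₁ e₂⟩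
  | lam _ ih _ =>
    intro s t Γ Δ T hs ht hp hd h
    cases ht with
    | lam k =>
    obtain ⟨A, B, hB, -⟩ := h.lam_inv
    obtain ⟨_, h₁, e₁⟩ := ih hs.lift k hp.lift (hup hd) hB
    exact ⟨_, .lam h₁, .lam e₁⟩
  | neu _ ih =>
    intro s t Γ Δ T hs ht hp hd h
    cases ht with
    | neu k =>
      obtain ⟨_, h₁, e₁⟩ := ih hs k hp hd h
      exact ⟨_, .neu h₁, e₁⟩
    | @eta m n _ e k =>
      subst e
      obtain ⟨A, B, -, hT⟩ := h.lam_inv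
      have hn : RTyped Γ n.raw (.pi A B) := ((Eta.eta rfl (.refl n)).rtyped h).conv hT.symm
      obtain ⟨v, h₁, e₁⟩ := ih hs k hp hd hn
      -- The expanded term applies the value of `n` to a new variable. That value has a function
      -- type, so it is an abstraction or neutral and the application is defined.
      have hk := (h₁.rtyped hp hd hn).kind_of_pi
      obtain ⟨r₀, hr⟩ := AppElim.exists_of_kind hk
      refine ⟨.lam r₀, .lam (.neu (.app h₁.shift (.neu .var) hr)), ?_⟩
      cases v with
      | lam b => cases appElim_lam_var.1 hr; exact e₁
      | neu m =>
        cases appElim_neu.1 hr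
        obtain ⟨m', rfl, em⟩ := e₁.neu_inv
        exact .eta rfl em
      | _ => cases hr
  | app_neu _ _ ih₁ ih₂ =>
    intro s t Γ Δ T hs ht hp hd h
    cases ht with
    | app k₁ k₂ =>
    obtain ⟨A, B, hn, hu, -⟩ := h.app_inv
    obtain ⟨v, h₁, e₁⟩ := ih₁ hs k₁ hp hd hn
    obtain ⟨_, h₂, e₂⟩ := ih₂ hs k₂ hp hd hu
    cases e₁ with
    | neu e₁ => exact ⟨_, .app h₁ h₂ .neu, .neu (.app e₁ e₂)⟩
    | eta e e₁ =>
      subst e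
      exact ⟨_, .app h₁ h₂ (.lam (.neu (.app (.shift_one _ _) (.neu .var) .neu))),
        .neu (.app e₁ e₂)⟩
  | app_lam _ _ _ ih₁ ih₂ ih₃ =>
    intro s t Γ Δ T hs ht hp hd h
    cases ht with
    | app k₁ k₂ =>
    obtain ⟨A, B, hn, hu, -⟩ := h.app_inv
    obtain ⟨v, h₁, e₁⟩ := ih₁ hs k₁ hp hd hn
    obtain ⟨_, h₂, e₂⟩ := ih₂ hs k₂ hp hd hu
    have du := h₂.rtyped hp hd hu
    have dn := h₁.rtyped hp hd hn
    cases e₁ with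
    | lam e₁ =>
      obtain ⟨_, h₃, e₃⟩ := ih₃ (.one e₂) e₁ (Sub.plain_one _)
        (by rw [Sub.raw_one]; exact du.one) dn.lam_pi_inv
      exact ⟨_, .app h₁ h₂ (.lam h₃), e₃⟩
  | ite _ _ _ _ h ih₁ ih₂ ih₃ ih₄ =>
    intro s t Γ Δ T hs ht hp hd hty
    cases ht with
    | ite k₁ k₂ k₃ k₄ =>
    obtain ⟨hn, hA, hu, hv, -⟩ := hty.ite_inv
    obtain ⟨w, h₁, e₁⟩ := ih₁ hs k₁ hp hd hn
    obtain ⟨_, h₂, e₂⟩ := ih₂ hs.lift k₂ hp.lift (hup (A := .bool) hd) hA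
    obtain ⟨_, h₃, e₃⟩ := ih₃ hs k₃ hp hd hu
    obtain ⟨_, h₄, e₄⟩ := ih₄ hs k₄ hp hd hv
    have dn := h₁.rtyped hp hd hn
    cases h with
    | tt => cases e₁; exact ⟨_, .ite h₁ h₂ h₃ h₄ .tt, e₃⟩
    | ff => cases e₁; exact ⟨_, .ite h₁ h₂ h₃ h₄ .ff, e₄⟩
    | neu =>
      cases e₁ with
      | neu e₁ => exact ⟨_, .ite h₁ h₂ h₃ h₄ .neu, .neu (.ite e₁ e₂ e₃ e₄)⟩
      | eta _ _ =>
        -- An eta-expanded scrutinee would be an abstraction, on which `ite` is stuck; it cannot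
        -- have type `bool`.
        obtain ⟨_, _, -, hc⟩ := dn.lam_inv
        exact hc.symm.not_bool_pi.elim

/-- Hereditary substitution stays defined when its arguments are replaced by convertible ones that
are typed. -/
theorem HSub.exists_of_cv {B B' t t' C : Tm} (h : HSub (.one t) B C) (hB : Cv B.raw B'.raw)
    (ht : Cv t.raw t'.raw) {Γ : ℕ → Raw} {A T : Raw} (hB' : RTyped (.cons A Γ) B'.raw T)
    (ht' : RTyped Γ t'.raw A) : ∃ C', HSub (.one t') B' C' ∧ Cv C.raw C'.raw := by
  suffices ∃ C', HSub (.one t') B' C' by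
    obtain ⟨C', h'⟩ := this
    exact ⟨C', h', h.cv_one.symm.trans ((hB.subst_one ht).trans h'.cv_one)⟩
  -- The derivation is moved in four stages, from `B` down to the common eta-reduct `W`, from `t`
  -- down to `w`, then up to `B'` and up to `t'`. Only the upward stages use typing, so only the
  -- primed terms need it.
  obtain ⟨W, hW, hW'⟩ := hB.exists_etas
  obtain ⟨w, hw, hw'⟩ := ht.exists_etas
  have h₁ : ∃ C, HSub (.one t) W C := by
    clear hW'
    induction hW with
    | refl => exact ⟨C, h⟩
    | tail _ e ih =>
      obtain ⟨C, h⟩ := ih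
      obtain ⟨C', h', -⟩ := h.eta (.one (.refl _)) e
      exact ⟨C', h'⟩
  have h₂ : ∃ C, HSub (.one w) W C := by
    clear hw'
    induction hw with
    | refl => exact h₁
    | tail _ e ih =>
      obtain ⟨C, h⟩ := ih
      obtain ⟨C', h', -⟩ := h.eta (.one e) (.refl _)
      exact ⟨C', h'⟩
  have h₃ : ∃ C, HSub (.one w) B' C := by
    have hw : RTyped Γ w.raw A := hw'.rtyped ht'
    clear hW hB
    induction hW' using Relation.ReflTransGen.head_induction_on with
    | refl => exact h₂
    | head e _ ih =>
      obtain ⟨C, h⟩ := ih (e.rtyped hB')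
      obtain ⟨C', h', -⟩ := h.of_eta (.one (.refl _)) e (Sub.plain_one _)
        (by rw [Sub.raw_one]; exact hw.one) hB'
      exact ⟨C', h'⟩
  clear hw ht
  induction hw' using Relation.ReflTransGen.head_induction_on with
  | refl => exact h₃
  | head e _ ih =>
    obtain ⟨C, h⟩ := ih (e.rtyped ht')
    obtain ⟨C', h', -⟩ := h.of_eta (.one e) (.refl _) (Sub.plain_one _)
      (by rw [Sub.raw_one]; exact ht'.one) hB'
    exact ⟨C', h'⟩


/-! ### Algorithmic typing with raw conversion -/

/-- The raw context of a context; the types out of range are irrelevant. -/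
def rawCtx : Ctx → ℕ → Raw
  | [], _ => .univ
  | A :: Γ, i => Raw.cons A.raw (rawCtx Γ) i

/-- All the types of a context are types of the declarative system. -/
def CtxTyped (Γ : Ctx) : Prop := ∀ i, RTyped (rawCtx Γ) (rawCtx Γ i) .univ

/-- Conversion of contexts. -/
def CtxCv (Γ Γ' : Ctx) : Prop := List.Forall₂ (fun A B : Tm => Cv A.raw B.raw) Γ Γ'

/-- Out of range the type is `univ`, which is a type because of `Set : Set`. -/
theorem CtxTyped.nil : CtxTyped [] := fun _ => .univ

theorem CtxTyped.cons {Γ : Ctx} {A : Tm} (h : CtxTyped Γ) (hA : RTyped (rawCtx Γ) A.raw .univ) :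
    CtxTyped (A :: Γ) := by
  intro i
  cases i
  · exact hA.weaken _
  · exact (h _).weaken _

theorem CtxCv.refl (Γ : Ctx) : CtxCv Γ Γ := by
  induction Γ with
  | nil => exact .nil
  | cons _ _ ih => exact .cons (.refl _) ih

theorem CtxCv.rawCtx {Γ Γ' : Ctx} (h : CtxCv Γ Γ') : ∀ i, Cv (rawCtx Γ i) (rawCtx Γ' i) := by
  induction h with
  | nil => intro i; exact .refl _
  | cons h _ ih =>
    intro i
    cases i
    · exact h.rename _
    · exact (ih _).rename _

theorem Lookup.rawCtx {Γ : Ctx} {i : ℕ} {A : Tm} (h : Lookup Γ i A) : rawCtx Γ i = A.raw := by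
  induction h with
  | zero => exact (raw_shift _).symm
  | succ _ ih => rw [raw_shift, ← ih]; rfl

theorem Lookup.det {Γ : Ctx} {i : ℕ} {A A' : Tm} (h : Lookup Γ i A) (h' : Lookup Γ i A') :
    A = A' := by
  induction h generalizing A' with
  | zero => cases h'; rfl
  | succ _ ih =>
    cases h' with
    | succ h' => rw [ih h']

theorem Lookup.exists_of_cv {Γ Γ' : Ctx} {i : ℕ} {A : Tm} (h : Lookup Γ i A) (hc : CtxCv Γ Γ') :
    ∃ A', Lookup Γ' i A' ∧ Cv A.raw A'.raw := by
  induction h generalizing Γ' with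
  | zero =>
    cases hc with
    | cons h _ =>
      refine ⟨_, .zero, ?_⟩
      rw [raw_shift, raw_shift]
      exact h.rename _
  | succ _ ih =>
    cases hc with
    | cons _ hc =>
      obtain ⟨A', h, hA⟩ := ih hc
      refine ⟨_, .succ h, ?_⟩
      rw [raw_shift, raw_shift]
      exact hA.rename _

/-- Renamings between contexts. -/
def RenOk (Γ Δ : Ctx) (ρ : ℕ → ℕ) : Prop := ∀ i A, Lookup Γ i A → Lookup Δ (ρ i) (A.rename ρ)

theorem RenOk.lift {Γ Δ : Ctx} {ρ : ℕ → ℕ} (h : RenOk Γ Δ ρ) (A : Tm) :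
    RenOk (A :: Γ) (A.rename ρ :: Δ) (liftRen ρ) := by
  intro i B hB
  cases hB with
  | zero => rw [Exp.shift_rename]; exact .zero
  | succ hB => rw [Exp.shift_rename]; exact .succ (h _ _ hB)

theorem RenOk.shift (Γ : Ctx) (A : Tm) : RenOk Γ (A :: Γ) Nat.succ := fun _ _ h => .succ h

/-- Renamings that reflect the declarations of contexts. -/
def RenReflect (Γ Δ : Ctx) (ρ : ℕ → ℕ) : Prop :=
  ∀ i A', Lookup Δ (ρ i) A' → ∃ A, A' = A.rename ρ ∧ Lookup Γ i A

theorem RenReflect.lift {Γ Δ : Ctx} {ρ : ℕ → ℕ} (h : RenReflect Γ Δ ρ) (A : Tm) :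
    RenReflect (A :: Γ) (A.rename ρ :: Δ) (liftRen ρ) := by
  intro i B hB
  cases i with
  | zero => cases hB; exact ⟨_, (Exp.shift_rename _ _).symm, .zero⟩
  | succ i =>
    cases hB with
    | succ hB =>
      obtain ⟨B', rfl, hB'⟩ := h _ _ hB
      exact ⟨_, (Exp.shift_rename _ _).symm, .succ hB'⟩

theorem RenReflect.shift (Γ : Ctx) (A : Tm) : RenReflect Γ (A :: Γ) Nat.succ := by
  intro i B hB
  cases hB with
  | succ hB => exact ⟨_, rfl, hB⟩

/-- Algorithmic typing in the empty signature, with conversion of raw terms in place of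
definitional equality. The index measures derivations so that eta-expansion decreases it. -/
inductive Alg : {c : Cls} → ℕ → Ctx → Exp c → Tm → Prop
  | univ {Γ : Ctx} : Alg 1 Γ univ univ
  | bool {Γ : Ctx} : Alg 1 Γ bool univ
  | tt {Γ : Ctx} : Alg 1 Γ tt bool
  | ff {Γ : Ctx} : Alg 1 Γ ff bool
  -- The constant 4 pays for eta-expansion. If `n` of size `a` infers a function type with
  -- components of sizes `b₁` and `b₂`, then `neu n` has size `a + b₁ + b₂ + 5`, while `app_var`
  -- types its application to a new variable with size `a + b₁ + b₂ + 4`.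
  | pi {a b : ℕ} {Γ : Ctx} {A B : Tm} :
      Alg a Γ A univ → Alg b (A :: Γ) B univ → Alg (a + b + 4) Γ (pi A B) univ
  | lam {a : ℕ} {Γ : Ctx} {t A B : Tm} : Alg a (A :: Γ) t B → Alg (a + 1) Γ (lam t) (pi A B)
  | neu {a b c : ℕ} {Γ : Ctx} {n : Ne} {A B : Tm} :
      Alg a Γ n A → Alg b Γ A univ → Alg c Γ B univ → Cv A.raw B.raw →
      Alg (a + b + 1) Γ (neu n) B
  | var {Γ : Ctx} {i : ℕ} {A : Tm} : Lookup Γ i A → Alg 1 Γ (var i) A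
  | app {a b : ℕ} {Γ : Ctx} {n : Ne} {t A B C : Tm} :
      Alg a Γ n (pi A B) → Alg b Γ t A → HSub (Sub.one t) B C → Alg (a + b + 1) Γ (app n t) C
  | ite {a b c d : ℕ} {Γ : Ctx} {n : Ne} {A t u At Af C : Tm} :
      Alg a Γ n bool → Alg b (bool :: Γ) A univ →
      HSub (Sub.one tt) A At → Alg c Γ t At →
      HSub (Sub.one ff) A Af → Alg d Γ u Af →
      HSub (Sub.one (neu n)) A C → Alg (a + b + c + d + 1) Γ (ite n A t u) C

namespace Alg

theorem rtyped {c : Cls} {k : ℕ} {Γ : Ctx} {t : Exp c} {A : Tm} (h : Alg k Γ t A) :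
    RTyped (rawCtx Γ) t.raw A.raw := by
  induction h with
  | univ => exact .univ
  | bool => exact .bool
  | tt => exact .tt
  | ff => exact .ff
  | pi _ _ ih₁ ih₂ => exact .pi ih₁ ih₂
  | lam _ ih => exact .lam ih
  | neu _ _ _ hc ih => exact ih.conv hc
  | @var Γ i A h =>
    have := RTyped.var (Γ := rawCtx Γ) (i := i)
    rw [h.rawCtx] at this
    exact this
  | app _ _ h ih₁ ih₂ => exact (RTyped.app ih₁ ih₂).conv h.cv_one
  | ite _ _ h₁ _ h₂ _ h₃ ih₁ ih₂ ih₃ ih₄ =>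
    exact (RTyped.ite ih₁ ih₂ (ih₃.conv h₁.cv_one.symm) (ih₄.conv h₂.cv_one.symm)).conv h₃.cv_one

theorem rename {c : Cls} {k : ℕ} {Γ : Ctx} {t : Exp c} {A : Tm} (h : Alg k Γ t A) :
    ∀ {Δ : Ctx} {ρ : ℕ → ℕ}, RenOk Γ Δ ρ → Alg k Δ (t.rename ρ) (A.rename ρ) := by
  induction h with
  | univ => intros; exact .univ
  | bool => intros; exact .bool
  | tt => intros; exact .tt
  | ff => intros; exact .ff
  | pi _ _ ih₁ ih₂ => intro Δ ρ h; exact .pi (ih₁ h) (ih₂ (h.lift _))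
  | lam _ ih => intro Δ ρ h; exact .lam (ih (h.lift _))
  | neu _ _ _ hc ih₁ ih₂ ih₃ =>
    intro Δ ρ h
    exact .neu (ih₁ h) (ih₂ h) (ih₃ h) (by rw [raw_rename, raw_rename]; exact hc.rename ρ)
  | var hl => intro Δ ρ h; exact .var (h _ _ hl)
  | app _ _ hs ih₁ ih₂ => intro Δ ρ h; exact .app (ih₁ h) (ih₂ h) (hs.rename_one ρ)
  | ite _ _ h₁ _ h₂ _ h₃ ih₁ ih₂ ih₃ ih₄ =>
    intro Δ ρ h
    exact .ite (ih₁ h) (ih₂ (h.lift _)) (h₁.rename_one ρ) (ih₃ h) (h₂.rename_one ρ) (ih₄ h)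
      (h₃.rename_one ρ)

/-- Strengthening works because the system is bidirectional. A checked type is an input and has to
be assumed a renaming, whereas an inferred type is computed from the context and the term and is a
renaming automatically; this covers the intermediate type of the rule `neu`. -/
theorem of_rename_aux {c : Cls} {k : ℕ} {Δ : Ctx} {t' : Exp c} {A' : Tm} (h : Alg k Δ t' A') :
    ∀ {Γ : Ctx} {ρ : ℕ → ℕ} {t : Exp c}, ρ.Injective → RenReflect Γ Δ ρ → t' = t.rename ρ →
      (c = .tm → ∀ A : Tm, A' = A.rename ρ → Alg k Γ t A) ∧
      (c = .ne → ∃ A : Tm, A' = A.rename ρ ∧ Alg k Γ t A) := by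
  induction h with
  | univ =>
    intro Γ ρ t hi hr e
    cases t <;> simp [Exp.rename] at e
    refine ⟨fun _ A e => ?_, by simp⟩
    cases A <;> simp [Exp.rename] at e
    exact .univ
  | bool =>
    intro Γ ρ t hi hr e
    cases t <;> simp [Exp.rename] at e
    refine ⟨fun _ A e => ?_, by simp⟩
    cases A <;> simp [Exp.rename] at e
    exact .bool
  | tt =>
    intro Γ ρ t hi hr e
    cases t <;> simp [Exp.rename] at e
    refine ⟨fun _ A e => ?_, by simp⟩
    cases A <;> simp [Exp.rename] at e
    exact .tt
  | ff =>
    intro Γ ρ t hi hr e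
    cases t <;> simp [Exp.rename] at e
    refine ⟨fun _ A e => ?_, by simp⟩
    cases A <;> simp [Exp.rename] at e
    exact .ff
  | pi _ _ ih₁ ih₂ =>
    intro Γ ρ t hi hr e
    cases t <;> simp [Exp.rename] at e
    obtain ⟨rfl, rfl⟩ := e
    refine ⟨fun _ A e => ?_, by simp⟩
    cases A <;> simp [Exp.rename] at e
    exact .pi ((ih₁ hi hr rfl).1 rfl .univ rfl)
      ((ih₂ (liftRen_injective hi) (hr.lift _) rfl).1 rfl .univ rfl)
  | lam _ ih =>
    intro Γ ρ t hi hr e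
    cases t <;> simp [Exp.rename] at e
    subst e
    refine ⟨fun _ A e => ?_, by simp⟩
    cases A <;> simp [Exp.rename] at e
    obtain ⟨rfl, rfl⟩ := e
    exact .lam ((ih (liftRen_injective hi) (hr.lift _) rfl).1 rfl _ rfl)
  | neu _ _ _ hc ih₁ ih₂ ih₃ =>
    intro Γ ρ t hi hr e
    cases t <;> simp [Exp.rename] at e
    subst e
    refine ⟨fun _ B e => ?_, by simp⟩
    subst e
    obtain ⟨A, rfl, h₁⟩ := (ih₁ hi hr rfl).2 rfl
    rw [raw_rename, raw_rename] at hc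
    exact .neu h₁ ((ih₂ hi hr rfl).1 rfl .univ rfl) ((ih₃ hi hr rfl).1 rfl .univ rfl)
      (hc.of_rename hi)
  | var hl =>
    intro Γ ρ t hi hr e
    cases t <;> simp [Exp.rename] at e
    subst e
    refine ⟨by simp, fun _ => ?_⟩
    obtain ⟨A, rfl, hl'⟩ := hr _ _ hl
    exact ⟨A, rfl, .var hl'⟩
  | app _ _ hs ih₁ ih₂ =>
    intro Γ ρ t hi hr e
    cases t <;> simp [Exp.rename] at e
    obtain ⟨rfl, rfl⟩ := e
    refine ⟨by simp, fun _ => ?_⟩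
    obtain ⟨T, e, h₁⟩ := (ih₁ hi hr rfl).2 rfl
    cases T <;> simp [Exp.rename] at e
    obtain ⟨rfl, rfl⟩ := e
    obtain ⟨C, rfl, hs'⟩ := hs.of_rename_one
    exact ⟨C, rfl, .app h₁ ((ih₂ hi hr rfl).1 rfl _ rfl) hs'⟩
  | ite _ _ h₁ _ h₂ _ h₃ ih₁ ih₂ ih₃ ih₄ =>
    intro Γ ρ t hi hr e
    cases t <;> simp [Exp.rename] at e
    rename_i n _ _ _
    obtain ⟨rfl, rfl, rfl, rfl⟩ := e
    refine ⟨by simp, fun _ => ?_⟩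
    obtain ⟨T, e, k₁⟩ := (ih₁ hi hr rfl).2 rfl
    cases T <;> simp [Exp.rename] at e
    obtain ⟨_, rfl, s₁⟩ := HSub.of_rename_one (u := .tt) (ρ := ρ) h₁
    obtain ⟨_, rfl, s₂⟩ := HSub.of_rename_one (u := .ff) (ρ := ρ) h₂
    obtain ⟨C, rfl, s₃⟩ := HSub.of_rename_one (u := Exp.neu n) (ρ := ρ) h₃
    exact ⟨C, rfl, .ite k₁ ((ih₂ (liftRen_injective hi) (hr.lift .bool) rfl).1 rfl .univ rfl) s₁
      ((ih₃ hi hr rfl).1 rfl _ rfl) s₂ ((ih₄ hi hr rfl).1 rfl _ rfl) s₃⟩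

theorem of_shift {k : ℕ} {Γ : Ctx} {X t A : Tm} (h : Alg k (X :: Γ) t.shift A.shift) :
    Alg k Γ t A :=
  (h.of_rename_aux Nat.succ_injective (.shift Γ X) rfl).1 rfl A rfl

theorem of_shift_ne {k : ℕ} {Γ : Ctx} {X : Tm} {n : Ne} {A' : Tm} (h : Alg k (X :: Γ) n.shift A') :
    ∃ A : Tm, A' = A.shift ∧ Alg k Γ n A :=
  (h.of_rename_aux Nat.succ_injective (.shift Γ X) rfl).2 rfl

/-- Inferred types are unique on the nose, since lookup and hereditary substitution are
deterministic. -/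
theorem det {c : Cls} {k : ℕ} {Γ : Ctx} {n : Exp c} {A : Tm} (h : Alg k Γ n A) :
    c = .ne → ∀ {k' A'}, Alg k' Γ n A' → A = A' := by
  induction h with
  | var h =>
    intro _ k' A' h'
    cases h' with
    | var h' => exact h.det h'
  | app _ _ hs ih _ =>
    intro _ k' A' h'
    cases h' with
    | app h₁ _ hs' =>
      cases ih rfl h₁
      exact hs.det hs'
  | ite _ _ _ _ _ _ hs =>
    intro _ k' A' h'
    cases h' with
    | ite _ _ _ _ _ _ hs' => exact hs.det hs'
  | _ => intro h; cases h

theorem app_var_inv {k : ℕ} {Γ : Ctx} {A B : Tm} {m : Ne}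
    (h : Alg k (A :: Γ) (Exp.neu (.app m.shift (.neu (.var 0)))) B) :
    ∃ X Y a b c d e, Alg a Γ m (.pi X Y) ∧ Alg b Γ X .univ ∧ Alg c Γ A .univ ∧
      Alg d (A :: Γ) Y .univ ∧ Alg e (A :: Γ) B .univ ∧ Cv A.raw X.raw ∧ Cv Y.raw B.raw := by
  cases h with
  | neu h hC hB hc =>
    cases h with
    | app hm hx hs =>
      obtain ⟨T, e, hm'⟩ := hm.of_shift_ne
      cases T <;> simp [Exp.rename, Exp.shift] at e
      obtain ⟨rfl, rfl⟩ := e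
      cases hs.det (.lift_shift_one _)
      cases hx with
      | neu hx hA hX hAX =>
        cases hx with
        | var hl =>
          cases hl
          have hX := of_shift (A := .univ) hX
          have hA := of_shift (A := .univ) hA
          refine ⟨_, _, _, _, _, _, _, hm', hX, hA, hC, hB, ?_, hc⟩
          rw [raw_shift, raw_rename] at hAX
          exact hAX.of_rename Nat.succ_injective

/-- Typing of functions by application to a new variable. -/
theorem of_appElim {Γ : Ctx} {f r A B : Tm} (hr : AppElim f.shift (Exp.neu (.var 0)) r)
    (hA : RTyped (rawCtx Γ) A.raw .univ)
    (h : ∀ X : Tm, Cv X.raw A.raw → RTyped (rawCtx Γ) X.raw .univ → ∃ k, Alg k (X :: Γ) r B) :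
    ∃ k, Alg k Γ f (.pi A B) := by
  cases f with
  | lam b =>
    cases appElim_lam_var.1 hr
    obtain ⟨k, h⟩ := h A (.refl _) hA
    exact ⟨_, .lam h⟩
  | neu m =>
    cases appElim_neu.1 hr
    obtain ⟨k, h₁⟩ := h A (.refl _) hA
    obtain ⟨X, Y, _, _, _, _, _, hm, hX, hA, -, hB, cX, cY⟩ := h₁.app_var_inv
    -- The inferred codomain `Y` is so far a type over `A`, but the well-formedness of `pi X Y`
    -- requires it over the inferred domain `X`. Hence the hypothesis is asked for every domain
    -- convertible to `A`, and determinism identifies the two codomains.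
    obtain ⟨k', h₂⟩ := h X cX.symm hX.rtyped
    obtain ⟨X', Y', _, _, _, _, _, hm', -, -, hY, -, -, -⟩ := h₂.app_var_inv
    cases hm.det rfl hm'
    exact ⟨_, .neu hm (.pi hX hY) (.pi hA hB) (cX.symm.pi cY)⟩
  | _ => cases hr

/-- Eta-expansion of neutral terms. -/
theorem app_var {a b₁ b₂ : ℕ} {Γ : Ctx} {n : Ne} {A B : Tm} (h : Alg a Γ n (.pi A B))
    (hA : Alg b₁ Γ A .univ) (hB : Alg b₂ (A :: Γ) B .univ) :
    Alg (a + (1 + b₁ + 1) + 1 + b₂ + 1) (A :: Γ)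
      (Exp.neu (.app n.shift (.neu (.var 0)))) B :=
  have hA' := hA.rename (.shift Γ A)
  .neu (.app (h.rename (.shift Γ A)) (.neu (.var .zero) hA' hA' (.refl _))
    (.lift_shift_one B)) hB hB (.refl _)

end Alg

-- From conversion to definitional equality

/-- Convertible terms that are typed in the declarative system are definitionally equal, if one of
them is typed algorithmically; the same holds up to conversion of the context and of the type. -/
theorem Alg.conv_size : ∀ k : ℕ,
    (∀ {Γ : Ctx} {t A : Tm}, Alg k Γ t A → ∀ {Γ' : Ctx} {A' u u' : Tm}, CtxCv Γ Γ' →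
      CtxTyped Γ' → Cv A.raw A'.raw → RTyped (rawCtx Γ') A'.raw .univ →
      Cv t.raw u.raw → Cv t.raw u'.raw →
      RTyped (rawCtx Γ') u.raw A'.raw → RTyped (rawCtx Γ') u'.raw A'.raw →
      Conv [] Γ' u u' A' ∧ ∃ k', Alg k' Γ' u A') ∧
    (∀ {Γ : Ctx} {n : Ne} {A : Tm}, Alg k Γ n A → ∀ {Γ' : Ctx} {m m' : Ne} {T T' : Raw},
      CtxCv Γ Γ' → CtxTyped Γ' → Cv n.raw m.raw → Cv n.raw m'.raw →
      RTyped (rawCtx Γ') m.raw T → RTyped (rawCtx Γ') m'.raw T' →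
      ∃ A' : Tm, Cv A.raw A'.raw ∧ RTyped (rawCtx Γ') A'.raw .univ ∧
        RTyped (rawCtx Γ') m.raw A'.raw ∧ RTyped (rawCtx Γ') m'.raw A'.raw ∧
        Conv [] Γ' m m' A' ∧ ∃ k', Alg k' Γ' m A') := by
  intro k
  induction k using Nat.strong_induction_on with
  | _ k IH =>
  -- At function type, terms are compared through their applications to a new variable. This serves
  -- abstractions and neutral terms alike, since either may be convertible to the other; the size of
  -- the application `r` of `t` is smaller than `k`.
  have etaStep : ∀ {j Γ} {t A₁ B₁ r : Tm}, j < k → Alg j (A₁ :: Γ) r B₁ → t.kind = 5 →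
      AppElim t.shift (Exp.neu (.var 0)) r → ∀ {Γ' : Ctx} {A' u u' : Tm}, CtxCv Γ Γ' →
      CtxTyped Γ' → Cv (Raw.pi A₁.raw B₁.raw) A'.raw → RTyped (rawCtx Γ') A'.raw .univ →
      Cv t.raw u.raw → Cv t.raw u'.raw →
      RTyped (rawCtx Γ') u.raw A'.raw → RTyped (rawCtx Γ') u'.raw A'.raw →
      Conv [] Γ' u u' A' ∧ ∃ k', Alg k' Γ' u A' := by
    intro j Γ t A₁ B₁ r hj h hk hr Γ' A' u u' hΓ hΓ' hA dA hu hu' du du'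
    obtain ⟨A, B, rfl, cA, cB⟩ := hA.symm.eq_pi
    obtain ⟨w, hw⟩ := AppElim.exists_of_kind (hu.kind ▸ hk)
    obtain ⟨w', hw'⟩ := AppElim.exists_of_kind (hu'.kind ▸ hk)
    have cw : ∀ {u w : Tm}, Cv t.raw u.raw → AppElim u.shift (Exp.neu (.var 0)) w →
        Cv r.raw w.raw := by
      intro u w hu hw
      refine hr.cv.symm.trans (.trans (.app ?_ (.refl _)) hw.cv)
      rw [raw_shift, raw_shift]
      exact hu.rename _
    obtain ⟨dA, dB, -⟩ := dA.pi_inv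
    have key : ∀ X : Tm, Cv X.raw A.raw → RTyped (rawCtx Γ') X.raw .univ →
        Conv [] (X :: Γ') w w' B ∧ ∃ k', Alg k' (X :: Γ') w B := by
      intro X hX dX
      have hcons : ∀ i, Cv (Raw.cons A.raw (rawCtx Γ') i) (Raw.cons X.raw (rawCtx Γ') i) := by
        intro i
        cases i
        · exact hX.symm.rename _
        · exact .refl _
      exact (IH j hj).1 h (.cons (cA.symm.trans hX.symm) hΓ) (hΓ'.cons dX) cB.symm
        (dB.ctx_cv hcons) (cw hu hw) (cw hu' hw') ((hw.rtyped_var du).ctx_cv hcons)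
        ((hw'.rtyped_var du').ctx_cv hcons)
    exact ⟨.eta hw hw' (key A (.refl _) dA).1,
      Alg.of_appElim hw dA fun X hX dX => (key X hX dX).2⟩
  refine ⟨?_, ?_⟩
  · intro Γ t A h Γ' A' u u' hΓ hΓ' hA dA hu hu' du du'
    cases h with
    | univ =>
      cases hA.symm.eq_univ; cases hu.symm.eq_univ; cases hu'.symm.eq_univ
      exact ⟨.univ, _, .univ⟩
    | bool =>
      cases hA.symm.eq_univ; cases hu.symm.eq_bool; cases hu'.symm.eq_bool
      exact ⟨.bool, _, .bool⟩
    | tt =>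
      cases hA.symm.eq_bool; cases hu.symm.eq_tt; cases hu'.symm.eq_tt
      exact ⟨.tt, _, .tt⟩
    | ff =>
      cases hA.symm.eq_bool; cases hu.symm.eq_ff; cases hu'.symm.eq_ff
      exact ⟨.ff, _, .ff⟩
    | pi h₁ h₂ =>
      cases hA.symm.eq_univ
      obtain ⟨B, C, rfl, cB, cC⟩ := hu.symm.eq_pi
      obtain ⟨B', C', rfl, cB', cC'⟩ := hu'.symm.eq_pi
      obtain ⟨dB, dC, -⟩ := du.pi_inv
      obtain ⟨dB', dC', -⟩ := du'.pi_inv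
      have dC' := dC'.ctx_cv (Δ := Raw.cons B.raw (rawCtx Γ')) fun i => by
        cases i
        · exact (cB'.trans cB.symm).rename _
        · exact .refl _
      obtain ⟨e₁, k₁, a₁⟩ := (IH _ (by omega)).1 h₁ hΓ hΓ' (.refl _) .univ cB.symm cB'.symm dB dB'
      obtain ⟨e₂, k₂, a₂⟩ := (IH _ (by omega)).1 h₂ (.cons cB.symm hΓ) (hΓ'.cons dB) (.refl _)
        .univ cC.symm cC'.symm dC dC'
      exact ⟨.pi e₁ e₂, _, .pi a₁ a₂⟩
    | lam h =>
      exact etaStep (t := .lam _) (Nat.lt_succ_self _) h rfl (appElim_lam_var.2 rfl) hΓ hΓ' hA dA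
        hu hu' du du'
    | @neu a b _ _ n B _ h₁ h₂ _ hc =>
      -- At a function type the neutral term is eta-expanded. At any other type the convertible
      -- terms cannot be abstractions, so they are neutral too and are compared as such.
      by_cases hp : A.kind = 4
      · rw [← hc.kind] at hp
        cases B <;> simp [Exp.kind] at hp
        cases h₂ with
        | @pi b₁ b₂ _ X Y hX hY =>
          exact etaStep (t := .neu n) (by omega) (h₁.app_var hX hY) rfl .neu hΓ hΓ' (hc.trans hA)
            dA hu hu' du du'
      · have hne : ∀ {u : Tm}, Cv n.raw u.raw → RTyped (rawCtx Γ') u.raw A'.raw →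
            ∃ m, u = .neu m := by
          intro u hu du
          have hk : u.kind = 5 := (Cv.kind (t := .neu n) hu).symm
          cases u <;> simp [Exp.kind] at hk
          · obtain ⟨X, Y, -, hc⟩ := du.lam_inv
            obtain ⟨_, _, rfl, -⟩ := hc.symm.eq_pi
            exact (hp hA.kind).elim
          · exact ⟨_, rfl⟩
        obtain ⟨m, rfl⟩ := hne hu du
        obtain ⟨m', rfl⟩ := hne hu' du'
        obtain ⟨B', cB, dB, -, -, e, _, a₁⟩ :=
          (IH a (by omega)).2 h₁ hΓ hΓ' hu hu' du du'
        have cA' := hc.trans hA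
        -- The derivation that `B` is a type serves two other types, the inferred `B'` and the
        -- expected `A'`: it equates them and, with the roles exchanged, types `A'`. This is why the
        -- statement compares two terms that are both convertible to the given one.
        obtain ⟨e₂, _, a₂⟩ := (IH b (by omega)).1 h₂ hΓ hΓ' (.refl _) .univ cB cA' dB dA
        obtain ⟨-, _, a₃⟩ := (IH b (by omega)).1 h₂ hΓ hΓ' (.refl _) .univ cA' cB dA dB
        exact ⟨.neu e e₂, _, .neu a₁ a₂ a₃ (cB.symm.trans cA')⟩
  · intro Γ n A h Γ' m m' T T' hΓ hΓ' hm hm' dm dm'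
    cases h with
    | var hl =>
      cases hm.ne_var
      cases hm'.ne_var
      obtain ⟨A', hl', hA⟩ := hl.exists_of_cv hΓ
      have d := Alg.rtyped (.var hl')
      refine ⟨A', hA, ?_, d, d, .var hl', _, .var hl'⟩
      have := hΓ' ‹ℕ›
      rwa [hl'.rawCtx] at this
    | @app a b _ n t A B C h₁ h₂ hs =>
      obtain ⟨p, w, rfl, cp, cw⟩ := hm.ne_app
      obtain ⟨p', w', rfl, cp', cw'⟩ := hm'.ne_app
      obtain ⟨X, Y, dp, dw, -⟩ := dm.app_inv
      obtain ⟨X', Y', dp', dw', -⟩ := dm'.app_inv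
      obtain ⟨F, cF, dF, kp, kp', e, _, a₁⟩ := (IH a (by omega)).2 h₁ hΓ hΓ' cp cp' dp dp'
      obtain ⟨A', B', rfl, cA, cB⟩ := cF.symm.eq_pi
      obtain ⟨dA, dB, -⟩ := dF.pi_inv
      -- Inversion of the declarative typing gives some domain for the argument; uniqueness of types
      -- turns it into the inferred one.
      have dw := dw.conv (dp.unique kp).pi_inv.1
      have dw' := dw'.conv (dp'.unique kp').pi_inv.1
      obtain ⟨e', _, a₂⟩ := (IH b (by omega)).1 h₂ hΓ hΓ' cA.symm dA cw cw' dw dw'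
      -- The instance of the codomain exists for the original pair; this transports its existence to
      -- the new one.
      obtain ⟨C', hC', cC⟩ := hs.exists_of_cv cB.symm cw dB dw
      refine ⟨C', cC, hC'.rtyped_one dw dB, (RTyped.app kp dw).conv hC'.cv_one,
        (RTyped.app kp' dw').conv (.trans (.subst_one (.refl _) (cw'.symm.trans cw)) hC'.cv_one),
        .app e e' hC', _, .app a₁ a₂ hC'⟩
    | @ite a b c d _ n A t u At Af C h₁ h₂ hs₁ h₃ hs₂ h₄ hs₃ =>
      obtain ⟨p, X, y, z, rfl, cp, cX, cy, cz⟩ := hm.ne_ite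
      obtain ⟨p', X', y', z', rfl, cp', cX', cy', cz'⟩ := hm'.ne_ite
      obtain ⟨dp, dX, dy, dz, -⟩ := dm.ite_inv
      obtain ⟨dp', dX', dy', dz', -⟩ := dm'.ite_inv
      obtain ⟨F, cF, dF, -, -, e, _, a₁⟩ := (IH a (by omega)).2 h₁ hΓ hΓ' cp cp' dp dp'
      cases cF.symm.eq_bool
      obtain ⟨e₂, _, a₂⟩ := (IH b (by omega)).1 h₂ (.cons (.refl _) hΓ) (hΓ'.cons .bool) (.refl _)
        .univ cX cX' dX dX'
      have cXX := cX'.symm.trans cX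
      obtain ⟨Xt, hXt, cXt⟩ := hs₁.exists_of_cv cX (.refl _) (A := .bool) dX .tt
      obtain ⟨Xf, hXf, cXf⟩ := hs₂.exists_of_cv cX (.refl _) (A := .bool) dX .ff
      obtain ⟨Xn, hXn, cXn⟩ := hs₃.exists_of_cv (t' := .neu p) cX cp (A := .bool) dX dp
      obtain ⟨e₃, _, a₃⟩ := (IH c (by omega)).1 h₃ hΓ hΓ' cXt
        (hXt.rtyped_one (A := .bool) .tt dX) cy cy' (dy.conv hXt.cv_one)
        (dy'.conv (.trans (cXX.subst_one (.refl _)) hXt.cv_one))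
      obtain ⟨e₄, _, a₄⟩ := (IH d (by omega)).1 h₄ hΓ hΓ' cXf
        (hXf.rtyped_one (A := .bool) .ff dX) cz cz' (dz.conv hXf.cv_one)
        (dz'.conv (.trans (cXX.subst_one (.refl _)) hXf.cv_one))
      refine ⟨Xn, cXn, hXn.rtyped_one (A := .bool) dp dX,
        (RTyped.ite dp dX dy dz).conv hXn.cv_one,
        (RTyped.ite dp' dX' dy' dz').conv (.trans (.subst_one cXX (cp'.symm.trans cp)) hXn.cv_one),
        .ite e e₂ hXt e₃ hXf e₄ hXn, _, .ite a₁ a₂ hXt a₃ hXf a₄ hXn⟩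


/-! ### Algorithmic typing of definitionally equal terms -/

/-- Algorithmic typing, without the size of the derivation. -/
def AlgTyped {c : Cls} (Γ : Ctx) (t : Exp c) (A : Tm) : Prop := ∃ k, Alg k Γ t A

namespace AlgTyped

theorem rtyped {c : Cls} {Γ : Ctx} {t : Exp c} {A : Tm} (h : AlgTyped Γ t A) :
    RTyped (rawCtx Γ) t.raw A.raw :=
  h.choose_spec.rtyped

theorem univ {Γ : Ctx} : AlgTyped Γ .univ .univ := ⟨_, .univ⟩
theorem bool {Γ : Ctx} : AlgTyped Γ .bool .univ := ⟨_, .bool⟩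
theorem tt {Γ : Ctx} : AlgTyped Γ .tt .bool := ⟨_, .tt⟩
theorem ff {Γ : Ctx} : AlgTyped Γ .ff .bool := ⟨_, .ff⟩

theorem pi {Γ : Ctx} {A B : Tm} : AlgTyped Γ A .univ → AlgTyped (A :: Γ) B .univ →
    AlgTyped Γ (.pi A B) .univ
  | ⟨_, h₁⟩, ⟨_, h₂⟩ => ⟨_, .pi h₁ h₂⟩

theorem lam {Γ : Ctx} {t A B : Tm} : AlgTyped (A :: Γ) t B → AlgTyped Γ (.lam t) (.pi A B)
  | ⟨_, h⟩ => ⟨_, .lam h⟩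

theorem neu {Γ : Ctx} {n : Ne} {A B : Tm} : AlgTyped Γ n A → AlgTyped Γ A .univ →
    AlgTyped Γ B .univ → Cv A.raw B.raw → AlgTyped Γ (.neu n) B
  | ⟨_, h₁⟩, ⟨_, h₂⟩, ⟨_, h₃⟩, h => ⟨_, .neu h₁ h₂ h₃ h⟩

theorem var {Γ : Ctx} {i : ℕ} {A : Tm} (h : Lookup Γ i A) : AlgTyped Γ (.var i) A := ⟨_, .var h⟩

theorem app {Γ : Ctx} {n : Ne} {t A B C : Tm} : AlgTyped Γ n (.pi A B) → AlgTyped Γ t A →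
    HSub (.one t) B C → AlgTyped Γ (.app n t) C
  | ⟨_, h₁⟩, ⟨_, h₂⟩, h => ⟨_, .app h₁ h₂ h⟩

theorem ite {Γ : Ctx} {n : Ne} {A t u At Af C : Tm} : AlgTyped Γ n .bool →
    AlgTyped (.bool :: Γ) A .univ → HSub (.one .tt) A At → AlgTyped Γ t At →
    HSub (.one .ff) A Af → AlgTyped Γ u Af → HSub (.one (.neu n)) A C →
    AlgTyped Γ (.ite n A t u) C
  | ⟨_, h₁⟩, ⟨_, h₂⟩, s₁, ⟨_, h₃⟩, s₂, ⟨_, h₄⟩, s₃ => ⟨_, .ite h₁ h₂ s₁ h₃ s₂ h₄ s₃⟩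

theorem pi_inv {Γ : Ctx} {A B : Tm} :
    AlgTyped Γ (.pi A B) .univ → AlgTyped Γ A .univ ∧ AlgTyped (A :: Γ) B .univ
  | ⟨_, .pi h₁ h₂⟩ => ⟨⟨_, h₁⟩, _, h₂⟩

theorem neu_inv {Γ : Ctx} {n : Ne} {B : Tm} :
    AlgTyped Γ (.neu n) B → ∃ A : Tm, AlgTyped Γ n A ∧ AlgTyped Γ A .univ ∧ Cv A.raw B.raw
  | ⟨_, .neu h₁ h₂ _ h⟩ => ⟨_, ⟨_, h₁⟩, ⟨_, h₂⟩, h⟩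

theorem conv_ctx {Γ Γ' : Ctx} {t u A A' : Tm} (h : AlgTyped Γ t A) (hΓ : CtxCv Γ Γ')
    (hΓ' : CtxTyped Γ') (hA : Cv A.raw A'.raw) (dA : RTyped (rawCtx Γ') A'.raw .univ)
    (hu : Cv t.raw u.raw) (du : RTyped (rawCtx Γ') u.raw A'.raw) : AlgTyped Γ' u A' :=
  have ⟨_, h⟩ := h
  ((Alg.conv_size _).1 h hΓ hΓ' hA dA hu hu du du).2

theorem conv {Γ : Ctx} {t u A A' : Tm} (h : AlgTyped Γ t A) (hΓ : CtxTyped Γ)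
    (hA : Cv A.raw A'.raw) (dA : RTyped (rawCtx Γ) A'.raw .univ)
    (hu : Cv t.raw u.raw) (du : RTyped (rawCtx Γ) u.raw A'.raw) : AlgTyped Γ u A' :=
  h.conv_ctx (CtxCv.refl Γ) hΓ hA dA hu du

theorem conv_type {Γ : Ctx} {t A A' : Tm} (h : AlgTyped Γ t A) (hΓ : CtxTyped Γ)
    (hA : Cv A.raw A'.raw) (dA : RTyped (rawCtx Γ) A'.raw .univ) : AlgTyped Γ t A' :=
  h.conv hΓ hA dA (.refl _) (h.rtyped.conv hA)

theorem conv_term {Γ : Ctx} {t u A : Tm} (h : AlgTyped Γ t A) (hΓ : CtxTyped Γ)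
    (dA : RTyped (rawCtx Γ) A.raw .univ) (hu : Cv t.raw u.raw)
    (du : RTyped (rawCtx Γ) u.raw A.raw) : AlgTyped Γ u A :=
  h.conv hΓ (.refl _) dA hu du

theorem conv_cons {Γ : Ctx} {t A A' B : Tm} (h : AlgTyped (A :: Γ) t B) (hΓ : CtxTyped Γ)
    (hA : Cv A.raw A'.raw) (dA : RTyped (rawCtx Γ) A'.raw .univ)
    (dB : RTyped (rawCtx (A :: Γ)) B.raw .univ) : AlgTyped (A' :: Γ) t B :=
  have hc : CtxCv (A :: Γ) (A' :: Γ) := .cons hA (CtxCv.refl Γ)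
  h.conv_ctx hc (hΓ.cons dA) (.refl _) (dB.ctx_cv hc.rawCtx) (.refl _) (h.rtyped.ctx_cv hc.rawCtx)

/-- Convertible typed terms are definitionally equal. -/
theorem definitionally_equal {Γ : Ctx} {t u A : Tm} (h : AlgTyped Γ t A) (hΓ : CtxTyped Γ)
    (dA : RTyped (rawCtx Γ) A.raw .univ) (hu : Cv t.raw u.raw)
    (du : RTyped (rawCtx Γ) u.raw A.raw) : Conv [] Γ t u A :=
  have d := h.rtyped
  have ⟨_, h⟩ := h
  ((Alg.conv_size _).1 h (CtxCv.refl Γ) hΓ (.refl _) dA (.refl _) hu d du).1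

end AlgTyped

/-- The extensionality rule is sound for conversion, because raw conversion includes eta. -/
theorem AppElim.cv_of_cv {f g f' g' : Tm} (hf : AppElim f.shift (.neu (.var 0)) f')
    (hg : AppElim g.shift (.neu (.var 0)) g') (h : Cv f'.raw g'.raw) : Cv f.raw g.raw := by
  have := Cv.lam ((hf.cv.trans h).trans hg.cv.symm)
  rw [raw_shift, raw_shift] at this
  exact (Cv.eta _).symm.trans (this.trans (Cv.eta _))

/-- Application and `ite` are typed by their left-hand sides, so the right-hand neutral term infers
a type of its own, convertible to the first. That this second type exists, being an instance by
another term, is `HSub.exists_of_cv`. -/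
theorem Conv.algTyped {c : Cls} {Γ : Ctx} {t u : Exp c} {A : Tm} (h : Conv [] Γ t u A) :
    CtxTyped Γ →
      (c = .tm → RTyped (rawCtx Γ) A.raw .univ →
        AlgTyped Γ t A ∧ AlgTyped Γ u A ∧ Cv t.raw u.raw) ∧
      (c = .ne → ∃ A' : Tm, AlgTyped Γ t A ∧ AlgTyped Γ u A' ∧ Cv t.raw u.raw ∧
        Cv A.raw A'.raw ∧ RTyped (rawCtx Γ) A.raw .univ ∧ RTyped (rawCtx Γ) A'.raw .univ) := by
  induction h with
  | univ => exact fun _ => ⟨fun _ _ => ⟨.univ, .univ, .refl _⟩, nofun⟩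
  | bool => exact fun _ => ⟨fun _ _ => ⟨.bool, .bool, .refl _⟩, nofun⟩
  | tt => exact fun _ => ⟨fun _ _ => ⟨.tt, .tt, .refl _⟩, nofun⟩
  | ff => exact fun _ => ⟨fun _ _ => ⟨.ff, .ff, .refl _⟩, nofun⟩
  | pi _ _ ih₁ ih₂ =>
    refine fun hΓ => ⟨fun _ _ => ?_, nofun⟩
    obtain ⟨a₁, a₂, hA⟩ := (ih₁ hΓ).1 rfl .univ
    obtain ⟨b₁, b₂, hB⟩ := (ih₂ (hΓ.cons a₁.rtyped)).1 rfl .univ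
    exact ⟨a₁.pi b₁, a₂.pi (b₂.conv_cons hΓ hA a₂.rtyped .univ), hA.pi hB⟩
  | @eta Γ A B _ _ _ _ hf hg _ ih =>
    refine fun hΓ => ⟨fun _ d => ?_, nofun⟩
    obtain ⟨dA, dB, -⟩ := d.pi_inv
    obtain ⟨a, b, hc⟩ := (ih (hΓ.cons dA)).1 rfl dB
    have key : ∀ {f f' : Tm}, AppElim f.shift (Exp.neu (.var 0)) f' → AlgTyped (A :: Γ) f' B →
        AlgTyped Γ f (.pi A B) := fun hf h =>
      Alg.of_appElim hf dA fun X hX dX => h.conv_cons hΓ hX.symm dX dB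
    exact ⟨key hf a, key hg b, hf.cv_of_cv hg hc⟩
  | neu _ _ ih₁ ih₂ =>
    refine fun hΓ => ⟨fun _ _ => ?_, nofun⟩
    obtain ⟨A', a, a', hn, hA, dA, dA'⟩ := (ih₁ hΓ).2 rfl
    obtain ⟨b₁, b₂, hB⟩ := (ih₂ hΓ).1 rfl .univ
    exact ⟨a.neu b₁ b₂ hB, a'.neu (b₁.conv_term hΓ .univ hA dA') b₂ (hA.symm.trans hB), hn⟩
  | @var Γ i A hl =>
    intro hΓ
    have d := hΓ i
    rw [hl.rawCtx] at d
    exact ⟨nofun, fun _ => ⟨A, .var hl, .var hl, .refl _, .refl _, d, d⟩⟩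
  | mvar h => cases h
  | app _ _ hs ih₁ ih₂ =>
    refine fun hΓ => ⟨nofun, fun _ => ?_⟩
    obtain ⟨F, a, a', hn, hF, dF, dF'⟩ := (ih₁ hΓ).2 rfl
    obtain ⟨A', B', rfl, hA, hB⟩ := hF.symm.eq_pi
    obtain ⟨dA, dB, -⟩ := dF.pi_inv
    obtain ⟨dA', dB', -⟩ := dF'.pi_inv
    obtain ⟨b, b', ht⟩ := (ih₂ hΓ).1 rfl dA
    replace b' := b'.conv_type hΓ hA.symm dA'
    obtain ⟨C', hs', hC⟩ := hs.exists_of_cv hB.symm ht dB' b'.rtyped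
    exact ⟨C', a.app b hs, a'.app b' hs', hn.app ht, hC, hs.rtyped_one b.rtyped dB,
      hs'.rtyped_one b'.rtyped dB'⟩
  | @ite _ n n' _ _ _ _ _ _ _ _ _ _ _ hs₁ _ hs₂ _ hs₃ ih₁ ih₂ ih₃ ih₄ =>
    refine fun hΓ => ⟨nofun, fun _ => ?_⟩
    obtain ⟨F, a, a', hn, hF, -, -⟩ := (ih₁ hΓ).2 rfl
    cases hF.symm.eq_bool
    obtain ⟨b, b', hA⟩ := (ih₂ (hΓ.cons .bool)).1 rfl .univ
    have dA := b.rtyped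
    have dA' := b'.rtyped
    obtain ⟨At, hs₁', hAt⟩ := hs₁.exists_of_cv hA (.refl _) (A := .bool) dA' .tt
    obtain ⟨Af, hs₂', hAf⟩ := hs₂.exists_of_cv hA (.refl _) (A := .bool) dA' .ff
    obtain ⟨C, hs₃', hC⟩ := hs₃.exists_of_cv (t' := Exp.neu n') hA hn (A := .bool) dA' a'.rtyped
    obtain ⟨t₁, t₂, ht⟩ := (ih₃ hΓ).1 rfl (hs₁.rtyped_one (A := .bool) .tt dA)
    obtain ⟨u₁, u₂, hu⟩ := (ih₄ hΓ).1 rfl (hs₂.rtyped_one (A := .bool) .ff dA)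
    exact ⟨C, a.ite b hs₁ t₁ hs₂ u₁ hs₃,
      a'.ite b' hs₁' (t₂.conv_type hΓ hAt (hs₁'.rtyped_one (A := .bool) .tt dA')) hs₂'
        (u₂.conv_type hΓ hAf (hs₂'.rtyped_one (A := .bool) .ff dA')) hs₃',
      hn.ite hA ht hu, hC, hs₃.rtyped_one (A := .bool) a.rtyped dA,
      hs₃'.rtyped_one (A := .bool) a'.rtyped dA'⟩

theorem Conv.tm_algTyped {Γ : Ctx} {t u A : Tm} (h : Conv [] Γ t u A) (hΓ : CtxTyped Γ)
    (dA : RTyped (rawCtx Γ) A.raw .univ) : AlgTyped Γ t A ∧ AlgTyped Γ u A ∧ Cv t.raw u.raw :=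
  (h.algTyped hΓ).1 rfl dA

theorem Typed.algTyped {c : Cls} {Γ : Ctx} {t : Exp c} {A : Tm} (h : Typed [] Γ t A) :
    CtxTyped Γ → (c = .tm → RTyped (rawCtx Γ) A.raw .univ → AlgTyped Γ t A) ∧
      (c = .ne → AlgTyped Γ t A ∧ RTyped (rawCtx Γ) A.raw .univ) := by
  induction h with
  | univ => exact fun _ => ⟨fun _ _ => .univ, nofun⟩
  | bool => exact fun _ => ⟨fun _ _ => .bool, nofun⟩
  | tt => exact fun _ => ⟨fun _ _ => .tt, nofun⟩
  | ff => exact fun _ => ⟨fun _ _ => .ff, nofun⟩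
  | pi _ _ ih₁ ih₂ =>
    refine fun hΓ => ⟨fun _ _ => ?_, nofun⟩
    have a := (ih₁ hΓ).1 rfl .univ
    exact a.pi ((ih₂ (hΓ.cons a.rtyped)).1 rfl .univ)
  | lam _ ih =>
    refine fun hΓ => ⟨fun _ d => ?_, nofun⟩
    obtain ⟨dA, dB, -⟩ := d.pi_inv
    exact .lam ((ih (hΓ.cons dA)).1 rfl dB)
  | neu _ hc ih =>
    refine fun hΓ => ⟨fun _ _ => ?_, nofun⟩
    obtain ⟨b₁, b₂, hB⟩ := hc.tm_algTyped hΓ .univ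
    exact ((ih hΓ).2 rfl).1.neu b₁ b₂ hB
  | @var Γ i A hl =>
    intro hΓ
    have d := hΓ i
    rw [hl.rawCtx] at d
    exact ⟨nofun, fun _ => ⟨.var hl, d⟩⟩
  | mvar h => cases h
  | app _ _ hs ih₁ ih₂ =>
    refine fun hΓ => ⟨nofun, fun _ => ?_⟩
    obtain ⟨a, d⟩ := (ih₁ hΓ).2 rfl
    obtain ⟨dA, dB, -⟩ := d.pi_inv
    have b := (ih₂ hΓ).1 rfl dA
    exact ⟨a.app b hs, hs.rtyped_one b.rtyped dB⟩
  | ite _ _ hs₁ _ hs₂ _ hs₃ ih₁ ih₂ ih₃ ih₄ =>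
    refine fun hΓ => ⟨nofun, fun _ => ?_⟩
    have a := ((ih₁ hΓ).2 rfl).1
    have b := (ih₂ (hΓ.cons .bool)).1 rfl .univ
    exact ⟨a.ite b hs₁ ((ih₃ hΓ).1 rfl (hs₁.rtyped_one (A := .bool) .tt b.rtyped)) hs₂
      ((ih₄ hΓ).1 rfl (hs₂.rtyped_one (A := .bool) .ff b.rtyped)) hs₃,
      hs₃.rtyped_one (A := .bool) a.rtyped b.rtyped⟩

theorem Typed.tm_algTyped {Γ : Ctx} {t A : Tm} (h : Typed [] Γ t A) (hΓ : CtxTyped Γ)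
    (dA : RTyped (rawCtx Γ) A.raw .univ) : AlgTyped Γ t A :=
  (h.algTyped hΓ).1 rfl dA

theorem Conv.rename {c : Cls} {Γ : Ctx} {t u : Exp c} {A : Tm} (h : Conv [] Γ t u A) :
    ∀ {Δ : Ctx} {ρ : ℕ → ℕ}, RenOk Γ Δ ρ → Conv [] Δ (t.rename ρ) (u.rename ρ) (A.rename ρ) := by
  induction h with
  | univ => intros; exact .univ
  | bool => intros; exact .bool
  | tt => intros; exact .tt
  | ff => intros; exact .ff
  | pi _ _ ih₁ ih₂ => intro Δ ρ h; exact .pi (ih₁ h) (ih₂ (h.lift _))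
  | eta hf hg _ ih =>
    intro Δ ρ h
    have hf' := hf.rename (liftRen ρ)
    have hg' := hg.rename (liftRen ρ)
    rw [Exp.shift_rename] at hf' hg'
    exact .eta hf' hg' (ih (h.lift _))
  | neu _ _ ih₁ ih₂ => intro Δ ρ h; exact .neu (ih₁ h) (ih₂ h)
  | var hl => intro Δ ρ h; exact .var (h _ _ hl)
  | mvar h => cases h
  | app _ _ hs ih₁ ih₂ => intro Δ ρ h; exact .app (ih₁ h) (ih₂ h) (hs.rename_one ρ)
  | ite _ _ h₁ _ h₂ _ h₃ ih₁ ih₂ ih₃ ih₄ =>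
    intro Δ ρ h
    exact .ite (ih₁ h) (ih₂ (h.lift _)) (h₁.rename_one ρ) (ih₃ h) (h₂.rename_one ρ) (ih₄ h)
      (h₃.rename_one ρ)

/-- Serves to move the value of a metavariable, typed in the empty context, into the instantiated
context. -/
theorem Typed.rename {c : Cls} {Γ : Ctx} {t : Exp c} {A : Tm} (h : Typed [] Γ t A) :
    ∀ {Δ : Ctx} {ρ : ℕ → ℕ}, RenOk Γ Δ ρ → Typed [] Δ (t.rename ρ) (A.rename ρ) := by
  induction h with
  | univ => intros; exact .univ
  | bool => intros; exact .bool
  | tt => intros; exact .tt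
  | ff => intros; exact .ff
  | pi _ _ ih₁ ih₂ => intro Δ ρ h; exact .pi (ih₁ h) (ih₂ (h.lift _))
  | lam _ ih => intro Δ ρ h; exact .lam (ih (h.lift _))
  | neu _ hc ih => intro Δ ρ h; exact .neu (ih h) (hc.rename h)
  | var hl => intro Δ ρ h; exact .var (h _ _ hl)
  | mvar h => cases h
  | app _ _ hs ih₁ ih₂ => intro Δ ρ h; exact .app (ih₁ h) (ih₂ h) (hs.rename_one ρ)
  | ite _ _ h₁ _ h₂ _ h₃ ih₁ ih₂ ih₃ ih₄ =>
    intro Δ ρ h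
    exact .ite (ih₁ h) (ih₂ (h.lift _)) (h₁.rename_one ρ) (ih₃ h) (h₂.rename_one ρ) (ih₄ h)
      (h₃.rename_one ρ)

theorem CtxOk.ctxTyped {Γ : Ctx} (h : CtxOk [] Γ) : CtxTyped Γ := by
  induction h with
  | nil => exact .nil
  | cons _ h ih => exact ih.cons (h.tm_algTyped ih .univ).rtyped


/-! ### Instantiation of metavariables -/

theorem Exp.Scoped.rename_eq {c : Cls} {t : Exp c} {M : Set ℕ} : ∀ {k : ℕ} {ρ : ℕ → ℕ},
    t.Scoped M k → (∀ i < k, ρ i = i) → t.rename ρ = t := by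
  have lift : ∀ {k : ℕ} {ρ : ℕ → ℕ}, (∀ i < k, ρ i = i) → ∀ i < k + 1, liftRen ρ i = i := by
    intro k ρ h i hi
    cases i with
    | zero => rfl
    | succ i => exact congrArg _ (h i (by omega))
  induction t with
  | pi A B ih₁ ih₂ =>
    intro k ρ h hρ
    simp only [Exp.Scoped] at h
    simp only [Exp.rename, ih₁ h.1 hρ, ih₂ h.2 (lift hρ)]
  | lam t ih =>
    intro k ρ h hρ
    simp only [Exp.Scoped] at h
    simp only [Exp.rename, ih h (lift hρ)]
  | neu n ih =>
    intro k ρ h hρ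
    simp only [Exp.Scoped] at h
    simp only [Exp.rename, ih h hρ]
  | var i =>
    intro k ρ h hρ
    simp only [Exp.Scoped] at h
    simp only [Exp.rename, hρ i h]
  | app n t ih₁ ih₂ =>
    intro k ρ h hρ
    simp only [Exp.Scoped] at h
    simp only [Exp.rename, ih₁ h.1 hρ, ih₂ h.2 hρ]
  | ite n A t u ih₁ ih₂ ih₃ ih₄ =>
    intro k ρ h hρ
    simp only [Exp.Scoped] at h
    simp only [Exp.rename, ih₁ h.1 hρ, ih₂ h.2.1 (lift hρ), ih₃ h.2.2.1 hρ, ih₄ h.2.2.2 hρ]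
  | _ => intros; rfl

/-- The values are closed, hence fixed by weakening, so one and the same substitution acts at every
depth of binders. -/
theorem MSub.Closing.toSub_lift {σ : MSub} (h : σ.Closing) : σ.toSub.lift = σ.toSub := by
  have hv : σ.toSub.lift.var = σ.toSub.var := by
    funext i
    cases i <;> rfl
  have hm : σ.toSub.lift.mvar = σ.toSub.mvar := by
    funext α
    show ((σ α).getD _).shift = (σ α).getD _
    -- Outside the domain the default value is the metavariable itself, which contains no variable.
    cases e : σ α with
    | none => rfl
    | some u => exact (h α u e).rename_eq nofun
  calc σ.toSub.lift = ⟨σ.toSub.lift.var, σ.toSub.lift.mvar⟩ := rfl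
    _ = σ.toSub := by rw [hv, hm]

theorem HSub.shift_inst {c : Cls} {σ : MSub} (h : σ.Closing) {t : Exp c} {r : Tm}
    (ht : HSub σ.toSub t r) : HSub σ.toSub t.shift r.shift := by
  have := ht.shift
  rwa [h.toSub_lift] at this

theorem MSub.InstCtx.det {σ : MSub} {Γ Γ₁ Γ₂ : Ctx} (h₁ : σ.InstCtx Γ Γ₁) (h₂ : σ.InstCtx Γ Γ₂) :
    Γ₁ = Γ₂ := by
  induction h₁ generalizing Γ₂ with
  | nil => cases h₂; rfl
  | cons h _ ih =>
    cases h₂ with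
    | cons h' h₂ => rw [HSub.det h h', ih h₂]

theorem Lookup.exists_inst {σ : MSub} (h : σ.Closing) {Γ Γσ : Ctx} {i : ℕ} {A : Tm}
    (hl : Lookup Γ i A) (hΓ : σ.InstCtx Γ Γσ) : ∃ A', Lookup Γσ i A' ∧ σ.Inst A A' := by
  induction hl generalizing Γσ with
  | zero =>
    cases hΓ with
    | cons hA _ => exact ⟨_, .zero, HSub.shift_inst h hA⟩
  | succ _ ih =>
    cases hΓ with
    | cons _ hΓ =>
      obtain ⟨A', hl, hA⟩ := ih hΓ
      exact ⟨_, .succ hl, HSub.shift_inst h hA⟩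

/-- A family of types `α (Γ, x)` is the body of the eta-expansion of `α Γ`, so instantiating `x`
amounts to applying `α Γ`. -/
theorem mvApp_cons (α : ℕ) (X : Tm) (Γ : Ctx) :
    ∃ g : Ne, mvApp α Γ = .neu g ∧ mvApp α (X :: Γ) = .neu (.app g.shift (.neu (.var 0))) := by
  refine ⟨_, rfl, ?_⟩
  have : ∀ l : List ℕ,
      (l.map Nat.succ).foldr (fun i n => Exp.app n (.neu (.var i))) (Exp.mvar α) =
        (l.foldr (fun i n => Exp.app n (.neu (.var i))) (Exp.mvar α)).shift := by
    intro l
    induction l with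
    | nil => rfl
    | cons i l ih => simp only [List.map_cons, List.foldr_cons, ih]; rfl
  simp only [mvApp, List.length_cons, List.range_succ_eq_map, List.foldr_cons, this]

/-- Instantiation commutes with substitution in a metavariable. -/
theorem HSub.one_mvApp_inst {σ : MSub} (h : σ.Closing) {α : ℕ} {X : Tm} {Γ : Ctx}
    {v A B' v' A' : Tm} (hA : HSub (.one v) (mvApp α (X :: Γ)) A)
    (hB' : σ.Inst (mvApp α (X :: Γ)) B') (hv' : σ.Inst v v') (hA' : σ.Inst A A') :
    HSub (.one v') B' A' := by
  obtain ⟨g, -, e⟩ := mvApp_cons α X Γ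
  rw [e] at hA hB'
  cases hA with
  | neu hA =>
  cases hA with
  | app hg h0 hA =>
  cases hg.det (.shift_one g v)
  cases h0 with
  | neu h0 =>
  cases h0
  cases appElim_neu.1 hA
  cases hA' with
  | neu hA' =>
  cases hA' with
  | app hg' hv hA' =>
  cases hv.det hv'
  cases hB' with
  | neu hB' =>
  cases hB' with
  | app hg hx hB' =>
  cases hg.det (hg'.shift_inst h)
  cases hx with
  | neu hx =>
  cases hx
  -- With `f` the instance of `α Γ`, the body `B'` is `f x` and `A'` is `f v'`. Only this special
  -- shape makes the two partial operations commute without a typing argument.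
  exact AppElim.hsub_one hB' hA'

/-- Extension of a signature by declarations of new names. -/
def Sig.Ext (S Ξ : Sig) : Prop :=
  S.dom ⊆ Ξ.dom ∧ ∀ α A, (α, A) ∈ Ξ → α ∈ S.dom → (α, A) ∈ S

theorem Sig.Ext.refl (S : Sig) : S.Ext S := ⟨subset_rfl, fun _ _ h _ => h⟩

theorem Sig.Ext.trans {S₁ S₂ S₃ : Sig} (h₁ : S₁.Ext S₂) (h₂ : S₂.Ext S₃) : S₁.Ext S₃ :=
  ⟨h₁.1.trans h₂.1, fun α A h hα => h₁.2 α A (h₂.2 α A h (h₁.1 hα)) hα⟩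

theorem Sig.Ext.add {S : Sig} {α : ℕ} (h : α ∉ S.dom) (Γ : Ctx) (A : Tm) : S.Ext (S.add α Γ A) := by
  refine ⟨fun β ⟨B, hB⟩ => ⟨B, .tail _ hB⟩, fun β B hB hβ => ?_⟩
  cases hB with
  | head => exact (h hβ).elim
  | tail _ hB => exact hB

theorem Infer.ext {S Ξ : Sig} {Γ : Ctx} {t t' A : Tm} {C : Set Constraint}
    (h : Infer S Γ t Ξ C t' A) : S.Ext Ξ := by
  induction h using Infer.rec (motive_2 := fun S _ _ _ Ξ _ _ _ => S.Ext Ξ) with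
  | univ | bool | tt | ff | var | mvar => exact .refl _
  | pi _ _ ih₁ ih₂ => exact ih₁.trans ih₂
  | lam h₁ e₁ h₂ e₂ _ ih => subst e₁ e₂; exact ((Sig.Ext.add h₁ _ _).trans (.add h₂ _ _)).trans ih
  | app h₁ e₁ h₂ e₂ _ _ _ _ ih₁ ih₂ =>
    subst e₁ e₂
    exact ((Sig.Ext.add h₁ _ _).trans (.add h₂ _ _)).trans (ih₁.trans ih₂)
  | ite _ _ _ _ _ _ _ _ ih₁ ih₂ ih₃ ih₄ => exact (ih₁.trans ih₂).trans (ih₃.trans ih₄)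
  | mk _ h ih => exact ih.trans (.add h _ _)

theorem Check.ext {S Ξ : Sig} {Γ : Ctx} {t t' A : Tm} {C : Set Constraint}
    (h : Check S Γ t A Ξ C t') : S.Ext Ξ := by
  cases h with
  | mk h hα => exact h.ext.trans (.add hα _ _)

theorem Check.exists_eq {S Ξ : Sig} {Γ : Ctx} {t t' A : Tm} {C : Set Constraint}
    (h : Check S Γ t A Ξ C t') : ∃ α, t' = mvApp α Γ := by
  cases h with
  | mk => exact ⟨_, rfl⟩

theorem MSub.Solves.mono {σ : MSub} {C C' : Set Constraint} (h : σ.Solves C') (hC : C ⊆ C') :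
    σ.Solves C :=
  fun c hc => h c (hC hc)

/-! ### Soundness of elaboration -/

/-- Soundness of an elaboration in inference mode, for a substitution that is well typed on the
signature `S₀`. -/
def InferSound (σ : MSub) (S₀ S : Sig) (Γ : Ctx) (t : Tm) (C : Set Constraint) (t' A : Tm) : Prop :=
  S₀.Ext S → t.Scoped S₀.dom Γ.length → σ.Solves C → ∀ {Γσ : Ctx} {tσ t'σ Aσ : Tm},
    σ.InstCtx Γ Γσ → σ.Inst t tσ → σ.Inst t' t'σ → σ.Inst A Aσ → CtxTyped Γσ →
    AlgTyped Γσ Aσ .univ →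
    (∀ n u b, t = .neu (.app n u) → HSub σ.toSub n (.lam b) → AlgTyped Γσ t'σ Aσ) →
    AlgTyped Γσ tσ Aσ ∧ AlgTyped Γσ t'σ Aσ ∧ Cv tσ.raw t'σ.raw

/-- Soundness of an elaboration in checking mode, for a substitution that is well typed on the
signature `S₀`. -/
def CheckSound (σ : MSub) (S₀ S : Sig) (Γ : Ctx) (t A : Tm) (C : Set Constraint) (t' : Tm) : Prop :=
  S₀.Ext S → t.Scoped S₀.dom Γ.length → σ.Solves C → ∀ {Γσ : Ctx} {tσ : Tm},
    σ.InstCtx Γ Γσ → σ.Inst t tσ → CtxTyped Γσ → ∃ t'σ Aσ, σ.Inst t' t'σ ∧ σ.Inst A Aσ ∧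
      AlgTyped Γσ Aσ .univ ∧ AlgTyped Γσ tσ Aσ ∧ AlgTyped Γσ t'σ Aσ ∧ Cv tσ.raw t'σ.raw

/-- The solved constraint supplies everything that inference assumes: definedness of the instances,
well-formedness of the inferred type and, for applications, the typing of the elaborated term. Its
equation of types then moves the result to the expected type. -/
theorem InferSound.check {σ : MSub} {S₀ S : Sig} {Γ : Ctx} {t t' A B : Tm} {C : Set Constraint}
    {α : ℕ} (h : InferSound σ S₀ S Γ t C t' B) :
    CheckSound σ S₀ S Γ t A (insert ⟨Γ, t', B, mvApp α Γ, A⟩ C) (mvApp α Γ) := by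
  intro hS ht hC Γσ tσ hΓ htσ hΓσ
  obtain ⟨Γ', t₁, B₁, u, A₁, hΓ', ht₁, hB₁, hu, hA₁, cBA, ctu⟩ := hC _ (Set.mem_insert _ _)
  cases hΓ.det hΓ'
  obtain ⟨aB, aA, hBA⟩ := cBA.tm_algTyped hΓσ .univ
  obtain ⟨at₁, au, htu⟩ := ctu.tm_algTyped hΓσ aB.rtyped
  obtain ⟨a, -, ht'⟩ := h hS ht (hC.mono (Set.subset_insert _ _)) hΓ htσ ht₁ hB₁ hΓσ aB
    fun _ _ _ _ _ => at₁
  exact ⟨u, A₁, hu, hA₁, aA, a.conv_type hΓσ hBA aA.rtyped, au.conv_type hΓσ hBA aA.rtyped,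
    ht'.trans htu⟩

/-- Both instances are declaratively typed and convertible, so an algorithmic typing of one of them
suffices. When the function instance is an abstraction it is given for the elaborated term; when it
is neutral it is built for the source term. -/
theorem infer_sound_app {σ : MSub} (hσ : σ.Closing) {S₀ S₂ S₃ : Sig} {Γ : Ctx}
    {β γ δ ε : ℕ} {n : Ne}
    {u r A X : Tm} {C₁ C₂ : Set Constraint}
    (ih₁ : CheckSound σ S₀ S₂ Γ (.neu n) (.pi (mvApp β Γ) (mvApp γ (X :: Γ))) C₁ (mvApp δ Γ))
    (ih₂ : CheckSound σ S₀ S₃ Γ u (mvApp β Γ) C₂ (mvApp ε Γ))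
    (hr : AppElim (mvApp δ Γ) (mvApp ε Γ) r)
    (hA : HSub (.one (mvApp ε Γ)) (mvApp γ (X :: Γ)) A)
    (hS₂ : S₀.Ext S₂) (hS₃ : S₀.Ext S₃) (ht : (Exp.neu (.app n u)).Scoped S₀.dom Γ.length)
    (hC₁ : σ.Solves C₁) (hC₂ : σ.Solves C₂) {Γσ : Ctx} {tσ t'σ Aσ : Tm}
    (hΓ : σ.InstCtx Γ Γσ) (htσ : σ.Inst (.neu (.app n u)) tσ) (ht'σ : σ.Inst r t'σ)
    (hAσ : σ.Inst A Aσ) (hΓσ : CtxTyped Γσ) (aA : AlgTyped Γσ Aσ .univ)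
    (happ : ∀ b, HSub σ.toSub n (.lam b) → AlgTyped Γσ t'σ Aσ) :
    AlgTyped Γσ tσ Aσ ∧ AlgTyped Γσ t'σ Aσ ∧ Cv tσ.raw t'σ.raw := by
  simp only [Exp.Scoped] at ht
  cases htσ with
  | neu htσ =>
  cases htσ with
  | @app _ _ _ f a _ hf ha htσ =>
  cases appElim_neu.1 hr
  cases ht'σ with
  | neu ht'σ =>
  cases ht'σ with
  | @app _ _ _ f' a' _ hf' ha' ht'σ =>
  obtain ⟨_, F, hf'', hF, aF, tf, tf', cf⟩ := ih₁ hS₂ ht.1 hC₁ hΓ (.neu hf) hΓσ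
  cases hf''.det (.neu hf')
  cases hF with
  | @pi _ _ _ B G hB hG =>
  rw [hσ.toSub_lift] at hG
  obtain ⟨_, _, ha'', hB', aB, ta, ta', ca⟩ := ih₂ hS₃ ht.2 hC₂ hΓ ha hΓσ
  cases ha''.det ha'
  cases hB'.det hB
  have hs : HSub (.one a') G Aσ := hA.one_mvApp_inst hσ hG ha' hAσ
  have d : RTyped (rawCtx Γσ) tσ.raw Aσ.raw :=
    (htσ.rtyped tf.rtyped ta.rtyped).conv (.trans (.subst_one (.refl _) ca) hs.cv_one)
  have d' : RTyped (rawCtx Γσ) t'σ.raw Aσ.raw := (ht'σ.rtyped tf'.rtyped ta'.rtyped).conv hs.cv_one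
  have c : Cv tσ.raw t'σ.raw := htσ.cv.symm.trans ((cf.app ca).trans ht'σ.cv)
  suffices AlgTyped Γσ tσ Aσ ∨ AlgTyped Γσ t'σ Aσ by
    rcases this with h | h
    · exact ⟨h, h.conv_term hΓσ aA.rtyped c d', c⟩
    · exact ⟨h.conv_term hΓσ aA.rtyped c.symm d, h, c⟩
  cases f with
  | lam b => exact .inr (happ b hf)
  | neu m =>
    cases appElim_neu.1 htσ
    obtain ⟨_, hm, hT, cT⟩ := tf.neu_inv
    obtain ⟨T₁, T₂, rfl, cT₁, cT₂⟩ := cT.eq_pi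
    obtain ⟨aT₁, aT₂⟩ := hT.pi_inv
    replace ta := ta.conv_type hΓσ cT₁.symm aT₁.rtyped
    -- The neutral function infers its own codomain `T₂`, which must be instantiated by the source
    -- argument `a`. The instance exists because that of the convertible `G` by `a'` does.
    obtain ⟨T, hT, cT⟩ := hs.exists_of_cv cT₂.symm ca.symm aT₂.rtyped ta.rtyped
    have aT := aA.conv_term hΓσ .univ cT (hT.rtyped_one ta.rtyped aT₂.rtyped)
    exact .inl (.neu (.app hm ta hT) aT aA cT.symm)
  | _ => cases htσ

/-- Unlike an application, a conditional that reduces yields one of its branches, whose typing comes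
from the induction hypothesis. Hence no extra assumption is needed. -/
theorem infer_sound_ite {σ : MSub} (hσ : σ.Closing) {S₀ S S₁ S₂ S₃ : Sig} {Γ : Ctx}
    {α δ : ℕ} {n : Ne}
    {B u v u' v' Bt Bf r A : Tm} {C₁ C₂ C₃ C₄ : Set Constraint}
    (ih₁ : CheckSound σ S₀ S (.bool :: Γ) B .univ C₁ (mvApp α (.bool :: Γ)))
    (ih₂ : CheckSound σ S₀ S₁ Γ (.neu n) .bool C₂ (mvApp δ Γ))
    (hBt : HSub (.one .tt) (mvApp α (.bool :: Γ)) Bt) (ih₃ : CheckSound σ S₀ S₂ Γ u Bt C₃ u')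
    (hBf : HSub (.one .ff) (mvApp α (.bool :: Γ)) Bf) (ih₄ : CheckSound σ S₀ S₃ Γ v Bf C₄ v')
    (hr : IfElim (mvApp δ Γ) (mvApp α (.bool :: Γ)) u' v' r)
    (hA : HSub (.one (mvApp δ Γ)) (mvApp α (.bool :: Γ)) A)
    (hS : S₀.Ext S) (hS₁ : S₀.Ext S₁) (hS₂ : S₀.Ext S₂) (hS₃ : S₀.Ext S₃)
    (ht : (Exp.neu (.ite n B u v)).Scoped S₀.dom Γ.length)
    (hC₁ : σ.Solves C₁) (hC₂ : σ.Solves C₂) (hC₃ : σ.Solves C₃) (hC₄ : σ.Solves C₄)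
    {Γσ : Ctx} {tσ t'σ Aσ : Tm}
    (hΓ : σ.InstCtx Γ Γσ) (htσ : σ.Inst (.neu (.ite n B u v)) tσ) (ht'σ : σ.Inst r t'σ)
    (hAσ : σ.Inst A Aσ) (hΓσ : CtxTyped Γσ) (aA : AlgTyped Γσ Aσ .univ) :
    AlgTyped Γσ tσ Aσ ∧ AlgTyped Γσ t'σ Aσ ∧ Cv tσ.raw t'σ.raw := by
  simp only [Exp.Scoped] at ht
  obtain ⟨htn, htB, htu, htv⟩ := ht
  cases htσ with
  | neu htσ =>
  cases htσ with
  | @ite _ _ _ _ _ w D y z _ hw hD hy hz htσ =>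
  cases hr with
  | neu =>
  cases ht'σ with
  | neu ht'σ =>
  cases ht'σ with
  | @ite _ _ _ _ _ w' D' y' z' _ hw' hD' hy' hz' ht'σ =>
  rw [hσ.toSub_lift] at hD hD'
  obtain ⟨_, _, hD'', hU, -, tD, tD', cD⟩ := ih₁ hS htB hC₁ (.cons .bool hΓ) hD (hΓσ.cons .bool)
  cases hU
  cases hD''.det hD'
  obtain ⟨_, _, hw'', hU, -, tw, tw', cw⟩ := ih₂ hS₁ htn hC₂ hΓ (.neu hw) hΓσ
  cases hU
  cases hw''.det (.neu hw')
  obtain ⟨_, Btσ, hy'', hBtσ, -, ty, ty', cy⟩ := ih₃ hS₂ htu hC₃ hΓ hy hΓσ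
  cases hy''.det hy'
  obtain ⟨_, Bfσ, hz'', hBfσ, -, tz, tz', cz⟩ := ih₄ hS₃ htv hC₄ hΓ hz hΓσ
  cases hz''.det hz'
  have st : HSub (.one .tt) D' Btσ := hBt.one_mvApp_inst hσ hD' .tt hBtσ
  have sf : HSub (.one .ff) D' Bfσ := hBf.one_mvApp_inst hσ hD' .ff hBfσ
  have s : HSub (.one w') D' Aσ := hA.one_mvApp_inst hσ hD' (.neu hw') hAσ
  cases ht'σ with
  | tt =>
    cases cw.eq_tt
    cases htσ
    cases s.det st
    exact ⟨ty, ty', cy⟩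
  | ff =>
    cases cw.eq_ff
    cases htσ
    cases s.det sf
    exact ⟨tz, tz', cz⟩
  | @neu m' =>
    -- The elaborated side is typed first, because the required instances of its motive `D'` are
    -- known to exist; the source side follows by conversion.
    have a : AlgTyped Γσ (.neu (.ite m' D' y' z')) Aσ := by
      obtain ⟨_, hm, -, c⟩ := tw'.neu_inv
      cases c.eq_bool
      exact .neu (.ite hm tD' st ty' sf tz' s) aA aA (.refl _)
    have c : Cv tσ.raw (Exp.neu (.ite m' D' y' z')).raw := htσ.cv.symm.trans (cw.ite cD cy cz)
    refine ⟨a.conv_term hΓσ aA.rtyped c.symm ?_, a, c⟩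
    cases htσ with
    | neu =>
      have d := RTyped.ite tw.rtyped tD.rtyped
        (ty.rtyped.conv (.symm (.trans (.subst_one cD (.refl _)) st.cv_one)))
        (tz.rtyped.conv (.symm (.trans (.subst_one cD (.refl _)) sf.cv_one)))
      exact d.conv (.trans (.subst_one cD cw) s.cv_one)
    -- A source scrutinee `tt` or `ff` is not convertible to a neutral term.
    | _ => cases cw.kind

theorem Infer.sound {σ : MSub} (hσ : σ.Closing) {S₀ : Sig} (hσS : σ.WellTyped S₀) {S Ξ : Sig}
    {Γ : Ctx} {t t' A : Tm} {C : Set Constraint} (h : Infer S Γ t Ξ C t' A) :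
    InferSound σ S₀ S Γ t C t' A := by
  induction h using Infer.rec
    (motive_2 := fun S Γ t A _ C t' _ => CheckSound σ S₀ S Γ t A C t') with
  | univ =>
    intro _ _ _ Γσ tσ t'σ Aσ _ ht ht' hA _ _ _
    cases ht; cases ht'; cases hA
    exact ⟨.univ, .univ, .refl _⟩
  | bool =>
    intro _ _ _ Γσ tσ t'σ Aσ _ ht ht' hA _ _ _
    cases ht; cases ht'; cases hA
    exact ⟨.bool, .bool, .refl _⟩
  | tt =>
    intro _ _ _ Γσ tσ t'σ Aσ _ ht ht' hA _ _ _
    cases ht; cases ht'; cases hA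
    exact ⟨.tt, .tt, .refl _⟩
  | ff =>
    intro _ _ _ Γσ tσ t'σ Aσ _ ht ht' hA _ _ _
    cases ht; cases ht'; cases hA
    exact ⟨.ff, .ff, .refl _⟩
  | pi hA hB ih₁ ih₂ =>
    intro hS hs hC Γσ tσ t'σ Aσ hΓ ht ht' hU hΓσ _ _
    simp only [Exp.Scoped] at hs
    cases hU
    cases ht with
    | pi h₁ h₂ =>
    cases ht' with
    | pi h₁' h₂' =>
    rw [hσ.toSub_lift] at h₂ h₂'
    obtain ⟨_, _, k₁, hU, -, a₁, a₁', c₁⟩ :=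
      ih₁ hS hs.1 (hC.mono Set.subset_union_left) hΓ h₁ hΓσ
    cases hU
    cases k₁.det h₁'
    obtain ⟨_, _, k₂, hU, -, a₂, a₂', c₂⟩ :=
      ih₂ (hS.trans hA.ext) hs.2 (hC.mono Set.subset_union_right) (.cons h₁' hΓ) h₂
        (hΓσ.cons a₁'.rtyped)
    cases hU
    cases k₂.det h₂'
    -- The codomain was elaborated over the elaborated domain; the source codomain is moved over the
    -- convertible source domain.
    exact ⟨a₁.pi (a₂.conv_cons hΓσ c₁.symm a₁.rtyped .univ), a₁'.pi a₂', c₁.pi c₂⟩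
  | lam h₁ e₁ h₂ e₂ _ ih =>
    subst e₁ e₂
    intro hS hs hC Γσ tσ t'σ Aσ hΓ ht ht' hA hΓσ aA _
    simp only [Exp.Scoped] at hs
    cases ht with
    | lam ht =>
    cases ht' with
    | lam ht' =>
    cases hA with
    | pi hA hB =>
    rw [hσ.toSub_lift] at ht ht' hB
    obtain ⟨aA, aB⟩ := aA.pi_inv
    obtain ⟨_, _, k₁, k₂, -, a, a', c⟩ := ih ((hS.trans (.add h₁ _ _)).trans (.add h₂ _ _)) hs hC
      (.cons hA hΓ) ht (hΓσ.cons aA.rtyped)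
    cases k₁.det ht'
    cases k₂.det hB
    exact ⟨a.lam, a'.lam, c.lam⟩
  | var hl =>
    intro _ _ _ Γσ tσ t'σ Aσ hΓ ht ht' hA _ aA _
    cases ht.det ht'
    cases ht with
    | neu ht =>
    cases ht
    obtain ⟨A', hl', hA'⟩ := hl.exists_inst hσ hΓ
    cases hA'.det hA
    have a : AlgTyped Γσ _ Aσ := .neu (.var hl') aA aA (.refl _)
    exact ⟨a, a, .refl _⟩
  | mvar hα =>
    intro hS hs _ Γσ tσ t'σ Aσ _ ht ht' hA hΓσ aA _
    simp only [Exp.Scoped] at hs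
    cases ht.det ht'
    cases ht with
    | neu ht =>
    cases ht
    -- The term mentions only names of `S₀`, and extensions do not redeclare them, so typing of `σ`
    -- on `S₀` suffices.
    obtain ⟨u, A', e, hA', hu⟩ := hσS _ _ (hS.2 _ _ hα hs)
    cases hA'.det hA
    have a := hu.rename (Δ := Γσ) (ρ := id) nofun
    rw [rename_id, rename_id] at a
    have a := a.tm_algTyped hΓσ aA.rtyped
    simp only [MSub.toSub, e, Option.getD_some]
    exact ⟨a, a, .refl _⟩
  | @app _ _ _ _ _ Γ β _ _ _ _ _ _ _ _ _ h₁ e₁ h₂ e₂ hn hu hr hA ih₁ ih₂ =>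
    subst e₁ e₂
    intro hS hs hC Γσ tσ t'σ Aσ hΓ ht ht' hA' hΓσ aA happ
    obtain ⟨δ, rfl⟩ := hn.exists_eq
    obtain ⟨ε, rfl⟩ := hu.exists_eq
    have hS₂ := (hS.trans (.add h₁ _ _)).trans (.add h₂ (mvApp β Γ :: Γ) .univ)
    exact infer_sound_app hσ ih₁ ih₂ hr hA hS₂ (hS₂.trans hn.ext) hs
      (hC.mono Set.subset_union_left) (hC.mono Set.subset_union_right) hΓ ht ht' hA' hΓσ aA
      fun b => happ _ _ b rfl
  | ite hB hn hBt hu hBf hv hr hA ih₁ ih₂ ih₃ ih₄ =>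
    intro hS hs hC Γσ tσ t'σ Aσ hΓ ht ht' hA' hΓσ aA _
    obtain ⟨α, rfl⟩ := hB.exists_eq
    obtain ⟨δ, rfl⟩ := hn.exists_eq
    have hS₁ := hS.trans hB.ext
    have hS₂ := hS₁.trans hn.ext
    exact infer_sound_ite hσ ih₁ ih₂ hBt ih₃ hBf ih₄ hr hA hS hS₁ hS₂ (hS₂.trans hu.ext) hs
      (hC.mono fun _ h => .inl (.inl (.inl h))) (hC.mono fun _ h => .inl (.inl (.inr h)))
      (hC.mono fun _ h => .inl (.inr h)) (hC.mono fun _ h => .inr h) hΓ ht ht' hA' hΓσ aA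
  | mk _ _ ih => exact ih.check

theorem Check.sound {σ : MSub} (hσ : σ.Closing) {S₀ : Sig} (hσS : σ.WellTyped S₀) {S Ξ : Sig}
    {Γ : Ctx} {t t' A : Tm} {C : Set Constraint} (h : Check S Γ t A Ξ C t') :
    CheckSound σ S₀ S Γ t A C t' := by
  cases h with
  | mk h _ => exact (h.sound hσ hσS).check

end TCU

-- Strong soundness of elaboration

theorem mainTheorem3 (S Ξ : TCU.Sig) (Γ Γσ : TCU.Ctx) (t t' A tσ t'σ Aσ : TCU.Tm)
    (C : Set TCU.Constraint) (σ : TCU.MSub)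
    (hS : TCU.SigOk S) (hΓ : TCU.CtxOk S Γ) (ht : t.Scoped S.dom Γ.length)
    (hclosing : σ.Closing) (hdom : Ξ.dom ⊆ σ.dom) (hσS : σ.WellTyped S) (hsolves : σ.Solves C)
    (hΓσ : σ.InstCtx Γ Γσ) (htσ : σ.Inst t tσ) (ht'σ : σ.Inst t' t'σ) (hAσ : σ.Inst A Aσ)
    (hΓσ_ok : TCU.CtxOk [] Γσ) :
    (TCU.Infer S Γ t Ξ C t' A →
      TCU.Typed [] Γσ Aσ TCU.Exp.univ →
      (∀ n u b, t = TCU.Exp.neu (TCU.Exp.app n u) → TCU.HSub σ.toSub n (TCU.Exp.lam b) →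
        TCU.Typed [] Γσ t'σ Aσ) →
      TCU.Conv [] Γσ tσ t'σ Aσ) ∧
    (TCU.Check S Γ t A Ξ C t' → TCU.Conv [] Γσ tσ t'σ Aσ) := by
  have hctx := hΓσ_ok.ctxTyped
  constructor
  · intro h hA happ
    have aA := hA.tm_algTyped hctx .univ
    obtain ⟨a, a', c⟩ := h.sound hclosing hσS (.refl S) ht hsolves hΓσ htσ ht'σ hAσ hctx aA
      fun n u b e hn => (happ n u b e hn).tm_algTyped hctx aA.rtyped
    exact a.definitionally_equal hctx aA.rtyped c a'.rtyped
  · intro h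
    obtain ⟨_, _, k, kA, aA, a, a', c⟩ :=
      h.sound hclosing hσS (.refl S) ht hsolves hΓσ htσ hctx
    -- Soundness of checking produces its own instances; determinism identifies them with the given
    -- ones.
    cases k.det ht'σ
    cases kA.det hAσ
    exact a.definitionally_equal hctx aA.rtyped c a'.rtyped
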